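/- **Setting.** Let $n\ge 2$, $K\ge 1$. A causal model consists of a DAG $D$ on variables $X_1,\dots,X_n$ with values in $[K]$ and conditional probabilities $P(X_i\mid \mathrm{Pa}_D(X_i))$; $P$ is the product of these, and $P(\cdot\mid\mathrm{do}(X_j=x))$ is obtained by removing the edges into $X_j$ and fixing $X_j=x$ (Markov condition and causal sufficiency). The reward $\mathbf R$ is directly influenced by exactly one unknown variable $X_R$. In every round the learner chooses $\mathrm{do}()$ or an intervention $\mathrm{do}(X_i=x)$ and observes all variables and the reward. Put $\mu_a=\mathbb E[\mathbf R\mid a]$; $\mu_a\in[0,1]$ for all single-variable interventions, and $\mathbf R-\mu_a$ is 1-sub-Gaussian under every $a$ (including $\mathrm{do}()$). With $\mu^*=\max_{i,x}\mu_{\mathrm{do}(X_i=x)}$, the regret is $R_T=T\mu^*-\sum_{t\le T}\mu_{a_t}$. The essential graph $\mathcal E(D)$ has the skeleton of $D$; an edge is directed if it has the same direction in all DAGs with the same d-separations as $D$, and undirected otherwise. Its chain components are the connected components after removing the directed edges; $C(D)$ is their number and $d$ the maximum of their maximum degrees. **Assumptions.** $D$ is a causal forest, i.e. every chain component of $\mathcal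 E(D)$ is a tree, and 1. $P$ is faithful to $D$: every conditional independence is a d-separation in $D$; 2. for every edge $X_i\to X_j$ of $D$ there are $x,x'$ with $|P(X_j=x\mid\mathrm{do}(X_i=x'))-P(X_j=x)|>\varepsilon$, where $\varepsilon>0$; 3. for every ancestor $X$ of $X_R$ (including $X_R$ itself) there is $x$ with $|\mathbb E[\mathbf R\mid\mathrm{do}()]-\mathbb E[\mathbf R\mid\mathrm{do}(X=x)]|\ge\Delta$, where $\Delta>0$. **Algorithm (CN-UCB for causal forests).** Input: $\mathcal E(D)$, the observational probabilities, $K,\varepsilon,\Delta$, $\delta\in(0,1)$ and the number $T$ of rounds. Let $B=\lceil\max\{\frac{32}{\Delta^2}\log\frac{8nK}{\delta},\frac{2}{\varepsilon^2}\log\frac{8n^2K^2}{\delta}\}\rceil$. Perform $\mathrm{do}()$ $B$ times; let $\hat R$ be the average reward. Below, *testing* $v$ means performing each $\mathrm{do}(v=z)$, $z\in[K]$, $B$ times; $v$ is a *hit* if for some $z$ the average reward differs from $\hat R$ by more than $\Delta/2$, and a neighbour $Y$ is *down* if for some $z,y$ the relative frequency of $Y=y$ under $\mathrm{do}(v=z)$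 differs from $P(Y=y)$ by more than $\varepsilon/2$. The branch of $v$ at a neighbour $Y$ is the set of vertices of the tree reachable from $Y$ after cutting the edge $vY$. A node is central for a candidate set $S$ if none of its branches contains more than $|S|/2$ elements of $S$. Visit the chain components one after the other, in an order in which no directed edge of $\mathcal E(D)$ leads from a component to one visited later. *Stage 1*, in the component $\mathcal T_0$, with $S=V(\mathcal T_0)$: test a central node $v$ of $\mathcal T_0$ for $S$. If it is a hit, go to stage 2 with the tree $\widetilde{\mathcal T}_0$ rooted at $v$ and consisting of $v$ and its branches at down neighbours. Otherwise, keep in $S$ only the elements in branches of $v$ at neighbours that are not down, and repeat; if $S$ becomes empty, go to the next component. *Stage 2*, with $S=V(\widetilde{\mathcal T}_0)$: while $|S|>1$, test a central node $v$ of $\widetilde{\mathcal T}_0$ for $S$. If it is not a hit, keep in $S$ only the elements in the branch of $v$ at its parent. If it is a hit, test all children of $v$; if none is a hit, output $v$, and otherwise keep in $S$ only the elements in the branch of $v$ at (the last) child that is a hit. If $|S|=1$, output its element. *Stage 3*: for all remaining rounds, run UCB on $\{\mathrm{do}(X=k)\mid k\in[K]\}$ for the output $X$, using only the data of this stage: try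 an untried arm if there is one, and otherwise an arm of largest index $\hat\mu_k+\sqrt{2\log(32KT/\delta)/N_k}$, where $\hat\mu_k$ is the average reward of arm $k$ and $N_k$ its number of pulls. The remaining choices (central nodes, order of the children, ties, and the actions if no variable is output) are arbitrary but depend only on the past (possibly with randomization). **Theorem.** Under these assumptions, an order of the chain components as required exists. Moreover there is a universal constant $C>0$ such that for every such order, every $\delta\in(0,1)$ and every $T$, with probability at least $1-\delta$, $$R_T\le C\left(K\max\left\{\tfrac1{\Delta^2},\tfrac1{\varepsilon^2}\right\}(d+C(D))(\log n)^2\,\bigl(1+\log\tfrac K\delta\bigr)+\sqrt{KT\bigl(1+\log\tfrac{KT}\delta\bigr)}\right),$$ that is, $R_T=\widetilde O\bigl(K\max\{\frac1{\Delta^2},\frac1{\varepsilon^2}\}(d+C(D))(\log n)^2+\sqrt{KT}\bigr)$, where $\widetilde O$ hides only logarithmic factors in $K,T,1/\delta$. -/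

import Mathlib

open MeasureTheory ProbabilityTheory

/-! ## Causal graphs and their essential graphs -/

/-- A directed acyclic graph on the variables `0, …, n - 1`. -/
structure DAG (n : ℕ) where
  edge : Fin n → Fin n → Prop
  acyclic : ∀ i, ¬ Relation.TransGen edge i i

namespace DAG

variable {n : ℕ} (D : DAG n)

/-- The undirected graph obtained by forgetting the directions of the edges. -/
def skeleton : SimpleGraph (Fin n) where
  Adj i j := D.edge i j ∨ D.edge j i
  symm := ⟨fun _ _ h => h.symm⟩
  loopless := ⟨fun i h => D.acyclic i (Relation.TransGen.single (h.elim id id))⟩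

/-- `i` is an ancestor of `j`: there is a directed path, possibly of length zero, from `i` to `j`. -/
def IsAncestor (i j : Fin n) : Prop := Relation.ReflTransGen D.edge i j

/-- A trail of the skeleton is active given `C` if every inner vertex of the trail that is a collider
has a descendant in `C` (possibly itself), and no other inner vertex is in `C`. -/
def ActiveTrail (C : Finset (Fin n)) {a b : Fin n} (p : D.skeleton.Walk a b) : Prop :=
  ∀ m, m + 2 ≤ p.length →
    ((D.edge (p.getVert m) (p.getVert (m + 1)) ∧ D.edge (p.getVert (m + 2)) (p.getVert (m + 1))) →
      ∃ c ∈ C, D.IsAncestor (p.getVert (m + 1)) c) ∧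
    (¬ (D.edge (p.getVert m) (p.getVert (m + 1)) ∧
        D.edge (p.getVert (m + 2)) (p.getVert (m + 1))) →
      p.getVert (m + 1) ∉ C)

/-- `A` and `B` are d-separated by `C`: no trail from `A` to `B` is active given `C`. -/
def DSep (A B C : Finset (Fin n)) : Prop :=
  ∀ a ∈ A, ∀ b ∈ B, ∀ p : D.skeleton.Walk a b, ¬ D.ActiveTrail C p

/-- The two graphs encode the same conditional independences. -/
def MarkovEquiv (D D' : DAG n) : Prop :=
  ∀ A B C : Finset (Fin n), Disjoint A B → Disjoint A C → Disjoint B C →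
    (D.DSep A B C ↔ D'.DSep A B C)

end DAG

/-- A graph on `n` vertices with directed edges `dir` and undirected edges `und`. -/
structure MixedGraph (n : ℕ) where
  dir : Fin n → Fin n → Prop
  und : SimpleGraph (Fin n)

namespace MixedGraph

variable {n : ℕ} (E : MixedGraph n)

/-- The chain components: the connected components after removing all directed edges. -/
abbrev ChainComponent : Type := E.und.ConnectedComponent

/-- The number of chain components. -/
noncomputable def numChainComponents : ℕ := Nat.card E.ChainComponent

/-- The largest degree of a vertex within its chain component, i.e. the maximum over the chain
components of their maximum degrees. -/
noncomputable def maxChainDegree : ℕ := Finset.univ.sup fun v => (E.und.neighborSet v).ncard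

/-- `order` lists every chain component exactly once, and no directed edge leads from a component
to a component that is listed later. -/
def SinksFirst (order : List E.ChainComponent) : Prop :=
  order.Nodup ∧ (∀ c, c ∈ order) ∧
    order.Pairwise fun c c' => ∀ i ∈ c.supp, ∀ j ∈ c'.supp, ¬ E.dir i j

end MixedGraph

namespace DAG

variable {n : ℕ} (D : DAG n)

/-- The essential graph: an edge of the skeleton is directed if it has the same direction in all
Markov equivalent DAGs, and undirected otherwise. -/
def essentialGraph : MixedGraph n where
  dir i j := ∀ D', D.MarkovEquiv D' → D'.edge i j
  und :=
    { Adj := fun i j => D.skeleton.Adj i j ∧ (¬ ∀ D', D.MarkovEquiv D' → D'.edge i j) ∧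
        (¬ ∀ D', D.MarkovEquiv D' → D'.edge j i)
      symm := ⟨fun _ _ h => ⟨h.1.symm, h.2.2, h.2.1⟩⟩
      loopless := ⟨fun i h => D.skeleton.loopless.irrefl i h.1⟩ }

/-- Every chain component of the essential graph is a tree. -/
def IsCausalForest : Prop :=
  ∀ c : D.essentialGraph.ChainComponent, (D.essentialGraph.und.induce c.supp).IsTree

end DAG

/-! ## Causal bandits -/

/-- An action: `none` is the empty intervention `do()`, and `some (i, k)` is `do(X_i = k)`. -/
abbrev Intervention (n K : ℕ) : Type := Option (Fin n × Fin K)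

/-- A causal model over `n` variables with values in a set of `K` elements, together with a real
reward that is directly influenced by exactly one variable. There are no latent variables:
`cpd i x k` is the probability of `X_i = k` given that the parents of `X_i` have the values
prescribed by `x`, and the reward has the law `rewardLaw k` given `X_R = k`. -/
structure CausalBandit (n K : ℕ) where
  D : DAG n
  cpd : Fin n → (Fin n → Fin K) → Fin K → ℝ
  cpd_nonneg : ∀ i x k, 0 ≤ cpd i x k
  cpd_sum : ∀ i x, ∑ k, cpd i x k = 1
  cpd_parents : ∀ i x x', (∀ j, D.edge j i → x j = x' j) → cpd i x = cpd i x'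
  rewardVar : Fin n
  rewardLaw : Fin K → Measure ℝ
  rewardLaw_prob : ∀ k, IsProbabilityMeasure (rewardLaw k)

namespace CausalBandit

variable {n K : ℕ} (M : CausalBandit n K)

/-- The joint probability `P(X = x | a)`, factorized over the graph from which the edges into the
intervened variable are removed. -/
def prob : Intervention n K → (Fin n → Fin K) → ℝ
  | none, x => ∏ i, M.cpd i x (x i)
  | some (j, k), x => ∏ i, if i = j then (if x j = k then 1 else 0) else M.cpd i x (x i)

/-- The marginal probability `P(X_i = k | a)`. -/
def marginal (a : Intervention n K) (i : Fin n) (k : Fin K) : ℝ :=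
  ∑ x, if x i = k then M.prob a x else 0

/-- The observational probability `P(X_i = x_i for all i ∈ S)`. -/
def marginalOn (S : Finset (Fin n)) (x : Fin n → Fin K) : ℝ :=
  ∑ x', if ∀ i ∈ S, x' i = x i then M.prob none x' else 0

/-- `X_A` and `X_B` are conditionally independent given `X_C`. -/
def CondIndep (A B C : Finset (Fin n)) : Prop :=
  ∀ x, M.marginalOn (A ∪ B ∪ C) x * M.marginalOn C x
    = M.marginalOn (A ∪ C) x * M.marginalOn (B ∪ C) x

/-- Causal faithfulness: all conditional independences come from the graph. (The converse, and
causal sufficiency, hold for every `CausalBandit`, by the factorizations in `prob`.) -/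
def Faithful : Prop :=
  ∀ A B C : Finset (Fin n), Disjoint A B → Disjoint A C → Disjoint B C →
    M.CondIndep A B C → M.D.DSep A B C

/-- The joint law of the variables and the reward under the action `a`. -/
noncomputable def law (a : Intervention n K) : Measure ((Fin n → Fin K) × ℝ) :=
  ∑ x, ENNReal.ofReal (M.prob a x) • (Measure.dirac x).prod (M.rewardLaw (x M.rewardVar))

/-- The expected reward `μ_a = E[R | a]`. -/
noncomputable def mean (a : Intervention n K) : ℝ := ∫ p, p.2 ∂(M.law a)

/-- The expected rewards are in `[0, 1]`, and the noise `R - μ_a` is `1`-sub-Gaussian. -/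
def RewardModel : Prop :=
  (∀ i k, M.mean (some (i, k)) ∈ Set.Icc (0 : ℝ) 1) ∧
    ∀ a, HasSubgaussianMGF (fun p => p.2 - M.mean a) 1 (M.law a)

/-- Causal effect identifiability with the gap `ε`. -/
def EffectIdentifiable (ε : ℝ) : Prop :=
  ∀ i j, M.D.edge i j → ∃ x x' : Fin K,
    ε < |M.marginal (some (i, x')) j x - M.marginal none j x|

/-- Reward identifiability with the gap `Δ`. -/
def RewardIdentifiable (Δ : ℝ) : Prop :=
  ∀ i, M.D.IsAncestor i M.rewardVar → ∃ x : Fin K,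
    Δ ≤ |M.mean none - M.mean (some (i, x))|

/-- The expected reward of an optimal single-variable intervention. -/
noncomputable def optimalMean : ℝ := ⨆ a : Fin n × Fin K, M.mean (some a)

/-- The cumulative regret of a sequence of `T` actions. -/
noncomputable def regret (T : ℕ) (A : ℕ → Intervention n K) : ℝ :=
  T * M.optimalMean - ∑ t ∈ Finset.range T, M.mean (A t)

/-- `T` rounds of interaction of a (possibly randomized) learner with the bandit: the action of
round `t` is determined by the information `ℱ t` available before that round, and given `ℱ t`
the observed values `X t` and the reward `R t` have the law of the chosen action. -/
structure IsInteraction {Ω : Type*} [mΩ : MeasurableSpace Ω] (P : Measure Ω)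
    (ℱ : Filtration ℕ mΩ) (T : ℕ) (A : ℕ → Ω → Intervention n K)
    (X : ℕ → Ω → Fin n → Fin K) (R : ℕ → Ω → ℝ) : Prop where
  action_meas : ∀ t a, MeasurableSet[ℱ t] {ω | A t ω = a}
  obs_meas : ∀ t, Measurable[ℱ (t + 1)] (X t)
  reward_meas : ∀ t, Measurable[ℱ (t + 1)] (R t)
  cond_law : ∀ t < T, ∀ F : Set Ω, MeasurableSet[ℱ t] F →
    ∀ S : Set ((Fin n → Fin K) × ℝ), MeasurableSet S →
      P (F ∩ {ω | (X t ω, R t ω) ∈ S}) = ∫⁻ ω in F, M.law (A t ω) S ∂P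

end CausalBandit

/-! ## The algorithm CN-UCB for causal forests -/

namespace CNUCB

variable {n K : ℕ}

/-- The subgraph of `G` formed by the edges between vertices of `W`. -/
def subgraphOn (G : SimpleGraph (Fin n)) (W : Set (Fin n)) : SimpleGraph (Fin n) where
  Adj u v := G.Adj u v ∧ u ∈ W ∧ v ∈ W
  symm := ⟨fun _ _ h => ⟨h.1.symm, h.2.2, h.2.1⟩⟩
  loopless := ⟨fun i h => G.loopless.irrefl i h.1⟩

/-- The vertices that can be reached from `y` when the edge between `v` and `y` is cut. -/
def branch (G : SimpleGraph (Fin n)) (v y : Fin n) : Set (Fin n) :=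
  {u | (G.deleteEdges {s(v, y)}).Reachable y u}

/-- `v` is a central node of the tree on the vertices `W` with respect to the uniform distribution
on the set `S` of remaining candidates: no branch at `v` has more than half of the weight. -/
def IsCentral (G : SimpleGraph (Fin n)) (W S : Set (Fin n)) (v : Fin n) : Prop :=
  v ∈ W ∧ ∀ y, (subgraphOn G W).Adj v y →
    2 * (S ∩ branch (subgraphOn G W) v y).ncard ≤ S.ncard

/-- `y` is a child of `v` in the tree on the vertices `W` with root `r`. -/
def IsChild (G : SimpleGraph (Fin n)) (W : Set (Fin n)) (r v y : Fin n) : Prop :=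
  (subgraphOn G W).Adj v y ∧ r ∉ branch (subgraphOn G W) v y

/-- The internal state of the algorithm, with the candidate set `S` (the variables of positive
weight) in the tree on the vertices `W`. -/
inductive Phase (E : MixedGraph n) : Type
  /-- Stage 1 in the component `W`: intervene on the central node `v`. The components `rest` are
  still to be searched. -/
  | locate (rest : List E.ChainComponent) (W S : Set (Fin n)) (v : Fin n)
  /-- Stage 2 in the tree on `W` with root `r`: intervene on the central node `v`. -/
  | central (W : Set (Fin n)) (r : Fin n) (S : Set (Fin n)) (v : Fin n)
  /-- Stage 2, where `v` was found to be an ancestor of `X_R`: intervene on the child `y` of `v`,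
  then on the children in `todo`; `found` is the last child that was found to be an ancestor. -/
  | child (W : Set (Fin n)) (r : Fin n) (S : Set (Fin n)) (v y : Fin n) (todo : List (Fin n))
      (found : Option (Fin n))
  /-- Stage 3: UCB on the interventions on `x`, started at the beginning of block `start`. -/
  | exploit (x : Fin n) (start : ℕ)
  /-- No reward generating variable was found; the actions are arbitrary from here on. -/
  | failed

/-- The variable on which the algorithm currently intervenes in stages 1 and 2. -/
def Phase.target {E : MixedGraph n} : Phase E → Option (Fin n)
  | .locate _ _ _ v => some v
  | .central _ _ _ v => some v
  | .child _ _ _ _ y _ _ => some y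
  | .exploit _ _ => none
  | .failed => none

/-- The outcome of intervening `B` times by each of `do(v = 0), …, do(v = K - 1)`. -/
structure Feedback (n K : ℕ) where
  /-- The average reward under `do(v = z)`. -/
  reward : Fin K → ℝ
  /-- `freq z y k` is the relative frequency of `X_y = k` under `do(v = z)`. -/
  freq : Fin K → Fin n → Fin K → ℝ

/-- The reward test: `v` is declared to be an ancestor of `X_R`. -/
def Feedback.Hit (fb : Feedback n K) (Δ Rhat : ℝ) : Prop :=
  ∃ z, Δ / 2 < |Rhat - fb.reward z|

/-- The direction test: the edge between `v` and `y` is declared to be directed `v → y`. -/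
def Feedback.Down (fb : Feedback n K) (ε : ℝ) (obs : Fin n → Fin K → ℝ) (y : Fin n) : Prop :=
  ∃ z k, ε / 2 < |obs y k - fb.freq z y k|

variable (E : MixedGraph n)

/-- Stage 1 is started in the next chain component, with all its vertices as candidates. -/
inductive StartComponent : List E.ChainComponent → Phase E → Prop
  | none : StartComponent [] .failed
  | next (c : E.ChainComponent) (rest : List E.ChainComponent) (v : Fin n) :
      IsCentral E.und c.supp c.supp v →
      StartComponent (c :: rest) (.locate rest c.supp c.supp v)

/-- The loop of stage 2 is entered with the candidate set `S`; `j` is the index of the next block. -/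
inductive SearchKey (j : ℕ) (W : Set (Fin n)) (r : Fin n) (S : Set (Fin n)) : Phase E → Prop
  | many (v : Fin n) : 1 < S.ncard → IsCentral E.und W S v →
      SearchKey j W r S (.central W r S v)
  | one (x : Fin n) : S = {x} → SearchKey j W r S (.exploit x j)
  | none : S = ∅ → SearchKey j W r S .failed

/-- Stage 2 continues with the children of `v` in the list, where `found` is the last child found
to be an ancestor of `X_R`. -/
inductive SearchChildren (j : ℕ) (W : Set (Fin n)) (r : Fin n) (S : Set (Fin n)) (v : Fin n) :
    List (Fin n) → Option (Fin n) → Phase E → Prop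
  | next (y : Fin n) (todo : List (Fin n)) (found : Option (Fin n)) :
      SearchChildren j W r S v (y :: todo) found (.child W r S v y todo found)
  | key : SearchChildren j W r S v [] none (.exploit v j)
  | descend (y : Fin n) (next : Phase E) :
      SearchKey E j W r (S ∩ branch (subgraphOn E.und W) v y) next →
      SearchChildren j W r S v [] (some y) next

/-- The transition of the internal state after a block with the outcome `fb`; `j` is the index of
the next block, `Rhat` the average reward under `do()`, and `obs` the observational
probabilities. -/
inductive Step (ε Δ : ℝ) (obs : Fin n → Fin K → ℝ) (Rhat : ℝ) (fb : Feedback n K) (j : ℕ) :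
    Phase E → Phase E → Prop
  | found (rest : List E.ChainComponent) (W S W' : Set (Fin n)) (v : Fin n) (next : Phase E) :
      fb.Hit Δ Rhat →
      W' = {v} ∪ {u | ∃ y, (subgraphOn E.und W).Adj v y ∧ fb.Down ε obs y ∧
        u ∈ branch (subgraphOn E.und W) v y} →
      SearchKey E j W' v W' next →
      Step ε Δ obs Rhat fb j (.locate rest W S v) next
  | eliminate (rest : List E.ChainComponent) (W S S' : Set (Fin n)) (v v' : Fin n) :
      ¬ fb.Hit Δ Rhat →
      S' = {u ∈ S | ∃ y, (subgraphOn E.und W).Adj v y ∧ ¬ fb.Down ε obs y ∧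
        u ∈ branch (subgraphOn E.und W) v y} →
      S'.Nonempty → IsCentral E.und W S' v' →
      Step ε Δ obs Rhat fb j (.locate rest W S v) (.locate rest W S' v')
  | exhausted (rest : List E.ChainComponent) (W S : Set (Fin n)) (v : Fin n) (next : Phase E) :
      ¬ fb.Hit Δ Rhat →
      {u ∈ S | ∃ y, (subgraphOn E.und W).Adj v y ∧ ¬ fb.Down ε obs y ∧
        u ∈ branch (subgraphOn E.und W) v y} = ∅ →
      StartComponent E rest next →
      Step ε Δ obs Rhat fb j (.locate rest W S v) next
  | up (W : Set (Fin n)) (r : Fin n) (S : Set (Fin n)) (v : Fin n) (next : Phase E) :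
      ¬ fb.Hit Δ Rhat →
      SearchKey E j W r {u ∈ S | ∃ y, (subgraphOn E.und W).Adj v y ∧
        r ∈ branch (subgraphOn E.und W) v y ∧ u ∈ branch (subgraphOn E.und W) v y} next →
      Step ε Δ obs Rhat fb j (.central W r S v) next
  | down (W : Set (Fin n)) (r : Fin n) (S : Set (Fin n)) (v : Fin n) (children : List (Fin n))
      (next : Phase E) :
      fb.Hit Δ Rhat →
      children.Nodup → (∀ y, y ∈ children ↔ IsChild E.und W r v y) →
      SearchChildren E j W r S v children none next →
      Step ε Δ obs Rhat fb j (.central W r S v) next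
  | childHit (W : Set (Fin n)) (r : Fin n) (S : Set (Fin n)) (v y : Fin n)
      (todo : List (Fin n)) (found : Option (Fin n)) (next : Phase E) :
      fb.Hit Δ Rhat →
      SearchChildren E j W r S v todo (some y) next →
      Step ε Δ obs Rhat fb j (.child W r S v y todo found) next
  | childMiss (W : Set (Fin n)) (r : Fin n) (S : Set (Fin n)) (v y : Fin n)
      (todo : List (Fin n)) (found : Option (Fin n)) (next : Phase E) :
      ¬ fb.Hit Δ Rhat →
      SearchChildren E j W r S v todo found next →
      Step ε Δ obs Rhat fb j (.child W r S v y todo found) next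
  | exploit (x : Fin n) (start : ℕ) :
      Step ε Δ obs Rhat fb j (.exploit x start) (.exploit x start)
  | failed : Step ε Δ obs Rhat fb j .failed .failed

/-- The number of repetitions of each intervention,
`B = max {(32 / Δ²) log (8 n K / δ), (2 / ε²) log (8 n² K² / δ)}`, rounded up. -/
noncomputable def reps (n K : ℕ) (ε Δ δ : ℝ) : ℕ :=
  ⌈max (32 / Δ ^ 2 * Real.log (8 * n * K / δ)) (2 / ε ^ 2 * Real.log (8 * n ^ 2 * K ^ 2 / δ))⌉₊

/-- The first round of block `j`: after `B` rounds of `do()`, each block has `K * B` rounds. -/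
def blockStart (K B j : ℕ) : ℕ := B + j * (K * B)

/-- The outcome of block `j`, in which `do(v = z)` is performed in the rounds
`blockStart K B j + z * B + b` with `b < B`. -/
noncomputable def feedback (B : ℕ) (X : ℕ → Fin n → Fin K) (R : ℕ → ℝ) (j : ℕ) : Feedback n K where
  reward z := (∑ b ∈ Finset.range B, R (blockStart K B j + z * B + b)) / B
  freq z y k := (∑ b ∈ Finset.range B,
    if X (blockStart K B j + z * B + b) y = k then (1 : ℝ) else 0) / B

/-- The number of times `a` was performed in the rounds `t₀, …, t - 1`. -/
def pulls (A : ℕ → Intervention n K) (t₀ t : ℕ) (a : Intervention n K) : ℕ :=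
  ((Finset.Ico t₀ t).filter fun s => A s = a).card

/-- The upper confidence bound of `a` at the confidence level `η`, from the rounds
`t₀, …, t - 1`. -/
noncomputable def ucbIndex (η : ℝ) (A : ℕ → Intervention n K) (R : ℕ → ℝ) (t₀ t : ℕ)
    (a : Intervention n K) : ℝ :=
  (∑ s ∈ (Finset.Ico t₀ t).filter (fun s => A s = a), R s) / pulls A t₀ t a
    + √(2 * Real.log (1 / η) / pulls A t₀ t a)

/-- The action of round `t` is chosen by UCB with the arms `do(X_x = 0), …, do(X_x = K - 1)`,
started in round `t₀`: an arm that was not yet tried if there is one, and otherwise an arm with the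
largest upper confidence bound. -/
def UCBChoice (η : ℝ) (A : ℕ → Intervention n K) (R : ℕ → ℝ) (t₀ t : ℕ) (x : Fin n) : Prop :=
  ∃ k : Fin K, A t = some (x, k) ∧
    (pulls A t₀ t (some (x, k)) = 0 ∨
      ((∀ k' : Fin K, pulls A t₀ t (some (x, k')) ≠ 0) ∧
        ∀ k' : Fin K, ucbIndex η A R t₀ t (some (x, k')) ≤ ucbIndex η A R t₀ t (some (x, k))))

/-- The processes `A`, `X`, `R` of actions, observed values and rewards form a run of the algorithm
with `T` rounds in total, on the input consisting of the essential graph, the observational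
probabilities, `K`, `ε`, `Δ` and `δ`, where the chain components are visited in the given order;
`σ j` is the internal state at the beginning of block `j`. -/
structure IsRun (M : CausalBandit n K) (ε Δ δ : ℝ)
    (order : List M.D.essentialGraph.ChainComponent) (T : ℕ)
    {Ω : Type*} [mΩ : MeasurableSpace Ω] (P : Measure Ω) (ℱ : Filtration ℕ mΩ)
    (A : ℕ → Ω → Intervention n K) (X : ℕ → Ω → Fin n → Fin K) (R : ℕ → Ω → ℝ)
    (σ : ℕ → Ω → Phase M.D.essentialGraph) : Prop where
  interaction : M.IsInteraction P ℱ T A X R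
  state_meas : ∀ j s, MeasurableSet[ℱ (blockStart K (reps n K ε Δ δ) j)] {ω | σ j ω = s}
  observe : ∀ ω, ∀ t < T, t < reps n K ε Δ δ → A t ω = none
  init : ∀ ω, StartComponent M.D.essentialGraph order (σ 0 ω)
  step : ∀ ω j, blockStart K (reps n K ε Δ δ) (j + 1) ≤ T →
    Step M.D.essentialGraph ε Δ (M.marginal none)
      ((∑ b ∈ Finset.range (reps n K ε Δ δ), R b ω) / reps n K ε Δ δ)
      (feedback (reps n K ε Δ δ) (fun t => X t ω) (fun t => R t ω) j) (j + 1)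
      (σ j ω) (σ (j + 1) ω)
  explore : ∀ ω j v, (σ j ω).target = some v → ∀ z : Fin K, ∀ b < reps n K ε Δ δ,
    blockStart K (reps n K ε Δ δ) j + z * reps n K ε Δ δ + b < T →
      A (blockStart K (reps n K ε Δ δ) j + z * reps n K ε Δ δ + b) ω = some (v, z)
  exploit : ∀ ω j x start, σ j ω = .exploit x start → ∀ t < T,
    blockStart K (reps n K ε Δ δ) j ≤ t → t < blockStart K (reps n K ε Δ δ) (j + 1) →
      UCBChoice (δ / (32 * K * T)) (fun s => A s ω) (fun s => R s ω)
        (blockStart K (reps n K ε Δ δ) start) t x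

end CNUCB

/-! The learner finds `X_R` by a binary search with noisy tests and then plays UCB on the `K`
interventions on `X_R`. Since there is no confounding, every mean reward is an average of the means
of `do(X_R = k)` (`RewardModel.mean_eq_sum`), so these arms contain an optimal one and the regret is
at most the length of the search plus the regret of UCB.

Graph theory makes the search short. The directed edges of the essential graph are the edges
derivable by Meek's rules (`essentialGraph_dir_iff`). Derivable edges persist because equivalent
graphs share skeleton and immoralities. Conversely, an arrow derived into a vertex is derived into
its whole undirected component (`Compelled.propagate`), so a component can be reoriented from any
root along a perfect elimination order, and equality of skeleton and immoralities suffices for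
equivalence by successive reversals of covered edges. Hence directed edges induce an acyclic
relation on the components, which gives the visiting order, and each tree component is an out-tree:
two parents would give either an immorality or a triangle.

A test of `v` is correct when the averages are accurate: intervening on a variable does not change
the law of a non-descendant, while ancestors of `X_R` and children of `v` show gaps `Δ` and `ε`
(`hit_iff`, `down_iff`). As components reachable by directed edges have been visited before, a hit
in stage 1 means that `X_R` lies below `v` in the current tree. The branch at the parent of `v` is
the set of non-descendants and the branch at a child is the set of its descendants, so centrality
halves the candidates at every decision. This costs `log n + 1` tests per component and `1 + d`
tests per halving in stage 2 (`SearchInv.step`), that is `O((d + C) log n)` blocks of `K B` rounds,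
and `B` contributes the other factor `log n`.

For the probability, an exponential supermartingale gives a Hoeffding bound for rounds selected by
predictable events, in spite of adaptive actions. The tests occupy fixed windows of rounds, and at
most `2 n` blocks are ever needed, so a union bound makes all relevant averages accurate at once
(`le_measure_accurate`). The rest is deterministic (`regret_le_of_accurate`). -/

namespace DAG

variable {n : ℕ} (D : DAG n)

theorem edge_asymm {i j : Fin n} (h : D.edge i j) : ¬ D.edge j i := fun h' =>
  D.acyclic i ((Relation.TransGen.single h).tail h')

theorem edge_irrefl (i : Fin n) : ¬ D.edge i i := fun h => D.acyclic i (.single h)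

theorem edge_ne {i j : Fin n} (h : D.edge i j) : i ≠ j := fun e => D.edge_irrefl i (e ▸ h)

theorem adj_of_edge {i j : Fin n} (h : D.edge i j) : D.skeleton.Adj i j := .inl h

theorem adj_of_edge' {i j : Fin n} (h : D.edge i j) : D.skeleton.Adj j i := .inr h

/-! ### Active trails as routes -/

/-- One step of a route that is active given `C`. The Boolean records whether the last edge of the
route points into the current vertex; a vertex is passed as a collider only if it lies in `C`, and
as a non-collider only if it does not. -/
inductive RouteStep (C : Finset (Fin n)) : Fin n × Bool → Fin n × Bool → Prop
  | forward {v w : Fin n} (m : Bool) : D.edge v w → v ∉ C → RouteStep C (v, m) (w, true)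
  | backward {v w : Fin n} : D.edge w v → v ∉ C → RouteStep C (v, false) (w, false)
  | collide {v w : Fin n} : D.edge w v → v ∈ C → RouteStep C (v, true) (w, false)

/-- `a` and `b` are joined by an active route. -/
def RouteConn (C : Finset (Fin n)) (a b : Fin n) : Prop :=
  ∃ m, Relation.ReflTransGen (D.RouteStep C) (a, false) (b, m)

/-- The walk `p` can be entered with the mark `m`. -/
def Enterable (C : Finset (Fin n)) {a b : Fin n} (p : D.skeleton.Walk a b) (m : Bool) : Prop :=
  1 ≤ p.length → ((m = true ∧ D.edge (p.getVert 1) a) → ∃ c ∈ C, D.IsAncestor a c) ∧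
    (¬ (m = true ∧ D.edge (p.getVert 1) a) → a ∉ C)

/-- Of the first edge, the rest of the trail only needs to know whether it points into `v`. This one
bit is the mark carried by routes. -/
theorem activeTrail_cons {C : Finset (Fin n)} {a v b : Fin n} (h : D.skeleton.Adj a v)
    (p : D.skeleton.Walk v b) (m : Bool) (hm : m = true ↔ D.edge a v) :
    D.ActiveTrail C (SimpleGraph.Walk.cons h p) ↔ D.Enterable C p m ∧ D.ActiveTrail C p := by
  constructor
  · intro H
    refine ⟨fun hl => ?_, fun k hk => ?_⟩
    · have := H 0 (by simpa using hl)
      simpa [hm] using this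
    · have := H (k + 1) (by simp only [SimpleGraph.Walk.length_cons]; omega)
      simpa using this
  · rintro ⟨h1, h2⟩ k hk
    cases k with
    | zero =>
      have := h1 (by simpa using hk)
      simpa [hm] using this
    | succ k =>
      have := h2 k (by simp only [SimpleGraph.Walk.length_cons] at hk; omega)
      simpa using this

/-- A collider outside of `C` with a descendant in `C` is replaced by a walk down to the first
vertex in `C`, a collision there, and the way back up. -/
theorem route_detour {C : Finset (Fin n)} {v c : Fin n} (hc : c ∈ C) (h : D.IsAncestor v c) :
    v ∉ C → Relation.ReflTransGen (D.RouteStep C) (v, true) (v, false) := by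
  induction h using Relation.ReflTransGen.head_induction_on with
  | refl => exact fun h => (h hc).elim
  | @head v w hvw _ ih =>
    intro hv
    have h1 : Relation.ReflTransGen (D.RouteStep C) (v, true) (w, true) :=
      .single (.forward _ hvw hv)
    by_cases hw : w ∈ C
    · exact h1.tail (.collide hvw hw)
    · exact (h1.trans (ih hw)).tail (.backward hvw hw)

theorem route_of_activeTrail {C : Finset (Fin n)} {a b : Fin n} (p : D.skeleton.Walk a b) :
    ∀ m, D.Enterable C p m → D.ActiveTrail C p →
      ∃ m', Relation.ReflTransGen (D.RouteStep C) (a, m) (b, m') := by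
  induction p with
  | nil => exact fun m _ _ => ⟨m, .refl⟩
  | cons h p ih =>
    rename_i a v b
    intro m hm hp
    have he := hm (by simp)
    simp only [SimpleGraph.Walk.getVert_cons_succ, SimpleGraph.Walk.getVert_zero] at he
    rcases h with h | h
    · have h' := D.edge_asymm h
      obtain ⟨e, hp'⟩ := (D.activeTrail_cons (.inl h) p true (by simpa using h)).1 hp
      obtain ⟨m', hr⟩ := ih true e hp'
      exact ⟨m', hr.head (.forward _ h (he.2 (by tauto)))⟩
    · have h' := D.edge_asymm h
      obtain ⟨e, hp'⟩ := (D.activeTrail_cons (.inr h) p false (by simpa using h')).1 hp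
      obtain ⟨m', hr⟩ := ih false e hp'
      refine ⟨m', ?_⟩
      cases m with
      | false => exact hr.head (.backward h (he.2 (by simp)))
      | true =>
        obtain ⟨c, hc, hac⟩ := he.1 ⟨rfl, h⟩
        by_cases haC : a ∈ C
        · exact hr.head (.collide h haC)
        · exact (D.route_detour hc hac haC).trans (hr.head (.backward h haC))

theorem activeTrail_of_route {C : Finset (Fin n)} {b : Fin n} {t s : Fin n × Bool}
    (h : Relation.ReflTransGen (D.RouteStep C) s t) (hb : t.1 = b) :
    ∃ p : D.skeleton.Walk s.1 b, D.Enterable C p s.2 ∧ D.ActiveTrail C p := by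
  induction h using Relation.ReflTransGen.head_induction_on with
  | refl =>
    subst hb
    exact ⟨.nil, fun h => by simp at h, fun k hk => by simp at hk⟩
  | head hs _ ih =>
    obtain ⟨p, hp1, hp2⟩ := ih
    cases hs with
    | forward m h hv =>
      exact ⟨.cons (D.adj_of_edge h) p, fun _ => ⟨fun h' => (D.edge_asymm h (by simpa only [SimpleGraph.Walk.getVert_cons_succ, SimpleGraph.Walk.getVert_zero] using h'.2)).elim,
        fun _ => hv⟩, (D.activeTrail_cons (.inl h) p true (by simpa using h)).2 ⟨hp1, hp2⟩⟩
    | backward h hv =>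
      exact ⟨.cons (D.adj_of_edge' h) p, fun _ => ⟨fun h' => by simp at h',
        fun _ => hv⟩, (D.activeTrail_cons (.inr h) p false
          (by simpa using D.edge_asymm h)).2 ⟨hp1, hp2⟩⟩
    | collide h hv =>
      exact ⟨.cons (D.adj_of_edge' h) p, fun _ => ⟨fun _ => ⟨_, hv, .refl⟩,
        fun h' => (h' ⟨rfl, by simpa only [SimpleGraph.Walk.getVert_cons_succ, SimpleGraph.Walk.getVert_zero] using h⟩).elim⟩, (D.activeTrail_cons (.inr h) p false
          (by simpa using D.edge_asymm h)).2 ⟨hp1, hp2⟩⟩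

/-- Routes turn d-connection into reachability for a local step relation without any reference to
descendants, which is what the simulation after an edge reversal needs. -/
theorem routeConn_iff {C : Finset (Fin n)} {a b : Fin n} (ha : a ∉ C) :
    D.RouteConn C a b ↔ ∃ p : D.skeleton.Walk a b, D.ActiveTrail C p := by
  constructor
  · rintro ⟨m, h⟩
    obtain ⟨p, _, hp⟩ := D.activeTrail_of_route h rfl
    exact ⟨p, hp⟩
  · rintro ⟨p, hp⟩
    exact D.route_of_activeTrail p false (fun _ => ⟨fun h => by simp at h, fun _ => ha⟩) hp

theorem markovEquiv_of_routeConn {D D' : DAG n}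
    (h : ∀ C a b, a ∉ C → b ∉ C → (D.RouteConn C a b ↔ D'.RouteConn C a b)) :
    D.MarkovEquiv D' := by
  intro A B C _ hAC hBC
  refine forall₂_congr fun a ha => forall₂_congr fun b hb => ?_
  have haC := Finset.disjoint_left.1 hAC ha
  have := h C a b haC (Finset.disjoint_left.1 hBC hb)
  rw [D.routeConn_iff haC, D'.routeConn_iff haC] at this
  simpa only [not_exists] using not_congr this

theorem MarkovEquiv.refl (D : DAG n) : D.MarkovEquiv D := fun _ _ _ _ _ _ => Iff.rfl

theorem MarkovEquiv.symm {D D' : DAG n} (h : D.MarkovEquiv D') : D'.MarkovEquiv D :=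
  fun A B C h1 h2 h3 => (h A B C h1 h2 h3).symm

theorem MarkovEquiv.trans {D D' D'' : DAG n} (h : D.MarkovEquiv D') (h' : D'.MarkovEquiv D'') :
    D.MarkovEquiv D'' :=
  fun A B C h1 h2 h3 => (h A B C h1 h2 h3).trans (h' A B C h1 h2 h3)

/-! ### Separating sets, the skeleton and the unshielded colliders -/

open scoped Classical in
/-- The parents of `j`. -/
noncomputable def parents (j : Fin n) : Finset (Fin n) := Finset.univ.filter fun i => D.edge i j

theorem mem_parents {i j : Fin n} : i ∈ D.parents j ↔ D.edge i j := by simp [parents]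

/-- No route that is active given the parents of `j` leads from `j` to a non-descendant of `j` that
is not a parent. -/
theorem not_routeConn_parents {i j : Fin n} (hij : i ≠ j) (h1 : ¬ D.edge i j)
    (h2 : ¬ D.IsAncestor j i) : ¬ D.RouteConn (D.parents j) j i := by
  rintro ⟨m, h⟩
  -- A route leaving `j` upwards is stuck at a parent, which is a blocked non-collider. A route
  -- leaving downwards can never turn, since a strict descendant of `j` is not a parent of `j`.
  have key : ∀ s, Relation.ReflTransGen (D.RouteStep (D.parents j)) (j, false) s →
      (s.2 = true ∧ Relation.TransGen D.edge j s.1) ∨ s = (j, false) ∨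
        (s.1 ∈ D.parents j ∧ s.2 = false) := by
    intro s hs
    induction hs with
    | refl => simp
    | tail _ hst ih =>
      cases hst with
      | forward m h hv =>
        rename_i v w
        rcases ih with ⟨_, h'⟩ | h' | h'
        · exact .inl ⟨rfl, h'.tail h⟩
        · simp only [Prod.mk.injEq] at h'
          exact .inl ⟨rfl, .single (h'.1 ▸ h)⟩
        · exact (hv h'.1).elim
      | backward h hv =>
        rename_i v w
        rcases ih with h' | h' | h'
        · simp at h'
        · simp only [Prod.mk.injEq] at h'
          exact .inr (.inr ⟨D.mem_parents.2 (h'.1 ▸ h), rfl⟩)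
        · exact (hv h'.1).elim
      | collide h hv =>
        rename_i v w
        rcases ih with ⟨_, h'⟩ | h' | h'
        · exact (D.acyclic j (h'.tail (D.mem_parents.1 hv))).elim
        · simp at h'
        · simp at h'
  rcases key _ h with h | h | h
  · exact h2 h.2.to_reflTransGen
  · exact hij (congrArg Prod.fst h)
  · exact h1 (D.mem_parents.1 h.1)

theorem activeTrail_of_length_le_one {C : Finset (Fin n)} {a b : Fin n} (p : D.skeleton.Walk a b)
    (hp : p.length ≤ 1) : D.ActiveTrail C p := fun m hm => by omega

theorem exists_dSep_of_not_adj {i j : Fin n} (hij : i ≠ j) (hadj : ¬ D.skeleton.Adj i j)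
    (h : ¬ D.IsAncestor j i) : ∃ C : Finset (Fin n), i ∉ C ∧ j ∉ C ∧ D.DSep {j} {i} C := by
  have hne : ¬ D.edge i j ∧ ¬ D.edge j i := not_or.1 hadj
  have hj : j ∉ D.parents j := fun h => D.edge_irrefl _ (D.mem_parents.1 h)
  refine ⟨D.parents j, fun h => hne.1 (D.mem_parents.1 h), hj, fun a ha b hb p hp => ?_⟩
  rw [Finset.mem_singleton] at ha hb
  subst ha hb
  exact D.not_routeConn_parents hij hne.1 h ((D.routeConn_iff hj).2 ⟨p, hp⟩)

/-- One of the two vertices is no ancestor of the other, and its parents separate them. -/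
theorem exists_dSep {i j : Fin n} (hij : i ≠ j) (hadj : ¬ D.skeleton.Adj i j) :
    ∃ C : Finset (Fin n), i ∉ C ∧ j ∉ C ∧ (D.DSep {j} {i} C ∨ D.DSep {i} {j} C) := by
  by_cases h : D.IsAncestor j i
  · have hji : ¬ D.IsAncestor i j := fun h' => by
      rcases Relation.reflTransGen_iff_eq_or_transGen.1 h' with e | e
      · exact hij e.symm
      · exact D.acyclic _ (e.trans_left h)
    obtain ⟨C, h1, h2, h3⟩ := D.exists_dSep_of_not_adj hij.symm (fun e => hadj e.symm) hji
    exact ⟨C, h2, h1, .inr h3⟩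
  · obtain ⟨C, h1, h2, h3⟩ := D.exists_dSep_of_not_adj hij hadj h
    exact ⟨C, h1, h2, .inl h3⟩

theorem not_dSep_of_adj {i j : Fin n} (h : D.skeleton.Adj i j) (C : Finset (Fin n)) :
    ¬ D.DSep {i} {j} C := fun hd =>
  hd i (by simp) j (by simp) (.cons h .nil) (D.activeTrail_of_length_le_one _ (by simp))

variable {D}

theorem MarkovEquiv.dSep_singleton {D' : DAG n} (h : D.MarkovEquiv D') {i j : Fin n} (hij : i ≠ j)
    {C : Finset (Fin n)} (hi : i ∉ C) (hj : j ∉ C) : D.DSep {i} {j} C ↔ D'.DSep {i} {j} C :=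
  h _ _ _ (by simpa using hij) (by simpa using hi) (by simpa using hj)

theorem MarkovEquiv.adj_of_adj {D' : DAG n} (h : D.MarkovEquiv D') {i j : Fin n}
    (hadj : D.skeleton.Adj i j) : D'.skeleton.Adj i j := by
  by_contra hc
  have hij := hadj.ne
  obtain ⟨C, hi, hj, h' | h'⟩ := D'.exists_dSep hij hc
  · exact D.not_dSep_of_adj hadj.symm C ((h.dSep_singleton hij.symm hj hi).2 h')
  · exact D.not_dSep_of_adj hadj C ((h.dSep_singleton hij hi hj).2 h')

theorem MarkovEquiv.adj_iff {D' : DAG n} (h : D.MarkovEquiv D') {i j : Fin n} :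
    D.skeleton.Adj i j ↔ D'.skeleton.Adj i j :=
  ⟨h.adj_of_adj, h.symm.adj_of_adj⟩

/-- `i → k ← j` where `i` and `j` are not adjacent. -/
def Immorality (D : DAG n) (i k j : Fin n) : Prop :=
  D.edge i k ∧ D.edge j k ∧ i ≠ j ∧ ¬ D.skeleton.Adj i j

theorem Immorality.symm {i k j : Fin n} (h : D.Immorality i k j) : D.Immorality j k i :=
  ⟨h.2.1, h.1, h.2.2.1.symm, fun e => h.2.2.2 e.symm⟩

theorem dSep_immorality {i k j : Fin n} (h1 : D.edge i k) (h2 : D.edge j k) {C : Finset (Fin n)}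
    (hd : D.DSep {i} {j} C) : k ∉ C := by
  intro hk
  refine hd i (by simp) j (by simp) (.cons (D.adj_of_edge h1) (.cons (D.adj_of_edge' h2) .nil)) ?_
  intro m hm
  simp only [SimpleGraph.Walk.length_cons, SimpleGraph.Walk.length_nil] at hm
  obtain rfl : m = 0 := by omega
  refine ⟨fun _ => ⟨k, hk, Relation.ReflTransGen.refl⟩, fun h => (h ?_).elim⟩
  simpa using ⟨h1, h2⟩

/-- The path `i - k - j` would be active given a set without `k`, unless `k` is a collider. Together
with `dSep_immorality` this makes immoralities visible in the separating sets. -/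
theorem edge_of_dSep {i k j : Fin n} (h1 : D.skeleton.Adj i k) (h2 : D.skeleton.Adj k j)
    {C : Finset (Fin n)} (hk : k ∉ C) (hd : D.DSep {i} {j} C) : D.edge i k ∧ D.edge j k := by
  by_contra hc
  refine hd i (by simp) j (by simp) (.cons h1 (.cons h2 .nil)) ?_
  intro m hm
  simp only [SimpleGraph.Walk.length_cons, SimpleGraph.Walk.length_nil] at hm
  obtain rfl : m = 0 := by omega
  refine ⟨fun h => (hc (by simpa using h)).elim, fun _ => by simpa using hk⟩

theorem MarkovEquiv.immorality {D' : DAG n} (h : D.MarkovEquiv D') {i k j : Fin n}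
    (hm : D.Immorality i k j) : D'.Immorality i k j := by
  obtain ⟨h1, h2, hij, hadj⟩ := hm
  obtain ⟨C, hi, hj, hd | hd⟩ := D.exists_dSep hij hadj
  · have := edge_of_dSep (h.adj_of_adj (.inl h2)) (h.adj_of_adj (.inr h1)) (dSep_immorality h2 h1 hd)
      ((h.dSep_singleton hij.symm hj hi).1 hd)
    exact ⟨this.2, this.1, hij, fun e => hadj (h.symm.adj_of_adj e)⟩
  · have := edge_of_dSep (h.adj_of_adj (.inl h1)) (h.adj_of_adj (.inr h2)) (dSep_immorality h1 h2 hd)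
      ((h.dSep_singleton hij hi hj).1 hd)
    exact ⟨this.1, this.2, hij, fun e => hadj (h.symm.adj_of_adj e)⟩

/-! ### Reversal of covered edges -/

/-- The edge `x → y` is covered: `y` has the same parents as `x`, apart from `x` itself. -/
def Covered (D : DAG n) (x y : Fin n) : Prop :=
  D.edge x y ∧ ∀ z, z ≠ x → (D.edge z y ↔ D.edge z x)

/-- The edge relation after the edge `x → y` is reversed. -/
def flipEdge (D : DAG n) (x y u v : Fin n) : Prop :=
  (u = y ∧ v = x) ∨ (D.edge u v ∧ ¬ (u = x ∧ v = y))

/-- A new cycle uses `y → x`, so some other path leads from `x` to `y`. Its last vertex before `y`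
is a parent of `y` and hence of `x`, which closes a cycle in `D`. -/
theorem Covered.flip_acyclic {x y : Fin n} (h : D.Covered x y) (i : Fin n) :
    ¬ Relation.TransGen (D.flipEdge x y) i i := by
  set E' : Fin n → Fin n → Prop := fun u v => D.edge u v ∧ ¬ (u = x ∧ v = y) with hE
  have hD : ∀ {u v}, Relation.ReflTransGen E' u v → Relation.ReflTransGen D.edge u v :=
    fun h => Relation.ReflTransGen.mono (fun _ _ h => h.1) _ _ h
  have key : ∀ u v, Relation.TransGen (D.flipEdge x y) u v → Relation.TransGen E' u v ∨
      (Relation.ReflTransGen E' u y ∧ Relation.ReflTransGen E' x v) := by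
    intro u v huv
    induction huv with
    | single h' =>
      rcases h' with ⟨rfl, rfl⟩ | h'
      · exact .inr ⟨.refl, .refl⟩
      · exact .inl (.single h')
    | tail _ h' ih =>
      rcases h' with ⟨rfl, rfl⟩ | h'
      · rcases ih with ih | ih
        · exact .inr ⟨ih.to_reflTransGen, .refl⟩
        · exact .inr ⟨ih.1, .refl⟩
      · rcases ih with ih | ih
        · exact .inl (ih.tail h')
        · exact .inr ⟨ih.1, ih.2.tail h'⟩
  intro hi
  rcases key i i hi with h' | ⟨h1, h2⟩
  · exact D.acyclic i (Relation.TransGen.mono (fun _ _ h => h.1) _ _ h')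
  · rcases (h2.trans h1).cases_tail with h' | ⟨z, hz, hz'⟩
    · exact D.edge_irrefl x (h' ▸ h.1)
    · have hzx : z ≠ x := fun e => hz'.2 ⟨e, rfl⟩
      exact D.acyclic x (Relation.TransGen.tail' (hD hz) ((h.2 z hzx).1 hz'.1))

/-- The graph obtained by the reversal of a covered edge. -/
def Covered.flip {x y : Fin n} (h : D.Covered x y) : DAG n where
  edge := D.flipEdge x y
  acyclic := h.flip_acyclic

theorem Covered.flip_edge_iff {x y : Fin n} (h : D.Covered x y) {u v : Fin n} :
    h.flip.edge u v ↔ (u = y ∧ v = x) ∨ (D.edge u v ∧ ¬ (u = x ∧ v = y)) := Iff.rfl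

theorem Covered.flip_covered {x y : Fin n} (h : D.Covered x y) : h.flip.Covered y x := by
  have hxy := D.edge_ne h.1
  refine ⟨.inl ⟨rfl, rfl⟩, fun z hz => ?_⟩
  rw [h.flip_edge_iff, h.flip_edge_iff]
  by_cases hzx : z = x
  · subst hzx
    have := D.edge_irrefl z
    tauto
  · have := h.2 z hzx
    tauto

theorem Covered.flip_flip_edge {x y : Fin n} (h : D.Covered x y) {u v : Fin n} :
    h.flip_covered.flip.edge u v ↔ D.edge u v := by
  rw [h.flip_covered.flip_edge_iff, h.flip_edge_iff]
  have h1 := h.1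
  have h2 := D.edge_asymm h.1
  constructor
  · rintro (⟨rfl, rfl⟩ | h')
    · exact h1
    · tauto
  · intro h'
    by_cases hu : u = x ∧ v = y
    · exact .inl hu
    · refine .inr ⟨.inr ⟨h', hu⟩, ?_⟩
      rintro ⟨rfl, rfl⟩
      exact h2 h'

/-- A route outside of `{x, y}` leads from `a` to the marked vertex `s`, or there is enough
information about how a route from `a` reaches `s ∈ {x, y}` to simulate it after the reversal of
the covered edge `x → y`. -/
def FlipInvariant (D' : DAG n) (C : Finset (Fin n)) (x y a : Fin n) (s : Fin n × Bool) : Prop :=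
  let r := fun t => Relation.ReflTransGen (D'.RouteStep C) (a, false) t
  (s.1 ≠ x ∧ s.1 ≠ y ∧ r s) ∨
  ((s.1 = x ∨ s.1 = y) ∧ r (x, true) ∧ r (y, true) ∧ (s.2 = false → y ∈ C)) ∨
  (r (x, false) ∧ (s = (x, false) ∨ s = (y, true) ∧ x ∉ C)) ∨
  (r (y, false) ∧ (s = (y, false) ∨ y ∉ C ∧ (s = (x, false) ∨ s = (y, true) ∧ x ∉ C)))

/-- A common parent leads to `x` and to `y` alike, so after an entry from above both are reachable
with an incoming mark. After an entry from below, or a start in `{x, y}`, the simulating route waits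
at the entry vertex until the given route leaves the pair. A collision at `y` followed by an exit
through `x` is imitated by a collision at `y` and an exit to the same parent. -/
theorem Covered.flipInvariant {x y : Fin n} (h : D.Covered x y) {C : Finset (Fin n)} {a : Fin n}
    {s : Fin n × Bool} (hs : Relation.ReflTransGen (D.RouteStep C) (a, false) s) :
    FlipInvariant h.flip C x y a s := by
  have hxy := D.edge_ne h.1
  have hyx := D.edge_asymm h.1
  have hxx := D.edge_irrefl x
  have hyy := D.edge_irrefl y
  have e1 : h.flip.edge y x := .inl ⟨rfl, rfl⟩
  have e2 : ∀ {u v}, D.edge u v → v ≠ x → v ≠ y → h.flip.edge u v := fun h' _ h2 =>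
    .inr ⟨h', fun e => h2 e.2⟩
  have e3 : ∀ {u v}, D.edge u v → u ≠ x → u ≠ y → h.flip.edge u v := fun h' h2 _ =>
    .inr ⟨h', fun e => h2 e.1⟩
  have px : ∀ {u}, D.edge u y → u ≠ x → D.edge u x := fun h' h2 => (h.2 _ h2).1 h'
  have py : ∀ {u}, D.edge u x → D.edge u y := fun h' => (h.2 _ (D.edge_ne h')).2 h'
  induction hs with
  | refl =>
    by_cases hx : a = x
    · subst hx
      exact .inr (.inr (.inl ⟨.refl, .inl rfl⟩))
    · by_cases hy : a = y
      · subst hy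
        exact .inr (.inr (.inr ⟨.refl, .inl rfl⟩))
      · exact .inl ⟨hx, hy, .refl⟩
  | tail _ hst ih =>
    cases hst with
    | @forward v w m hvw hv =>
      by_cases hw : w = x ∨ w = y
      · by_cases hvx : v = x
        · -- the edge `x → y`
          subst hvx
          have hw : w = y := hw.resolve_left (D.edge_ne hvw).symm
          subst hw
          rcases ih with ih | ih | ih | ih
          · exact (ih.1 rfl).elim
          · exact .inr (.inl ⟨.inr rfl, ih.2.1, ih.2.2.1, by simp⟩)
          · exact .inr (.inr (.inl ⟨ih.1, .inr ⟨rfl, hv⟩⟩))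
          · refine .inr (.inr (.inr ⟨ih.1, .inr ⟨?_, .inr ⟨rfl, hv⟩⟩⟩))
            rcases ih.2 with ih | ih
            · exact (hxy (congrArg Prod.fst ih)).elim
            · exact ih.1
        · have hvy : v ≠ y := by
            rintro rfl
            rcases hw with rfl | rfl
            · exact hyx hvw
            · exact hyy hvw
          have hx : D.edge v x := by rcases hw with rfl | rfl; exacts [hvw, px hvw hvx]
          rcases ih with ih | ih | ih | ih
          · refine .inr (.inl ⟨hw, ih.2.2.tail (.forward _ (e3 hx hvx hvy) hv),
              ih.2.2.tail (.forward _ (e3 (py hx) hvx hvy) hv), by simp⟩)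
          · exact (ih.1.elim hvx hvy).elim
          · simp [hvx, hvy] at ih
          · simp [hvx, hvy] at ih
      · obtain ⟨hwx, hwy⟩ := not_or.1 hw
        have hvw' := e2 hvw hwx hwy
        refine .inl ⟨hwx, hwy, ?_⟩
        rcases ih with ih | ih | ih | ih
        · exact ih.2.2.tail (.forward _ hvw' hv)
        · rcases ih.1 with e | e <;> simp only at e <;> subst e
          · exact ih.2.1.tail (.forward _ hvw' hv)
          · exact ih.2.2.1.tail (.forward _ hvw' hv)
        · rcases ih.2 with e | ⟨e, hxC⟩ <;> obtain ⟨rfl, -⟩ := Prod.mk.inj e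
          · exact ih.1.tail (.forward _ hvw' hv)
          · exact (ih.1.tail (.backward e1 hxC)).tail (.forward _ hvw' hv)
        · rcases ih.2 with e | ⟨hyC, e | ⟨e, hxC⟩⟩ <;> obtain ⟨rfl, -⟩ := Prod.mk.inj e
          · exact ih.1.tail (.forward _ hvw' hv)
          · exact (ih.1.tail (.forward _ e1 hyC)).tail (.forward _ hvw' hv)
          · exact ih.1.tail (.forward _ hvw' hv)
    | @backward v w hwv hv =>
      by_cases hw : w = x ∨ w = y
      · by_cases hvy : v = y
        · subst hvy
          have hw : w = x := hw.resolve_right (D.edge_ne hwv)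
          subst hw
          rcases ih with ih | ih | ih | ih
          · exact (ih.2.1 rfl).elim
          · exact (hv (ih.2.2.2 rfl)).elim
          · simp [hxy.symm] at ih
          · exact .inr (.inr (.inr ⟨ih.1, .inr ⟨hv, .inl rfl⟩⟩))
        · have hvx : v ≠ x := by
            rintro rfl
            rcases hw with rfl | rfl
            · exact hxx hwv
            · exact hyx hwv
          have hwv' : h.flip.edge w v := e2 hwv hvx hvy
          rcases ih with ih | ih | ih | ih
          · rcases hw with rfl | rfl
            · exact .inr (.inr (.inl ⟨ih.2.2.tail (.backward hwv' hv), .inl rfl⟩))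
            · exact .inr (.inr (.inr ⟨ih.2.2.tail (.backward hwv' hv), .inl rfl⟩))
          · exact (ih.1.elim hvx hvy).elim
          · simp [hvx, hvy] at ih
          · simp [hvx, hvy] at ih
      · obtain ⟨hwx, hwy⟩ := not_or.1 hw
        have hwv' := e3 hwv hwx hwy
        refine .inl ⟨hwx, hwy, ?_⟩
        rcases ih with ih | ih | ih | ih
        · exact ih.2.2.tail (.backward hwv' hv)
        · have hyC := ih.2.2.2 rfl
          have hwy' : D.edge w y := by
            rcases ih.1 with e | e <;> simp only at e <;> subst e
            · exact py hwv
            · exact hwv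
          exact ih.2.2.1.tail (.collide (e3 hwy' hwx hwy) hyC)
        · rcases ih.2 with e | ⟨e, hxC⟩ <;> obtain ⟨rfl, h2⟩ := Prod.mk.inj e
          · exact ih.1.tail (.backward hwv' hv)
          · simp at h2
        · rcases ih.2 with e | ⟨hyC, e | ⟨e, hxC⟩⟩ <;> obtain ⟨rfl, h2⟩ := Prod.mk.inj e
          · exact ih.1.tail (.backward hwv' hv)
          · exact ih.1.tail (.backward (e3 (py hwv) hwx hwy) hyC)
          · simp at h2
    | @collide v w hwv hv =>
      by_cases hw : w = x ∨ w = y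
      · by_cases hvy : v = y
        · subst hvy
          have hw : w = x := hw.resolve_right (D.edge_ne hwv)
          subst hw
          rcases ih with ih | ih | ih | ih
          · exact (ih.2.1 rfl).elim
          · exact .inr (.inl ⟨.inl rfl, ih.2.1, ih.2.2.1, fun _ => hv⟩)
          · exact .inr (.inr (.inl ⟨ih.1, .inl rfl⟩))
          · simp [hxy.symm, hv] at ih
        · have hvx : v ≠ x := by
            rintro rfl
            rcases hw with rfl | rfl
            · exact hxx hwv
            · exact hyx hwv
          have hwv' : h.flip.edge w v := e2 hwv hvx hvy
          rcases ih with ih | ih | ih | ih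
          · rcases hw with rfl | rfl
            · exact .inr (.inr (.inl ⟨ih.2.2.tail (.collide hwv' hv), .inl rfl⟩))
            · exact .inr (.inr (.inr ⟨ih.2.2.tail (.collide hwv' hv), .inl rfl⟩))
          · exact (ih.1.elim hvx hvy).elim
          · simp [hvx, hvy] at ih
          · simp [hvx, hvy] at ih
      · obtain ⟨hwx, hwy⟩ := not_or.1 hw
        have hwv' := e3 hwv hwx hwy
        refine .inl ⟨hwx, hwy, ?_⟩
        rcases ih with ih | ih | ih | ih
        · exact ih.2.2.tail (.collide hwv' hv)
        · rcases ih.1 with e | e <;> simp only at e <;> subst e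
          · exact ih.2.1.tail (.collide hwv' hv)
          · exact ih.2.2.1.tail (.collide hwv' hv)
        · rcases ih.2 with e | ⟨e, hxC⟩ <;> obtain ⟨rfl, h2⟩ := Prod.mk.inj e
          · simp at h2
          · exact ih.1.tail (.backward (e3 (px hwv hwx) hwx hwy) hxC)
        · rcases ih.2 with e | ⟨hyC, e | ⟨e, hxC⟩⟩ <;> obtain ⟨rfl, h2⟩ := Prod.mk.inj e
          · simp at h2
          · simp at h2
          · exact (hyC hv).elim

theorem Covered.routeConn_flip {x y : Fin n} (h : D.Covered x y) {C : Finset (Fin n)} {a b : Fin n}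
    (hc : D.RouteConn C a b) : h.flip.RouteConn C a b := by
  obtain ⟨m, hm⟩ := hc
  have e1 : h.flip.edge y x := .inl ⟨rfl, rfl⟩
  rcases h.flipInvariant hm with ih | ih | ih | ih
  · exact ⟨_, ih.2.2⟩
  · rcases ih.1 with e | e <;> simp only at e <;> subst e
    · exact ⟨_, ih.2.1⟩
    · exact ⟨_, ih.2.2.1⟩
  · rcases ih.2 with e | ⟨e, hxC⟩ <;> obtain ⟨rfl, -⟩ := Prod.mk.inj e
    · exact ⟨_, ih.1⟩
    · exact ⟨_, ih.1.tail (.backward e1 hxC)⟩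
  · rcases ih.2 with e | ⟨hyC, e | ⟨e, hxC⟩⟩ <;> obtain ⟨rfl, -⟩ := Prod.mk.inj e
    · exact ⟨_, ih.1⟩
    · exact ⟨_, ih.1.tail (.forward _ e1 hyC)⟩
    · exact ⟨_, ih.1⟩

theorem ext_edge {D D' : DAG n} (h : ∀ u v, D.edge u v ↔ D'.edge u v) : D = D' := by
  cases D
  cases D'
  congr
  ext u v
  exact h u v

/-- The reversed edge is covered again and reversing it restores `D`, so one inclusion suffices. -/
theorem Covered.markovEquiv {x y : Fin n} (h : D.Covered x y) : D.MarkovEquiv h.flip := by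
  have e : h.flip_covered.flip = D := ext_edge fun u v => h.flip_flip_edge
  refine markovEquiv_of_routeConn fun C a b _ _ => ⟨h.routeConn_flip, fun h' => ?_⟩
  have := h.flip_covered.routeConn_flip h'
  rwa [e] at this

/-! ### Graphs with the same skeleton and the same immoralities are Markov equivalent -/

/-- Transitive reachability in a DAG is well-founded. -/
theorem wellFounded_transGen (D : DAG n) : WellFounded (Relation.TransGen D.edge) :=
  have : IsTrans (Fin n) (Relation.TransGen D.edge) := ⟨fun _ _ _ => Relation.TransGen.trans⟩
  have : Std.Irrefl (Relation.TransGen D.edge) := ⟨D.acyclic⟩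
  Finite.wellFounded_of_trans_of_irrefl _

theorem wellFounded_transGen_swap (D : DAG n) :
    WellFounded (Function.swap (Relation.TransGen D.edge)) :=
  have : IsTrans (Fin n) (Function.swap (Relation.TransGen D.edge)) :=
    ⟨fun _ _ _ h h' => Relation.TransGen.trans h' h⟩
  have : Std.Irrefl (Function.swap (Relation.TransGen D.edge)) := ⟨D.acyclic⟩
  Finite.wellFounded_of_trans_of_irrefl _

/-- Some covered edge has different directions in two DAGs with the same skeleton and the same
immoralities, unless the DAGs are equal. -/
theorem exists_covered {D D' : DAG n}
    (hadj : ∀ i j, D.skeleton.Adj i j ↔ D'.skeleton.Adj i j)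
    (him : ∀ i k j, D.Immorality i k j ↔ D'.Immorality i k j)
    (hne : ∃ x y, D.edge x y ∧ D'.edge y x) :
    ∃ x y, D.Covered x y ∧ D'.edge y x := by
  -- Take the earliest head `y` of a disagreeing edge, and then the latest tail `x` of a disagreeing
  -- edge into `y`. A violation of coveredness at this pair would give a cycle or an immorality in
  -- only one of the graphs.
  obtain ⟨y, ⟨x₀, hx₀⟩, hy⟩ := D.wellFounded_transGen.has_min {y | ∃ x, D.edge x y ∧ D'.edge y x}
    (by obtain ⟨x, y, h⟩ := hne; exact ⟨y, x, h⟩)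
  obtain ⟨x, ⟨hxy, hyx⟩, hx⟩ := D.wellFounded_transGen_swap.has_min
    {x | D.edge x y ∧ D'.edge y x} ⟨x₀, hx₀⟩
  have keep : ∀ {u v}, D.edge u v → Relation.TransGen D.edge v y → D'.edge u v := fun {u v} h h' => by
    rcases (hadj u v).1 (.inl h) with e | e
    · exact e
    · exact (hy v ⟨u, h, e⟩ h').elim
  refine ⟨x, y, ⟨hxy, fun z hzx => ⟨fun hz => ?_, fun hz => ?_⟩⟩, hyx⟩
  · by_cases h : D.skeleton.Adj z x
    · rcases h with h | h
      · exact h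
      · exfalso
        have h1 : D'.edge z y := by
          rcases (hadj z y).1 (.inl hz) with e | e
          · exact e
          · exact (hx z ⟨hz, e⟩ (.single h)).elim
        have h2 := keep h (.single hz)
        exact D'.acyclic z ((Relation.TransGen.single h1).trans ((Relation.TransGen.single hyx).tail h2))
    · have := (him z y x).1 ⟨hz, hxy, hzx, h⟩
      exact (D'.edge_asymm this.2.1 hyx).elim
  · have hz' := keep hz (.single hxy)
    by_cases h : D.skeleton.Adj z y
    · rcases h with h | h
      · exact h
      · exact (D.acyclic z (((Relation.TransGen.single hz).tail hxy).tail h)).elim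
    · have hzy : z ≠ y := fun e => D.edge_asymm hxy (e ▸ hz)
      have := (him z x y).2 ⟨hz', hyx, hzy, fun e => h ((hadj z y).2 e)⟩
      exact (D.edge_asymm this.2.1 hxy).elim

/-- Each reversal of a covered disagreeing edge stays in the equivalence class and lowers the number
of disagreements. -/
theorem markovEquiv_of_adj_of_immorality {D D' : DAG n}
    (hadj : ∀ i j, D.skeleton.Adj i j ↔ D'.skeleton.Adj i j)
    (him : ∀ i k j, D.Immorality i k j ↔ D'.Immorality i k j) : D.MarkovEquiv D' := by
  obtain ⟨m, hm⟩ : ∃ m, {p : Fin n × Fin n | D.edge p.1 p.2 ∧ D'.edge p.2 p.1}.ncard = m := ⟨_, rfl⟩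
  induction m using Nat.strong_induction_on generalizing D with
  | _ m ih =>
    by_cases hne : ∃ x y, D.edge x y ∧ D'.edge y x
    · obtain ⟨x, y, hc, hyx⟩ := exists_covered hadj him hne
      have he := hc.markovEquiv
      refine he.trans (ih _ ?_ (fun i j => he.adj_iff.symm.trans (hadj i j))
        (fun i k j => ⟨fun h => (him i k j).1 (he.symm.immorality h),
          fun h => he.immorality ((him i k j).2 h)⟩) rfl)
      rw [← hm]
      refine Set.ncard_lt_ncard ⟨?_, fun h => ?_⟩ (Set.toFinite _)
      · rintro ⟨u, v⟩ ⟨h1 | h1, h2⟩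
        · obtain ⟨rfl, rfl⟩ := h1
          exact (D'.edge_asymm hyx h2).elim
        · exact ⟨h1.1, h2⟩
      · have := (@h (x, y) ⟨hc.1, hyx⟩).1
        rcases this with h' | h'
        · exact D.edge_ne hc.1 h'.1
        · exact h'.2 ⟨rfl, rfl⟩
    · have : D = D' := ext_edge fun u v => ⟨fun h => ?_, fun h => ?_⟩
      · rw [this]
        exact .refl _
      · exact ((hadj u v).1 (.inl h)).resolve_right fun e => hne ⟨u, v, h, e⟩
      · exact ((hadj u v).2 (.inl h)).resolve_right fun e => hne ⟨v, u, e, h⟩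

end DAG

/-! ### Perfect elimination orders -/

/-- `ρ` orders the vertices in `s` such that the earlier neighbours of each vertex form a clique. -/
def SimpleGraph.PerfectRank {V : Type*} (G : SimpleGraph V) (s : Finset V) (ρ : V → ℕ) : Prop :=
  Set.InjOn ρ s ∧ ∀ u ∈ s, ∀ v ∈ s, ∀ w ∈ s, G.Adj u w → G.Adj v w → ρ u < ρ w → ρ v < ρ w →
    u ≠ v → G.Adj u v

/-- Induction that removes the last vertex `v`, whose neighbours form a clique `N`. If `v ∉ q`, it
is put last again. If `v ∈ q`, the other vertices are first arranged with `N` in front, and then the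
order is `v`, the rest of `q`, the rest of `N`, all others. -/
theorem SimpleGraph.PerfectRank.exists_clique_first {V : Type*} [DecidableEq V]
    (G : SimpleGraph V) (s : Finset V) (ρ : V → ℕ) (h : G.PerfectRank s ρ)
    (q : Finset V) (hq : q ⊆ s) (hc : ∀ u ∈ q, ∀ v ∈ q, u ≠ v → G.Adj u v) :
    ∃ ρ', G.PerfectRank s ρ' ∧ ∀ u ∈ q, ∀ v ∈ s, v ∉ q → ρ' u < ρ' v := by
  classical
  induction hs : s.card generalizing s q with
  | zero =>
    obtain rfl := Finset.card_eq_zero.1 hs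
    exact ⟨ρ, h, by simp⟩
  | succ m ih =>
    have hne : s.Nonempty := Finset.card_pos.1 (by omega)
    obtain ⟨v, hv, hmax⟩ := s.exists_max_image ρ hne
    have hlt : ∀ u ∈ s, u ≠ v → ρ u < ρ v := fun u hu huv =>
      lt_of_le_of_ne (hmax u hu) fun e => huv (h.1 hu hv e)
    have ht : G.PerfectRank (s.erase v) ρ :=
      ⟨h.1.mono (Finset.coe_subset.2 (Finset.erase_subset _ _)), fun u hu w hw x hx =>
        h.2 u (Finset.mem_of_mem_erase hu) w (Finset.mem_of_mem_erase hw) x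
          (Finset.mem_of_mem_erase hx)⟩
    have hcard : (s.erase v).card = m := by rw [Finset.card_erase_of_mem hv]; omega
    by_cases hvq : v ∈ q
    · set N := (s.erase v).filter fun u => G.Adj u v with hN
      have memN : ∀ {u}, u ∈ N ↔ (u ≠ v ∧ u ∈ s) ∧ G.Adj u v := by simp [hN]
      have hNc : ∀ u ∈ N, ∀ w ∈ N, u ≠ w → G.Adj u w := fun u hu w hw huw => by
        obtain ⟨⟨h1, h2⟩, h3⟩ := memN.1 hu
        obtain ⟨⟨h4, h5⟩, h6⟩ := memN.1 hw
        exact h.2 u h2 w h5 v hv h3 h6 (hlt _ h2 h1) (hlt _ h5 h4) huw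
      have hqN : ∀ u ∈ q, u ≠ v → u ∈ N := fun u hu huv =>
        memN.2 ⟨⟨huv, hq hu⟩, hc u hu v hvq huv⟩
      obtain ⟨ρ₁, h1, h2⟩ := ih (s.erase v) ht N (Finset.filter_subset _ _) hNc hcard
      set M := s.sup ρ₁ + 2 with hM
      have hle : ∀ u ∈ s, ρ₁ u + 2 ≤ M := fun u hu => by
        have := Finset.le_sup (f := ρ₁) hu
        omega
      -- The offsets `1`, `M` and `2 * M` keep the four groups apart, since `M` exceeds every value
      -- of `ρ₁` on `s` by at least two.
      set ρ' : V → ℕ := fun u => if u = v then 0 else if u ∈ q then ρ₁ u + 1 else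
        if u ∈ N then ρ₁ u + M else ρ₁ u + 2 * M with hρ'
      have inj : ∀ u ∈ s, ∀ w ∈ s, u ≠ v → w ≠ v → ρ₁ u = ρ₁ w → u = w := fun u hu w hw huv hwv e =>
        h1.1 (by simp [huv, hu]) (by simp [hwv, hw]) e
      refine ⟨ρ', ⟨?_, ?_⟩, ?_⟩
      · intro u hu w hw e
        have hu' := hle u hu
        have hw' := hle w hw
        have hi := inj u hu w hw
        simp only [hρ'] at e
        split_ifs at e <;> first | (exfalso; omega) | (subst_vars; rfl) | (exact hi ‹_› ‹_› (by omega))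
      · intro u hu w hw x hx hux hwx hlu hlw huw
        have hu' := hle u hu
        have hw' := hle w hw
        have hx' := hle x hx
        have aux : ∀ z ∈ s, G.Adj z x → ρ' z < ρ' x → x ∉ q → x ∉ N → x ≠ v →
            z ∈ s.erase v ∧ ρ₁ z < ρ₁ x := by
          intro z hz hzx hl hxq hxN hxv
          have hzv : z ≠ v := by
            rintro rfl
            exact hxN (memN.2 ⟨⟨hxv, hx⟩, hzx.symm⟩)
          refine ⟨by simp [hzv, hz], ?_⟩
          by_cases hzN : z ∈ N
          · exact h2 z hzN x (by simp [hxv, hx]) hxN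
          · have hzq : z ∉ q := fun e => hzN (hqN z e hzv)
            simpa [hρ', hzv, hzq, hzN, hxq, hxN, hxv] using hl
        have aux2 : ∀ z ∈ s, ρ' z < ρ' x → x ∈ q → z ∈ q := by
          intro z hz hl hxq
          have := hle z hz
          by_contra hzq
          have hzv : z ≠ v := by rintro rfl; exact hzq hvq
          simp only [hρ', hzv, hzq, hxq, if_true, if_false] at hl
          split_ifs at hl <;> omega
        have aux3 : ∀ z ∈ s, ρ' z < ρ' x → x ∈ N → z = v ∨ z ∈ N := by
          intro z hz hl hxN
          have := hle z hz
          by_contra hzq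
          obtain ⟨hzv, hzN⟩ := not_or.1 hzq
          have hzq : z ∉ q := fun e => hzN (hqN z e hzv)
          have hxv := (memN.1 hxN).1.1
          simp only [hρ', hzv, hzq, hxN, hzN, hxv, if_true, if_false] at hl
          split_ifs at hl <;> omega
        by_cases hxv : x = v
        · simp [hρ', hxv] at hlu
        by_cases hxq : x ∈ q
        · exact hc u (aux2 u hu hlu hxq) w (aux2 w hw hlw hxq) huw
        by_cases hxN : x ∈ N
        · rcases aux3 u hu hlu hxN with rfl | e1 <;> rcases aux3 w hw hlw hxN with rfl | e2
          · exact (huw rfl).elim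
          · exact (memN.1 e2).2.symm
          · exact (memN.1 e1).2
          · exact hNc u e1 w e2 huw
        · obtain ⟨a1, a2⟩ := aux u hu hux hlu hxq hxN hxv
          obtain ⟨b1, b2⟩ := aux w hw hwx hlw hxq hxN hxv
          exact h1.2 u a1 w b1 x (by simp [hxv, hx]) hux hwx a2 b2 huw
      · intro u hu w hw hwq
        have hu' := hle u (hq hu)
        have hwv : w ≠ v := by rintro rfl; exact hwq hvq
        simp only [hρ', hu, hwq, hwv, if_true, if_false]
        split_ifs <;> omega
    · obtain ⟨ρ₁, h1, h2⟩ := ih (s.erase v) ht q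
        (fun u hu => Finset.mem_erase.2 ⟨fun e => hvq (e ▸ hu), hq hu⟩) hc hcard
      set M := s.sup ρ₁ + 1 with hM
      have hle : ∀ u ∈ s, ρ₁ u < M := fun u hu => by
        have := Finset.le_sup (f := ρ₁) hu
        omega
      have hup : ∀ u ∈ s, u ≠ v → Function.update ρ₁ v M u < M := fun u hu huv => by
        rw [Function.update_of_ne huv]; exact hle u hu
      refine ⟨Function.update ρ₁ v M, ⟨?_, ?_⟩, ?_⟩
      · intro u hu w hw e
        by_cases huv : u = v <;> by_cases hwv : w = v
        · rw [huv, hwv]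
        · subst huv
          have := hup w hw hwv
          rw [Function.update_self] at e
          omega
        · subst hwv
          have := hup u hu huv
          rw [Function.update_self] at e
          omega
        · rw [Function.update_of_ne huv, Function.update_of_ne hwv] at e
          exact h1.1 (by simpa [huv] using hu) (by simpa [hwv] using hw) e
      · intro u hu w hw x hx hux hwx hlu hlw huw
        by_cases hxv : x = v
        · subst hxv
          exact h.2 u hu w hw x hx hux hwx (hlt u hu hux.ne) (hlt w hw hwx.ne) huw
        · have hx' := hup x hx hxv
          have huv : u ≠ v := by rintro rfl; rw [Function.update_self] at hlu; omega
          have hwv : w ≠ v := by rintro rfl; rw [Function.update_self] at hlw; omega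
          rw [Function.update_of_ne huv, Function.update_of_ne hxv] at hlu
          rw [Function.update_of_ne hwv, Function.update_of_ne hxv] at hlw
          exact h1.2 u (by simp [huv, hu]) w (by simp [hwv, hw]) x (by simp [hxv, hx]) hux hwx hlu hlw huw
      · intro u hu w hw hwq
        have huv : u ≠ v := fun e => hvq (e ▸ hu)
        by_cases hwv : w = v
        · subst hwv
          rw [Function.update_self]
          exact hup u (hq hu) huv
        · rw [Function.update_of_ne huv, Function.update_of_ne hwv]
          exact h2 u hu w (by simp [hwv, hw]) hwq

namespace DAG

variable {n : ℕ} {D : DAG n}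

/-! ### Compelled edges -/

/-- The edges of `D` whose direction follows from the skeleton and the immoralities by Meek's
orientation rules. -/
inductive Compelled (D : DAG n) : Fin n → Fin n → Prop
  | immorality {a b d : Fin n} : D.Immorality a b d → Compelled D a b
  | away {a b d : Fin n} : Compelled D d a → D.edge a b → d ≠ b → ¬ D.skeleton.Adj d b →
      Compelled D a b
  | trans {a b d : Fin n} : Compelled D a d → Compelled D d b → D.skeleton.Adj a b →
      Compelled D a b
  | merge {a b d d' : Fin n} : Compelled D d b → Compelled D d' b → D.skeleton.Adj a d →
      D.skeleton.Adj a d' → d ≠ d' → ¬ D.skeleton.Adj d d' → D.skeleton.Adj a b →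
      ¬ (D.edge d a ∧ D.edge d' a) → Compelled D a b

theorem edge_of_adj_of_path {a b : Fin n} (h : D.skeleton.Adj a b)
    (h' : Relation.TransGen D.edge a b) : D.edge a b :=
  h.resolve_right fun e => D.acyclic a (h'.tail e)

theorem Compelled.edge_of_markovEquiv {a b : Fin n} (h : D.Compelled a b) {D' : DAG n}
    (he : D.MarkovEquiv D') : D'.edge a b := by
  induction h with
  | immorality h => exact (he.immorality h).1
  | @away a b d _ hab hdb hadj ih =>
    refine (he.adj_of_adj (.inl hab)).resolve_right fun e => ?_
    exact D.edge_asymm hab (he.symm.immorality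
      (⟨ih, e, hdb, fun e => hadj (he.symm.adj_of_adj e)⟩ : D'.Immorality d a b)).2.1
  | trans _ _ hadj ih1 ih2 =>
    exact edge_of_adj_of_path (he.adj_of_adj hadj) ((Relation.TransGen.single ih1).tail ih2)
  | @merge a b d d' _ _ h1 h2 hne hadj hab hn ih1 ih2 =>
    refine (he.adj_of_adj hab).resolve_right fun e => hn ?_
    have e1 : D'.edge d a := edge_of_adj_of_path (he.adj_of_adj h1).symm
      ((Relation.TransGen.single ih1).tail e)
    have e2 : D'.edge d' a := edge_of_adj_of_path (he.adj_of_adj h2).symm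
      ((Relation.TransGen.single ih2).tail e)
    have := he.symm.immorality
      (⟨e1, e2, hne, fun e => hadj (he.symm.adj_of_adj e)⟩ : D'.Immorality d a d')
    exact ⟨this.1, this.2.1⟩

theorem Compelled.edge {a b : Fin n} (h : D.Compelled a b) : D.edge a b :=
  h.edge_of_markovEquiv (.refl D)

/-- The edges that are not compelled, without their directions. -/
def freeGraph (D : DAG n) : SimpleGraph (Fin n) where
  Adj a b := D.skeleton.Adj a b ∧ ¬ D.Compelled a b ∧ ¬ D.Compelled b a
  symm := ⟨fun _ _ h => ⟨h.1.symm, h.2.2, h.2.1⟩⟩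
  loopless := ⟨fun i h => D.skeleton.loopless.irrefl i h.1⟩

/-- If `a` and `c` were not adjacent, the edge between `b` and `c` would be compelled, away from `a`
or by an immorality. A compelled edge `c → a` would compel `c → b` by transitivity. -/
theorem Compelled.compelled_or_free {a b c : Fin n} (h : D.Compelled a b)
    (hbc : D.freeGraph.Adj b c) : D.Compelled a c ∨ D.freeGraph.Adj a c := by
  obtain ⟨h1, h2, h3⟩ := hbc
  have hac : a ≠ c := by rintro rfl; exact h3 h
  have hadj : D.skeleton.Adj a c := by
    by_contra hadj
    rcases h1 with e | e
    · exact h2 (.away h e hac hadj)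
    · exact h3 (.immorality ⟨e, h.edge, hac.symm, fun e => hadj e.symm⟩)
  by_cases h4 : D.Compelled a c
  · exact .inl h4
  · exact .inr ⟨hadj, h4, fun h5 => h3 (.trans h5 h h1.symm)⟩

/-- Induction on the derivation: by `compelled_or_free` only a free edge between `a` and `c` must be
excluded, and the premises moved from `b` to `c` either compel it or compel the free edge between
`b` and `c`. This is why the components of the free graph behave like single vertices for arrows
from outside. -/
theorem Compelled.propagate {a b : Fin n} (h : D.Compelled a b) :
    ∀ {c}, D.freeGraph.Adj b c → D.Compelled a c := by
  induction h with
  | @immorality a b d h =>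
    intro c hbc
    have hab : D.Compelled a b := .immorality h
    have hdb : D.Compelled d b := .immorality h.symm
    refine (hab.compelled_or_free hbc).resolve_right fun hf => ?_
    have hdc : D.skeleton.Adj c d := by
      rcases hdb.compelled_or_free hbc with e | e
      · exact .inr e.edge
      · exact e.1.symm
    by_cases hcol : D.edge a c ∧ D.edge d c
    · exact hf.2.1 (.immorality ⟨hcol.1, hcol.2, h.2.2⟩)
    · exact hbc.2.2 (.merge hab hdb hf.1.symm hdc h.2.2.1 h.2.2.2 hbc.1.symm hcol)
  | @away a b d hda hab hdb hadj ih =>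
    intro c hbc
    refine ((Compelled.away hda hab hdb hadj).compelled_or_free hbc).resolve_right fun hf => ?_
    have hdc := ih hf
    rcases hbc.1 with e | e
    · exact hbc.2.1 (.immorality ⟨e, hdc.edge, hdb.symm, fun e => hadj e.symm⟩)
    · exact hbc.2.2 (.away hdc e hdb hadj)
  | @trans a b d had hdb hadj ih1 ih2 =>
    intro c hbc
    rcases (Compelled.trans had hdb hadj).compelled_or_free hbc with e | e
    · exact e
    · exact .trans had (ih2 hbc) e.1
  | @merge a b d d' h1 h2 h3 h4 h5 h6 h7 h8 ih1 ih2 =>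
    intro c hbc
    rcases (Compelled.merge h1 h2 h3 h4 h5 h6 h7 h8).compelled_or_free hbc with e | e
    · exact e
    · exact .merge (ih1 hbc) (ih2 hbc) h3 h4 h5 h6 e.1 h8

theorem Compelled.of_reachable {a b c : Fin n} (h : D.Compelled a b)
    (hbc : D.freeGraph.Reachable b c) : D.Compelled a c := by
  rw [SimpleGraph.reachable_iff_reflTransGen] at hbc
  induction hbc with
  | refl => exact h
  | tail _ h' ih => exact ih.propagate h'

theorem Compelled.not_reachable {a b : Fin n} (h : D.Compelled a b) :
    ¬ D.freeGraph.Reachable a b := fun h' =>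
  D.edge_irrefl a (h.of_reachable h'.symm).edge

theorem free_of_edge {a b : Fin n} (h : D.edge a b) (h' : ¬ D.Compelled a b) :
    D.freeGraph.Adj a b :=
  ⟨.inl h, h', fun e => D.edge_asymm h e.edge⟩

/-! ### Reorientation of a component -/

/-- The edges of `D`, except that those in the component of `t` are directed by `ρ`. -/
def reorientEdge (D : DAG n) (t : Fin n) (ρ : Fin n → ℕ) (u v : Fin n) : Prop :=
  (D.freeGraph.Reachable t u ∧ D.freeGraph.Reachable t v ∧ D.skeleton.Adj u v ∧ ρ u < ρ v) ∨
    (¬ (D.freeGraph.Reachable t u ∧ D.freeGraph.Reachable t v) ∧ D.edge u v)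

/-- An edge entering the component is compelled, so its tail points to every vertex of the
component. A path that passes through the component from outside can therefore skip all reoriented
edges and is a path of `D`, while a path that never leaves the component increases `ρ`. -/
theorem reorient_acyclic (t : Fin n) (ρ : Fin n → ℕ) (i : Fin n) :
    ¬ Relation.TransGen (D.reorientEdge t ρ) i i := by
  set τ : Fin n → Prop := fun u => D.freeGraph.Reachable t u with hτ
  have cross : ∀ {u v}, D.edge u v → ¬ τ u → τ v → ∀ v', τ v' → D.edge u v' := by
    intro u v h hu hv v' hv'
    have hc : D.Compelled u v := by
      by_contra hc
      exact hu (hv.trans (free_of_edge h hc).symm.reachable)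
    exact (hc.of_reachable (hv.symm.trans hv')).edge
  have outside : ∀ x, ¬ τ x → ∀ y, Relation.TransGen (D.reorientEdge t ρ) x y →
      (¬ τ y → Relation.TransGen D.edge x y) ∧
      (τ y → ∀ y', τ y' → Relation.TransGen D.edge x y') := by
    intro x hx y hxy
    induction hxy with
    | single h =>
      rcases h with h | h
      · exact (hx h.1).elim
      · exact ⟨fun _ => .single h.2, fun hy y' hy' => .single (cross h.2 hx hy y' hy')⟩
    | @tail y z _ h ih =>
      rcases h with h | h
      · exact ⟨fun hz => (hz h.2.1).elim, fun _ => ih.2 h.1⟩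
      · by_cases hy : τ y
        · exact ⟨fun _ => (ih.2 hy y hy).tail h.2, fun hz => (h.1 ⟨hy, hz⟩).elim⟩
        · exact ⟨fun _ => (ih.1 hy).tail h.2,
            fun hz z' hz' => (ih.1 hy).tail (cross h.2 hy hz z' hz')⟩
  have inside : ∀ x, τ x → ∀ y, Relation.TransGen (D.reorientEdge t ρ) x y →
      (∃ u, ¬ τ u ∧ Relation.TransGen (D.reorientEdge t ρ) x u ∧
        Relation.ReflTransGen (D.reorientEdge t ρ) u y) ∨ (τ y ∧ ρ x < ρ y) := by
    intro x hx y hxy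
    induction hxy with
    | @single y h =>
      rcases id h with h' | h'
      · exact .inr ⟨h'.2.1, h'.2.2.2⟩
      · exact .inl ⟨y, fun hy => h'.1 ⟨hx, hy⟩, .single h, .refl⟩
    | @tail y z hxy h ih =>
      rcases ih with ⟨u, h1, h2, h3⟩ | ih
      · exact .inl ⟨u, h1, h2, h3.tail h⟩
      · rcases id h with h' | h'
        · exact .inr ⟨h'.2.1, ih.2.trans h'.2.2.2⟩
        · exact .inl ⟨z, fun hz => h'.1 ⟨ih.1, hz⟩, hxy.tail h, .refl⟩
  have out : ∀ x, ¬ τ x → ¬ Relation.TransGen (D.reorientEdge t ρ) x x := fun x hx h =>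
    D.acyclic x ((outside x hx x h).1 hx)
  intro h
  by_cases hi : τ i
  · rcases inside i hi i h with ⟨u, h1, h2, h3⟩ | h
    · exact out u h1 (h2.trans_right h3)
    · exact lt_irrefl _ h.2
  · exact out i hi h

/-- `D`, except that the edges in the component of `t` are directed by `ρ`. -/
def reorient (D : DAG n) (t : Fin n) (ρ : Fin n → ℕ) : DAG n where
  edge := D.reorientEdge t ρ
  acyclic := reorient_acyclic t ρ

/-- Immoralities of `D` consist of compelled edges and are untouched. A new one is impossible: two
reoriented edges into `k` have adjacent tails by perfectness, and the tail of an edge from outside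
is adjacent to the whole component. -/
theorem reorient_markovEquiv (t : Fin n) (ρ : Fin n → ℕ) (s : Finset (Fin n))
    (hs : ∀ v, v ∈ s ↔ D.freeGraph.Reachable t v) (hρ : D.skeleton.PerfectRank s ρ) :
    D.MarkovEquiv (D.reorient t ρ) := by
  have hadj : ∀ i j, D.skeleton.Adj i j ↔ (D.reorient t ρ).skeleton.Adj i j := by
    intro i j
    constructor
    · intro h
      by_cases hi : D.freeGraph.Reachable t i ∧ D.freeGraph.Reachable t j
      · have : ρ i ≠ ρ j := fun e =>
          h.ne (hρ.1 (by simpa using (hs i).2 hi.1) (by simpa using (hs j).2 hi.2) e)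
        rcases lt_or_gt_of_ne this with e | e
        · exact .inl (.inl ⟨hi.1, hi.2, h, e⟩)
        · exact .inr (.inl ⟨hi.2, hi.1, h.symm, e⟩)
      · rcases h with h | h
        · exact .inl (.inr ⟨hi, h⟩)
        · exact .inr (.inr ⟨fun e => hi e.symm, h⟩)
    · rintro ((h | h) | (h | h))
      · exact h.2.2.1
      · exact .inl h.2
      · exact h.2.2.1.symm
      · exact .inr h.2
  refine markovEquiv_of_adj_of_immorality hadj fun i k j => ⟨fun h => ?_, fun h => ?_⟩
  · have h1 : ¬ (D.freeGraph.Reachable t i ∧ D.freeGraph.Reachable t k) := fun e =>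
      (Compelled.immorality h).not_reachable (e.1.symm.trans e.2)
    have h2 : ¬ (D.freeGraph.Reachable t j ∧ D.freeGraph.Reachable t k) := fun e =>
      (Compelled.immorality h.symm).not_reachable (e.1.symm.trans e.2)
    exact ⟨.inr ⟨h1, h.1⟩, .inr ⟨h2, h.2.1⟩, h.2.2.1, fun e => h.2.2.2 ((hadj i j).2 e)⟩
  · obtain ⟨h1, h2, hij, hn⟩ := h
    have hn' : ¬ D.skeleton.Adj i j := fun e => hn ((hadj i j).1 e)
    have mixed : ∀ {u v}, D.freeGraph.Reachable t u → D.freeGraph.Reachable t k →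
        ¬ (D.freeGraph.Reachable t v ∧ D.freeGraph.Reachable t k) → D.edge v k →
        D.skeleton.Adj v u := by
      intro u v hu hk hv hvk
      have hc : D.Compelled v k := by
        by_contra hc
        exact hv ⟨hk.trans (free_of_edge hvk hc).symm.reachable, hk⟩
      exact .inl (hc.of_reachable (hk.symm.trans hu)).edge
    rcases h1 with h1 | h1 <;> rcases h2 with h2 | h2
    · exact (hn' (hρ.2 i ((hs i).2 h1.1) j ((hs j).2 h2.1) k ((hs k).2 h1.2.1) h1.2.2.1 h2.2.2.1
        h1.2.2.2 h2.2.2.2 hij)).elim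
    · exact (hn' (mixed h1.1 h1.2.1 h2.1 h2.2).symm).elim
    · exact (hn' (mixed h2.1 h2.2.1 h1.1 h1.2)).elim
    · exact ⟨h1.2, h2.2, hij, hn'⟩

open scoped Classical in
/-- A topological order of `D`. -/
noncomputable def topRank (D : DAG n) (v : Fin n) : ℕ :=
  (Finset.univ.filter fun u => Relation.TransGen D.edge u v).card * n + v

/-- The summand `v` breaks ties and is recovered modulo `n`. -/
theorem topRank_injective (D : DAG n) : Function.Injective D.topRank := by
  intro u v h
  have := congrArg (· % n) h
  simpa [topRank, Nat.add_mod, Nat.mod_eq_of_lt u.2, Nat.mod_eq_of_lt v.2, Fin.ext_iff] using this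

theorem topRank_lt {u v : Fin n} (h : D.edge u v) : D.topRank u < D.topRank v := by
  classical
  have : (Finset.univ.filter fun w => Relation.TransGen D.edge w u).card <
      (Finset.univ.filter fun w => Relation.TransGen D.edge w v).card := by
    refine Finset.card_lt_card ⟨fun w hw => ?_, fun hc => ?_⟩
    · simp only [Finset.mem_filter, Finset.mem_univ, true_and] at hw ⊢
      exact hw.tail h
    · have := @hc u (by simpa using Relation.TransGen.single h)
      simp only [Finset.mem_filter, Finset.mem_univ, true_and] at this
      exact D.acyclic u this
  have h3 := Nat.mul_le_mul_right n (Nat.succ_le_of_lt this)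
  have hu := u.2
  simp only [topRank]
  rw [Nat.succ_mul] at h3
  omega

/-- An edge that is not compelled is reversed in some Markov equivalent graph. -/
theorem exists_markovEquiv_reversed {a b : Fin n} (h : D.edge a b) (hc : ¬ D.Compelled a b) :
    ∃ D', D.MarkovEquiv D' ∧ D'.edge b a := by
  classical
  have hf := free_of_edge h hc
  set s : Finset (Fin n) := Finset.univ.filter fun v => D.freeGraph.Reachable a v with hs
  have hs' : ∀ v, v ∈ s ↔ D.freeGraph.Reachable a v := by simp [hs]
  have hρ : D.skeleton.PerfectRank s D.topRank := by
    refine ⟨D.topRank_injective.injOn, fun u hu v hv w hw huw hvw h1 h2 huv => ?_⟩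
    have e1 : D.edge u w := huw.resolve_right fun e => lt_asymm h1 (topRank_lt e)
    have e2 : D.edge v w := hvw.resolve_right fun e => lt_asymm h2 (topRank_lt e)
    by_contra hn
    exact (Compelled.immorality ⟨e1, e2, huv, hn⟩).not_reachable
      (((hs' u).1 hu).symm.trans ((hs' w).1 hw))
  -- Making `b` the first vertex of its component turns all its edges there outwards, in particular
  -- the one to `a`.
  obtain ⟨ρ, h1, h2⟩ := hρ.exists_clique_first _ s _ {b} (by simpa [hs'] using hf.reachable)
    (by simp only [Finset.mem_singleton]; rintro u rfl v rfl h; exact (h rfl).elim)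
  refine ⟨D.reorient a ρ, reorient_markovEquiv a ρ s hs' h1, ?_⟩
  exact .inl ⟨hf.reachable, .rfl, .inr h, h2 b (by simp) a (by simp [hs'])
    (by simpa using D.edge_ne h)⟩

/-! ### The essential graph is a chain graph -/

theorem essentialGraph_dir_iff {a b : Fin n} : D.essentialGraph.dir a b ↔ D.Compelled a b := by
  refine ⟨fun h => ?_, fun h D' => h.edge_of_markovEquiv⟩
  by_contra hc
  obtain ⟨D', he, hba⟩ := exists_markovEquiv_reversed (h D (.refl D)) hc
  exact D'.edge_asymm hba (h D' he)

theorem essentialGraph_und : D.essentialGraph.und = D.freeGraph := by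
  ext a b
  change D.skeleton.Adj a b ∧ ¬ D.essentialGraph.dir a b ∧ ¬ D.essentialGraph.dir b a ↔ _
  rw [essentialGraph_dir_iff, essentialGraph_dir_iff]
  rfl

theorem edge_of_dir {a b : Fin n} (h : D.essentialGraph.dir a b) : D.edge a b := h D (.refl D)

theorem dir_or_und_of_edge {a b : Fin n} (h : D.edge a b) :
    D.essentialGraph.dir a b ∨ D.essentialGraph.und.Adj a b := by
  rw [essentialGraph_dir_iff, essentialGraph_und]
  by_cases hc : D.Compelled a b
  · exact .inl hc
  · exact .inr (free_of_edge h hc)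

theorem dir_of_reachable {a b c : Fin n} (h : D.essentialGraph.dir a b)
    (h' : D.essentialGraph.und.Reachable b c) : D.essentialGraph.dir a c := by
  rw [essentialGraph_dir_iff] at h ⊢
  rw [essentialGraph_und] at h'
  exact h.of_reachable h'

theorem not_reachable_of_dir {a b : Fin n} (h : D.essentialGraph.dir a b) :
    ¬ D.essentialGraph.und.Reachable a b := fun h' =>
  D.edge_irrefl a (edge_of_dir (dir_of_reachable h h'.symm))

/-- The components that can be reached by directed edges from the component `c`. -/
def laterComponents (D : DAG n) (c : D.essentialGraph.ChainComponent) :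
    Set D.essentialGraph.ChainComponent :=
  {c' | ∃ i ∈ c.supp, ∃ j ∈ c'.supp, Relation.TransGen D.essentialGraph.dir i j}

/-- Arrows into a component extend to all its vertices, so directed paths compose across components.
The inclusion is strict because `c'` is reachable from `c` but not from itself. Sorting by this
cardinality puts the sinks first. -/
theorem ncard_laterComponents_lt {c c' : D.essentialGraph.ChainComponent} {i j : Fin n}
    (hi : i ∈ c.supp) (hj : j ∈ c'.supp) (h : D.essentialGraph.dir i j) :
    (D.laterComponents c').ncard < (D.laterComponents c).ncard := by
  have hr : ∀ {c : D.essentialGraph.ChainComponent} {u v}, u ∈ c.supp → v ∈ c.supp →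
      D.essentialGraph.und.Reachable u v := fun hu hv =>
    SimpleGraph.ConnectedComponent.exact (hu.trans hv.symm)
  have hcyc : ∀ v, ¬ Relation.TransGen D.essentialGraph.dir v v := fun v hv =>
    D.acyclic v (Relation.TransGen.mono (fun _ _ h => edge_of_dir h) _ _ hv)
  refine Set.ncard_lt_ncard ⟨?_, fun hc => ?_⟩ (Set.toFinite _)
  · rintro c'' ⟨u, hu, v, hv, huv⟩
    exact ⟨i, hi, v, hv, .head (dir_of_reachable h (hr hj hu)) huv⟩
  · obtain ⟨u, hu, v, hv, huv⟩ := hc ⟨i, hi, j, hj, .single h⟩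
    rcases Relation.TransGen.tail'_iff.1 huv with ⟨w, huw, hwv⟩
    exact hcyc u (Relation.TransGen.tail' huw (dir_of_reachable hwv (hr hv hu)))

theorem exists_sinksFirst (D : DAG n) : ∃ order, D.essentialGraph.SinksFirst order := by
  classical
  let r : D.essentialGraph.ChainComponent → D.essentialGraph.ChainComponent → Prop :=
    fun c c' => (D.laterComponents c).ncard ≤ (D.laterComponents c').ncard
  have : Std.Total r := ⟨fun a b => le_total _ _⟩
  have : IsTrans _ r := ⟨fun a b c => le_trans⟩
  let _ : Fintype D.essentialGraph.ChainComponent := Fintype.ofFinite _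
  refine ⟨(Finset.univ.toList).insertionSort r, ?_, ?_, ?_⟩
  · exact (List.perm_insertionSort r _).nodup_iff.2 (Finset.nodup_toList _)
  · intro c
    exact (List.perm_insertionSort r _).mem_iff.2 (by simp)
  · refine (List.pairwise_insertionSort r _).imp fun {c c'} h i hi j hj hd => ?_
    exact absurd (ncard_laterComponents_lt hi hj hd) (not_lt.2 h)

/-- In a causal forest, no vertex has two parents in its chain component. -/
theorem IsCausalForest.parent_unique (h : D.IsCausalForest) {i j k : Fin n}
    (hi : D.essentialGraph.und.Adj i k) (hj : D.essentialGraph.und.Adj j k)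
    (hik : D.edge i k) (hjk : D.edge j k) : i = j := by
  by_contra hij
  have hadj : D.skeleton.Adj i j := by
    by_contra hn
    have : D.essentialGraph.dir i k :=
      essentialGraph_dir_iff.2 (.immorality ⟨hik, hjk, hij, hn⟩)
    exact hi.2.1 this
  -- An edge within a component is undirected, so `i`, `j` and `k` form a triangle in a tree.
  have hr : D.essentialGraph.und.Reachable i j := hi.reachable.trans hj.reachable.symm
  have hu : D.essentialGraph.und.Adj i j := by
    rcases hadj with e | e
    · exact (dir_or_und_of_edge e).resolve_left fun e => not_reachable_of_dir e hr
    · exact ((dir_or_und_of_edge e).resolve_left fun e => not_reachable_of_dir e hr.symm).symm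
  set c := D.essentialGraph.und.connectedComponentMk k with hc
  have mk : k ∈ c.supp := rfl
  have mi : i ∈ c.supp := SimpleGraph.ConnectedComponent.sound hi.reachable
  have mj : j ∈ c.supp := SimpleGraph.ConnectedComponent.sound hj.reachable
  refine (h c).isAcyclic.cliqueFree le_rfl {⟨i, mi⟩, ⟨j, mj⟩, ⟨k, mk⟩} ?_
  rw [SimpleGraph.is3Clique_triple_iff]
  exact ⟨hu, hi, hj⟩

end DAG

/-! ### Summing out variables of a Bayesian network -/

/-- Exchanging `x i` with `k` is an involution of the pairs `(x, k)`. -/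
theorem sum_sum_update {n K : ℕ} (i : Fin n) (F : (Fin n → Fin K) → ℝ) :
    ∑ x, ∑ k, F (Function.update x i k) = K * ∑ x, F x := by
  have hinv : Function.Involutive
      fun p : (Fin n → Fin K) × Fin K => (Function.update p.1 i p.2, p.1 i) := by
    rintro ⟨x, k⟩
    simp
  have h := Equiv.sum_comp hinv.toPerm fun p => F p.1
  rw [Fintype.sum_prod_type, Fintype.sum_prod_type] at h
  simpa [Finset.mul_sum] using h

theorem sum_conditional_mul {n K : ℕ} (i : Fin n) (q : (Fin n → Fin K) → Fin K → ℝ)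
    (hq : ∀ x k, q (Function.update x i k) = q x) (hsum : ∀ x, ∑ k, q x k = 1)
    (h : (Fin n → Fin K) → ℝ) (hh : ∀ x k, h (Function.update x i k) = h x) :
    K * ∑ x, q x (x i) * h x = ∑ x, h x := by
  rw [← sum_sum_update i]
  refine Finset.sum_congr rfl fun x _ => ?_
  simp [hq, hh, ← Finset.sum_mul, hsum]

/-- In a product of conditional probabilities, the variables outside of a set `A` that contains the
parents of its elements can be summed out. -/
theorem DAG.sum_prod_ancestral {n K : ℕ} (D : DAG n) (q : Fin n → (Fin n → Fin K) → Fin K → ℝ)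
    (hq : ∀ i x x', (∀ j, D.edge j i → x j = x' j) → q i x = q i x')
    (hsum : ∀ i x, ∑ k, q i x k = 1) (A : Finset (Fin n))
    (hA : ∀ i j, D.edge i j → j ∈ A → i ∈ A) (g : (Fin n → Fin K) → ℝ)
    (hg : ∀ i ∉ A, ∀ x k, g (Function.update x i k) = g x) (B : Finset (Fin n)) (hB : Disjoint A B) :
    (K : ℝ) ^ B.card * ∑ x, (∏ i ∈ A ∪ B, q i x (x i)) * g x =
      ∑ x, (∏ i ∈ A, q i x (x i)) * g x := by
  induction hm : B.card generalizing B with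
  | zero =>
    obtain rfl := Finset.card_eq_zero.1 hm
    simp
  | succ m ih =>
    -- A vertex of `B` without descendants in `B` has no children in `A ∪ B` either, as `A` contains
    -- the parents of its elements. Its value occurs only in its own factor, which sums to one.
    obtain ⟨i, hi, hmax⟩ := D.wellFounded_transGen_swap.has_min (B : Set (Fin n))
      (Finset.coe_nonempty.2 (Finset.card_pos.1 (by omega)))
    have hi : i ∈ B := hi
    have hiA : i ∉ A := fun h => (Finset.disjoint_left.1 hB h) hi
    have hch : ∀ j ∈ A ∪ B, ¬ D.edge i j := by
      intro j hj hij
      rcases Finset.mem_union.1 hj with h | h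
      · exact hiA (hA i j hij h)
      · exact hmax j h (.single hij)
    have hsplit : A ∪ B = insert i (A ∪ B.erase i) := by
      rw [← Finset.union_insert, Finset.insert_erase hi]
    have hnot : i ∉ A ∪ B.erase i := by simp [hiA]
    rw [← ih (B.erase i) (Finset.disjoint_of_subset_right (Finset.erase_subset _ _) hB)
      (by rw [Finset.card_erase_of_mem hi]; omega), pow_succ, mul_assoc]
    congr 1
    rw [hsplit]
    simp only [Finset.prod_insert hnot, mul_assoc]
    refine sum_conditional_mul i (q i) (fun x k => hq i _ _ fun j hj =>
      Function.update_of_ne (D.edge_ne hj) _ _) (hsum i) _ fun x k => ?_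
    rw [hg i hiA]
    congr 1
    refine Finset.prod_congr rfl fun j hj => ?_
    have hji : j ≠ i := fun e => hnot (e ▸ hj)
    have hij : ¬ D.edge i j := hch j (by rw [hsplit]; exact Finset.mem_insert_of_mem hj)
    rw [Function.update_of_ne hji, hq j (Function.update x i k) x fun l hl =>
      Function.update_of_ne (by rintro rfl; exact hij hl) _ _]

/-! ### Marginals under interventions -/

namespace CausalBandit

variable {n K : ℕ} (M : CausalBandit n K)

/-- The conditional probability of `X_i = k` given the other variables under the action `a`. -/
def factor : Intervention n K → Fin n → (Fin n → Fin K) → Fin K → ℝ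
  | none, i, x, k => M.cpd i x k
  | some (j, z), i, x, k => if i = j then (if k = z then 1 else 0) else M.cpd i x k

theorem prob_eq_prod (a : Intervention n K) (x : Fin n → Fin K) :
    M.prob a x = ∏ i, M.factor a i x (x i) := by
  rcases a with _ | ⟨j, z⟩
  · rfl
  · refine Finset.prod_congr rfl fun i _ => ?_
    by_cases h : i = j
    · subst h; simp [factor]
    · simp [factor, h]

theorem factor_parents (a : Intervention n K) (i : Fin n) (x x' : Fin n → Fin K)
    (h : ∀ j, M.D.edge j i → x j = x' j) : M.factor a i x = M.factor a i x' := by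
  funext k
  rcases a with _ | ⟨j, z⟩ <;> simp [factor, M.cpd_parents i x x' h]

theorem factor_sum (a : Intervention n K) (i : Fin n) (x : Fin n → Fin K) :
    ∑ k, M.factor a i x k = 1 := by
  rcases a with _ | ⟨j, z⟩
  · exact M.cpd_sum i x
  · by_cases h : i = j <;> simp [factor, h, M.cpd_sum]

theorem factor_nonneg (a : Intervention n K) (i : Fin n) (x : Fin n → Fin K) (k : Fin K) :
    0 ≤ M.factor a i x k := by
  rcases a with _ | ⟨j, z⟩
  · exact M.cpd_nonneg i x k
  · simp only [factor]
    split_ifs <;> simp [M.cpd_nonneg]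

theorem prob_nonneg (a : Intervention n K) (x : Fin n → Fin K) : 0 ≤ M.prob a x := by
  rw [prob_eq_prod]
  exact Finset.prod_nonneg fun i _ => M.factor_nonneg a i x _

/-- All sums run over full assignments, so a variable that was summed out still contributes a factor
`K`; the power keeps count of these. -/
theorem pow_mul_sum_prob (a : Intervention n K) (A : Finset (Fin n))
    (hA : ∀ i j, M.D.edge i j → j ∈ A → i ∈ A) (g : (Fin n → Fin K) → ℝ)
    (hg : ∀ i ∉ A, ∀ x k, g (Function.update x i k) = g x) :
    (K : ℝ) ^ Aᶜ.card * ∑ x, M.prob a x * g x = ∑ x, (∏ i ∈ A, M.factor a i x (x i)) * g x := by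
  rw [← M.D.sum_prod_ancestral (M.factor a) (M.factor_parents a) (M.factor_sum a) A hA g hg Aᶜ
    disjoint_compl_right]
  simp [prob_eq_prod]

theorem sum_prob (hK : 0 < K) (a : Intervention n K) : ∑ x, M.prob a x = 1 := by
  have h := M.pow_mul_sum_prob a ∅ (by simp) (fun _ => 1) (by simp)
  have hK' : (K : ℝ) ^ n ≠ 0 := by positivity
  simpa [hK'] using h

theorem marginal_eq (a : Intervention n K) (i : Fin n) (k : Fin K) :
    M.marginal a i k = ∑ x, M.prob a x * if x i = k then 1 else 0 := by
  simp [marginal]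

/-- After all non-ancestors of `i` are summed out, no factor that the intervention changes is left.
-/
theorem marginal_eq_of_not_isAncestor {v i : Fin n} (h : ¬ M.D.IsAncestor v i) (z k : Fin K) :
    M.marginal (some (v, z)) i k = M.marginal none i k := by
  classical
  have hK : 0 < K := z.pos
  set A : Finset (Fin n) := Finset.univ.filter fun j => M.D.IsAncestor j i with hA
  have mA : ∀ {j}, j ∈ A ↔ M.D.IsAncestor j i := by simp [hA]
  have key := fun a => M.pow_mul_sum_prob a A
    (fun j l hjl hl => mA.2 (Relation.ReflTransGen.head hjl (mA.1 hl)))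
    (fun x => if x i = k then 1 else 0) (fun j hj x l => by
      rw [Function.update_of_ne]
      rintro rfl
      exact hj (mA.2 .refl))
  rw [marginal_eq, marginal_eq]
  have hK' : (K : ℝ) ^ Aᶜ.card ≠ 0 := by positivity
  apply mul_left_cancel₀ hK'
  rw [key, key]
  refine Finset.sum_congr rfl fun x _ => ?_
  congr 1
  refine Finset.prod_congr rfl fun j hj => ?_
  have : j ≠ v := by rintro rfl; exact h (mA.1 hj)
  simp [factor, this]

theorem prob_some_eq_zero {v : Fin n} {z : Fin K} {x : Fin n → Fin K} (h : x v ≠ z) :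
    M.prob (some (v, z)) x = 0 := by
  rw [prob_eq_prod]
  exact Finset.prod_eq_zero (Finset.mem_univ v) (by simp [factor, h])

theorem marginal_some_self (v : Fin n) (z k : Fin K) :
    M.marginal (some (v, z)) v k = if k = z then 1 else 0 := by
  rw [marginal_eq]
  by_cases h : k = z
  · subst h
    refine Eq.trans ?_ ((M.sum_prob k.pos (some (v, k))).trans (if_pos rfl).symm)
    refine Finset.sum_congr rfl fun x _ => ?_
    by_cases hx : x v = k
    · simp [hx]
    · simp [M.prob_some_eq_zero hx]
  · rw [if_neg h]
    refine Finset.sum_eq_zero fun x _ => ?_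
    by_cases hx : x v = z
    · simp [hx, Ne.symm h]
    · simp [M.prob_some_eq_zero hx]

theorem sum_prob_comp (a : Intervention n K) (i : Fin n) (f : Fin K → ℝ) :
    ∑ x, M.prob a x * f (x i) = ∑ k, M.marginal a i k * f k := by
  simp_rw [marginal_eq, Finset.sum_mul]
  rw [Finset.sum_comm]
  refine Finset.sum_congr rfl fun x _ => ?_
  simp

theorem marginal_nonneg (a : Intervention n K) (i : Fin n) (k : Fin K) : 0 ≤ M.marginal a i k := by
  rw [marginal_eq]
  exact Finset.sum_nonneg fun x _ => mul_nonneg (M.prob_nonneg a x) (by positivity)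

theorem sum_marginal (hK : 0 < K) (a : Intervention n K) (i : Fin n) :
    ∑ k, M.marginal a i k = 1 := by
  have := M.sum_prob_comp a i fun _ => 1
  simpa [M.sum_prob hK] using this.symm

/-! ### The law of an action -/

theorem isProbabilityMeasure_law (hK : 0 < K) (a : Intervention n K) :
    IsProbabilityMeasure (M.law a) := by
  have := M.rewardLaw_prob
  refine ⟨?_⟩
  simp only [law, Measure.coe_finsetSum, Finset.sum_apply, Measure.smul_apply, measure_univ,
    smul_eq_mul, mul_one]
  rw [← ENNReal.ofReal_sum_of_nonneg fun x _ => M.prob_nonneg a x, M.sum_prob hK,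
    ENNReal.ofReal_one]

theorem integral_law (a : Intervention n K) (f : (Fin n → Fin K) × ℝ → ℝ) (hf : Measurable f)
    (hi : ∀ x, Integrable (fun r => f (x, r)) (M.rewardLaw (x M.rewardVar))) :
    ∫ p, f p ∂(M.law a) = ∑ x, M.prob a x * ∫ r, f (x, r) ∂(M.rewardLaw (x M.rewardVar)) := by
  have := M.rewardLaw_prob
  have hint : ∀ x, Integrable f ((Measure.dirac x).prod (M.rewardLaw (x M.rewardVar))) := fun x => by
    rw [Measure.dirac_prod, integrable_map_measure hf.aestronglyMeasurable
      measurable_prodMk_left.aemeasurable]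
    exact hi x
  rw [law, integral_finsetSum_measure fun x _ => (hint x).smul_measure ENNReal.ofReal_ne_top]
  refine Finset.sum_congr rfl fun x _ => ?_
  rw [integral_smul_measure, ENNReal.toReal_ofReal (M.prob_nonneg a x), smul_eq_mul,
    Measure.dirac_prod, integral_map measurable_prodMk_left.aemeasurable hf.aestronglyMeasurable]

variable {M}

/-- Integrability is assumed only for the law of an action. Under `do(X_R = k)` some assignment has
positive mass, and it gives `X_R` the value `k`, so the law of the reward given `k` is a component
of that mixture. -/
theorem RewardModel.integrable_rewardLaw (h : M.RewardModel) (k : Fin K) :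
    Integrable (fun r : ℝ => r) (M.rewardLaw k) := by
  have hK : 0 < K := k.pos
  have := M.rewardLaw_prob
  have := M.isProbabilityMeasure_law hK (some (M.rewardVar, k))
  have h1 : Integrable (fun p : (Fin n → Fin K) × ℝ => p.2) (M.law (some (M.rewardVar, k))) := by
    refine ((h.2 (some (M.rewardVar, k))).integrable.add
      (integrable_const (M.mean (some (M.rewardVar, k))))).congr (.of_forall fun p => ?_)
    simp
  obtain ⟨x, -, hx⟩ := Finset.exists_ne_zero_of_sum_ne_zero
    (ne_of_eq_of_ne (M.sum_prob hK (some (M.rewardVar, k))) one_ne_zero)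
  have hxk : x M.rewardVar = k := by
    by_contra hne
    exact hx (M.prob_some_eq_zero hne)
  have h2 : Integrable (fun p : (Fin n → Fin K) × ℝ => p.2)
      ((Measure.dirac x).prod (M.rewardLaw (x M.rewardVar))) := by
    rw [law] at h1
    have := (integrable_finsetSum_measure.1 h1) x (Finset.mem_univ x)
    refine (integrable_smul_measure ?_ ENNReal.ofReal_ne_top).1 this
    simpa using lt_of_le_of_ne (M.prob_nonneg _ x) hx.symm
  rw [Measure.dirac_prod, integrable_map_measure measurable_snd.aestronglyMeasurable
      measurable_prodMk_left.aemeasurable, hxk] at h2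
  exact h2

theorem RewardModel.mean_eq (h : M.RewardModel) (a : Intervention n K) :
    M.mean a = ∑ k, M.marginal a M.rewardVar k * ∫ r, r ∂(M.rewardLaw k) := by
  rw [mean, M.integral_law a _ measurable_snd fun x => h.integrable_rewardLaw _]
  exact M.sum_prob_comp a M.rewardVar fun k => ∫ r, r ∂(M.rewardLaw k)

theorem RewardModel.mean_rewardVar (h : M.RewardModel) (k : Fin K) :
    M.mean (some (M.rewardVar, k)) = ∫ r, r ∂(M.rewardLaw k) := by
  rw [h.mean_eq]
  simp [marginal_some_self]

theorem RewardModel.mean_eq_of_not_isAncestor (h : M.RewardModel) {v : Fin n}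
    (hv : ¬ M.D.IsAncestor v M.rewardVar) (z : Fin K) : M.mean (some (v, z)) = M.mean none := by
  rw [h.mean_eq, h.mean_eq]
  simp_rw [M.marginal_eq_of_not_isAncestor hv]

/-- Given the value of `X_R`, the reward has the same law under every action. This is why it
suffices to optimise over interventions on `X_R`. -/
theorem RewardModel.mean_eq_sum (h : M.RewardModel) (a : Intervention n K) :
    M.mean a = ∑ k, M.marginal a M.rewardVar k * M.mean (some (M.rewardVar, k)) := by
  rw [h.mean_eq]
  simp_rw [h.mean_rewardVar]

theorem RewardModel.mean_mem_Icc (h : M.RewardModel) (hK : 0 < K) (a : Intervention n K) :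
    M.mean a ∈ Set.Icc (0 : ℝ) 1 := by
  rw [h.mean_eq_sum]
  refine ⟨Finset.sum_nonneg fun k _ => mul_nonneg (M.marginal_nonneg _ _ _) (h.1 _ k).1, ?_⟩
  rw [← M.sum_marginal hK a M.rewardVar]
  exact Finset.sum_le_sum fun k _ => mul_le_of_le_one_right (M.marginal_nonneg _ _ _) (h.1 _ k).2

/-- Some intervention on the reward variable is at least as good as all actions. -/
theorem RewardModel.exists_optimal (h : M.RewardModel) (hK : 0 < K) :
    ∃ k, M.optimalMean = M.mean (some (M.rewardVar, k)) ∧ ∀ a, M.mean a ≤ M.optimalMean := by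
  have : Nonempty (Fin K) := ⟨⟨0, hK⟩⟩
  obtain ⟨k, hk⟩ := Finite.exists_max fun k => M.mean (some (M.rewardVar, k))
  have hle : ∀ a, M.mean a ≤ M.mean (some (M.rewardVar, k)) := fun a => by
    rw [h.mean_eq_sum, ← one_mul (M.mean (some (M.rewardVar, k))),
      ← M.sum_marginal hK a M.rewardVar, Finset.sum_mul]
    exact Finset.sum_le_sum fun k' _ => mul_le_mul_of_nonneg_left (hk k') (M.marginal_nonneg _ _ _)
  have : Nonempty (Fin n × Fin K) := ⟨(M.rewardVar, k)⟩
  have e : M.optimalMean = M.mean (some (M.rewardVar, k)) :=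
    le_antisymm (ciSup_le fun a => hle _)
      (le_ciSup (f := fun a : Fin n × Fin K => M.mean (some a)) (Set.finite_range _).bddAbove
        (M.rewardVar, k))
  exact ⟨k, e, fun a => e ▸ hle a⟩

/-- Hoeffding's lemma for a variable in `[0, 1]`; the proxy `1 / 4` is the source of the factor `2 /
ε ^ 2` in `reps`. -/
theorem hasSubgaussianMGF_indicator (hK : 0 < K) (a : Intervention n K) (y : Fin n) (k : Fin K) :
    HasSubgaussianMGF (fun p : (Fin n → Fin K) × ℝ =>
      (if p.1 y = k then (1 : ℝ) else 0) - M.marginal a y k) (1 / 4) (M.law a) := by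
  have := M.isProbabilityMeasure_law hK a
  have := M.rewardLaw_prob
  have hm : Measurable fun p : (Fin n → Fin K) × ℝ => if p.1 y = k then (1 : ℝ) else 0 :=
    Measurable.ite (measurableSet_eq_fun (by fun_prop) measurable_const) measurable_const
      measurable_const
  have h := hasSubgaussianMGF_of_mem_Icc (μ := M.law a) (a := 0) (b := 1) hm.aemeasurable
    (.of_forall fun p => by by_cases hp : p.1 y = k <;> simp [hp])
  have e : ∫ p, (if p.1 y = k then (1 : ℝ) else 0) ∂(M.law a) = M.marginal a y k := by
    rw [M.integral_law a _ hm fun x => integrable_const (if x y = k then (1 : ℝ) else 0), marginal]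
    refine Finset.sum_congr rfl fun x _ => ?_
    by_cases hx : x y = k <;> simp [hx]
  rw [e] at h
  convert h using 1
  rw [sub_zero, nnnorm_one]
  norm_num

end CausalBandit

/-! ### Concentration for adaptively chosen actions -/

namespace CausalBandit.IsInteraction

open scoped ENNReal NNReal

variable {n K : ℕ} {M : CausalBandit n K} {Ω : Type*} [mΩ : MeasurableSpace Ω] {P : Measure Ω}
  {ℱ : Filtration ℕ mΩ} {T : ℕ} {A : ℕ → Ω → Intervention n K} {X : ℕ → Ω → Fin n → Fin K}
  {R : ℕ → Ω → ℝ}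

theorem measurable_obs (h : M.IsInteraction P ℱ T A X R) (t : ℕ) :
    Measurable[ℱ (t + 1)] fun ω => (X t ω, R t ω) :=
  (h.obs_meas t).prodMk (h.reward_meas t)

theorem measurable_comp (h : M.IsInteraction P ℱ T A X R) (t : ℕ) {β : Type*} [MeasurableSpace β]
    (g : Intervention n K → (Fin n → Fin K) × ℝ → β) (hg : ∀ a, Measurable (g a)) :
    Measurable[ℱ (t + 1)] fun ω => g (A t ω) (X t ω, R t ω) := by
  intro S hS
  have : (fun ω => g (A t ω) (X t ω, R t ω)) ⁻¹' S =
      ⋃ a, {ω | A t ω = a} ∩ (fun ω => (X t ω, R t ω)) ⁻¹' (g a ⁻¹' S) := by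
    ext ω
    simp
  rw [this]
  exact MeasurableSet.iUnion fun a => (ℱ.mono (Nat.le_succ t) _ (h.action_meas t a)).inter
    (h.measurable_obs t (hg a hS))

theorem map_restrict [IsProbabilityMeasure P] (h : M.IsInteraction P ℱ T A X R) {t : ℕ}
    (ht : t < T) {F : Set Ω} (hF : MeasurableSet[ℱ t] F) (a : Intervention n K)
    (hFa : ∀ ω ∈ F, A t ω = a) :
    (P.restrict F).map (fun ω => (X t ω, R t ω)) = P F • M.law a := by
  have hm : Measurable fun ω => (X t ω, R t ω) := (h.measurable_obs t).mono (ℱ.le _) le_rfl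
  ext S hS
  rw [Measure.map_apply hm hS, Measure.restrict_apply (hm hS), Set.inter_comm,
    Measure.smul_apply, smul_eq_mul]
  refine (h.cond_law t ht F hF S hS).trans ?_
  rw [setLIntegral_congr_fun (g := fun _ => M.law a S) (ℱ.le _ _ hF)
    fun ω hω => by simp only [hFa ω hω], setLIntegral_const, mul_comm]

theorem setLIntegral_le [IsProbabilityMeasure P] (h : M.IsInteraction P ℱ T A X R) {t : ℕ}
    (ht : t < T) {g : Intervention n K → (Fin n → Fin K) × ℝ → ℝ≥0∞} (hg : ∀ a, Measurable (g a))
    (hg1 : ∀ a, ∫⁻ p, g a p ∂(M.law a) ≤ 1) {F : Set Ω} (hF : MeasurableSet[ℱ t] F) :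
    ∫⁻ ω in F, g (A t ω) (X t ω, R t ω) ∂P ≤ P F := by
  have hm : Measurable fun ω => (X t ω, R t ω) := (h.measurable_obs t).mono (ℱ.le _) le_rfl
  have hFa : ∀ a, MeasurableSet[ℱ t] (F ∩ {ω | A t ω = a}) := fun a => hF.inter (h.action_meas t a)
  have hU : F = ⋃ a, F ∩ {ω | A t ω = a} := by ext ω; simp
  have hd : Pairwise (Function.onFun Disjoint fun a => F ∩ {ω | A t ω = a}) := by
    intro a b hab
    refine Set.disjoint_left.2 fun ω h1 h2 => hab ?_
    exact h1.2.symm.trans h2.2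
  have e1 : ∫⁻ ω in F, g (A t ω) (X t ω, R t ω) ∂P =
      ∑' a, ∫⁻ ω in F ∩ {ω | A t ω = a}, g (A t ω) (X t ω, R t ω) ∂P := by
    rw [← lintegral_iUnion (fun a => ℱ.le _ _ (hFa a)) hd, ← hU]
  have e2 : P F = ∑' a, P (F ∩ {ω | A t ω = a}) := by
    rw [← measure_iUnion hd fun a => ℱ.le _ _ (hFa a), ← hU]
  rw [e1, e2]
  refine ENNReal.tsum_le_tsum fun a => ?_
  rw [setLIntegral_congr_fun (g := fun ω => g a (X t ω, R t ω)) (ℱ.le _ _ (hFa a))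
    fun ω hω => by simp only [show A t ω = a from hω.2], ← lintegral_map (hg a) hm,
    h.map_restrict ht (hFa a) a fun ω hω => hω.2, lintegral_smul_measure, smul_eq_mul]
  exact mul_le_of_le_one_right' (hg1 a)

/-- The tower property in terms of measures: by `setLIntegral_le`, the measure with density `g` is
dominated by `P` on the events known before round `t`, and `Y` is measurable with respect to these.
-/
theorem lintegral_mul_le [IsProbabilityMeasure P] (h : M.IsInteraction P ℱ T A X R) {t : ℕ}
    (ht : t < T) {g : Intervention n K → (Fin n → Fin K) × ℝ → ℝ≥0∞} (hg : ∀ a, Measurable (g a))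
    (hg1 : ∀ a, ∫⁻ p, g a p ∂(M.law a) ≤ 1) {Y : Ω → ℝ≥0∞} (hY : Measurable[ℱ t] Y) :
    ∫⁻ ω, g (A t ω) (X t ω, R t ω) * Y ω ∂P ≤ ∫⁻ ω, Y ω ∂P := by
  have hG : Measurable fun ω => g (A t ω) (X t ω, R t ω) :=
    (h.measurable_comp t g hg).mono (ℱ.le _) le_rfl
  have hle : (P.withDensity fun ω => g (A t ω) (X t ω, R t ω)).trim (ℱ.le t) ≤ P.trim (ℱ.le t) := by
    refine Measure.le_iff.2 fun F hF => ?_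
    rw [trim_measurableSet_eq _ hF, trim_measurableSet_eq _ hF, withDensity_apply _ (ℱ.le _ _ hF)]
    exact h.setLIntegral_le ht hg hg1 hF
  calc ∫⁻ ω, g (A t ω) (X t ω, R t ω) * Y ω ∂P
      = ∫⁻ ω, Y ω ∂(P.withDensity fun ω => g (A t ω) (X t ω, R t ω)) :=
        (lintegral_withDensity_eq_lintegral_mul P hG (hY.mono (ℱ.le t) le_rfl)).symm
    _ = ∫⁻ ω, Y ω ∂((P.withDensity fun ω => g (A t ω) (X t ω, R t ω)).trim (ℱ.le t)) :=
        (lintegral_trim (ℱ.le t) hY).symm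
    _ ≤ ∫⁻ ω, Y ω ∂(P.trim (ℱ.le t)) := lintegral_mono' hle le_rfl
    _ = ∫⁻ ω, Y ω ∂P := lintegral_trim (ℱ.le t) hY

open scoped Classical in
/-- A product of factors of conditional expectation at most one, over the rounds in which a
predictable event occurs, has expectation at most one. -/
theorem lintegral_prod_le [IsProbabilityMeasure P] (h : M.IsInteraction P ℱ T A X R)
    {g : Intervention n K → (Fin n → Fin K) × ℝ → ℝ≥0∞} (hg : ∀ a, Measurable (g a))
    (hg1 : ∀ a, ∫⁻ p, g a p ∂(M.law a) ≤ 1) (F : ℕ → Set Ω) (hF : ∀ t, MeasurableSet[ℱ t] (F t))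
    (t : ℕ) (ht : t ≤ T) :
    Measurable[ℱ t] (fun ω => ∏ s ∈ Finset.range t,
      if ω ∈ F s then g (A s ω) (X s ω, R s ω) else 1) ∧
    ∫⁻ ω, ∏ s ∈ Finset.range t, (if ω ∈ F s then g (A s ω) (X s ω, R s ω) else 1) ∂P ≤ 1 := by
  induction t with
  | zero => exact ⟨by simp, by simp⟩
  | succ t ih =>
    obtain ⟨ih1, ih2⟩ := ih (by omega)
    set Z : Ω → ℝ≥0∞ := fun ω => ∏ s ∈ Finset.range t,
      if ω ∈ F s then g (A s ω) (X s ω, R s ω) else 1 with hZ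
    simp only [Finset.prod_range_succ]
    refine ⟨?_, ?_⟩
    · refine Measurable.mul (ih1.mono (ℱ.mono (Nat.le_succ t)) le_rfl) ?_
      exact Measurable.ite (ℱ.mono (Nat.le_succ t) _ (hF t)) (h.measurable_comp t g hg)
        measurable_const
    · have hm1 : Measurable[ℱ t] ((F t).indicator Z) := ih1.indicator (hF t)
      have hm2 : Measurable[ℱ t] ((F t)ᶜ.indicator Z) := ih1.indicator (hF t).compl
      have e : ∀ ω, (∏ s ∈ Finset.range t, if ω ∈ F s then g (A s ω) (X s ω, R s ω) else 1) *
          (if ω ∈ F t then g (A t ω) (X t ω, R t ω) else 1) =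
          g (A t ω) (X t ω, R t ω) * (F t).indicator Z ω + (F t)ᶜ.indicator Z ω := by
        intro ω
        by_cases hω : ω ∈ F t
        · simp [hω, hZ, mul_comm]
        · simp [hω, hZ]
      simp_rw [e]
      rw [lintegral_add_right _ (hm2.mono (ℱ.le _) le_rfl)]
      calc _ ≤ ∫⁻ ω, (F t).indicator Z ω ∂P + ∫⁻ ω, (F t)ᶜ.indicator Z ω ∂P :=
            add_le_add_left (h.lintegral_mul_le (by omega) hg hg1 hm1) _
        _ = ∫⁻ ω, Z ω ∂P := by
            rw [← lintegral_add_right _ (hm2.mono (ℱ.le _) le_rfl)]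
            simp_rw [Set.indicator_self_add_compl_apply]
        _ ≤ 1 := ih2

open scoped Classical in
/-- The Azuma–Hoeffding bound for the rounds in which a predictable event occurs. -/
theorem measure_le_sum_le [IsProbabilityMeasure P] (h : M.IsInteraction P ℱ T A X R)
    {f : (Fin n → Fin K) × ℝ → ℝ} (hf : Measurable f) {μ : Intervention n K → ℝ} {c : ℝ≥0}
    (hsub : ∀ a, HasSubgaussianMGF (fun p => f p - μ a) c (M.law a)) (F : ℕ → Set Ω)
    (hF : ∀ t, MeasurableSet[ℱ t] (F t)) {m : ℕ}
    (hm : ∀ ω, ((Finset.range T).filter fun t => ω ∈ F t).card ≤ m) {r : ℝ} (hr : 0 ≤ r) :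
    P {ω | r ≤ ∑ t ∈ (Finset.range T).filter (fun t => ω ∈ F t), (f (X t ω, R t ω) - μ (A t ω))}
      ≤ ENNReal.ofReal (Real.exp (-(r ^ 2 / (2 * c * m)))) := by
  -- This value optimises the Chernoff exponent. If `c * m = 0`, then `l = 0` and the claimed bound
  -- is the trivial one.
  set l : ℝ := r / (c * m) with hl
  have hl0 : 0 ≤ l := by positivity
  set g : Intervention n K → (Fin n → Fin K) × ℝ → ℝ≥0∞ := fun a p =>
    ENNReal.ofReal (Real.exp (l * (f p - μ a) - c * l ^ 2 / 2)) with hg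
  have hgm : ∀ a, Measurable (g a) := fun a => by fun_prop
  have hg1 : ∀ a, ∫⁻ p, g a p ∂(M.law a) ≤ 1 := fun a => by
    have hi := (hsub a).integrable_exp_mul l
    have e : ∀ p, Real.exp (l * (f p - μ a) - c * l ^ 2 / 2) =
        Real.exp (l * (f p - μ a)) * Real.exp (-(c * l ^ 2 / 2)) := fun p => by
      rw [← Real.exp_add, sub_eq_add_neg]
    simp only [hg, e]
    rw [← ofReal_integral_eq_lintegral_ofReal (hi.mul_const _)
      (.of_forall fun p => by positivity), integral_mul_const]
    rw [ENNReal.ofReal_le_one]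
    have := (hsub a).mgf_le l
    rw [mgf] at this
    calc _ ≤ Real.exp (c * l ^ 2 / 2) * Real.exp (-(c * l ^ 2 / 2)) :=
          mul_le_mul_of_nonneg_right this (Real.exp_nonneg _)
      _ = 1 := by rw [← Real.exp_add]; simp
  obtain ⟨hZm, hZ⟩ := h.lintegral_prod_le hgm hg1 F hF T le_rfl
  have hval : ∀ ω, ∏ s ∈ Finset.range T, (if ω ∈ F s then g (A s ω) (X s ω, R s ω) else 1) =
      ENNReal.ofReal (Real.exp (l * ∑ t ∈ (Finset.range T).filter (fun t => ω ∈ F t),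
        (f (X t ω, R t ω) - μ (A t ω)) -
        ((Finset.range T).filter fun t => ω ∈ F t).card * (c * l ^ 2 / 2))) := fun ω => by
    rw [← Finset.prod_filter, ← ENNReal.ofReal_prod_of_nonneg fun _ _ => (Real.exp_nonneg _),
      ← Real.exp_sum, Finset.sum_sub_distrib, ← Finset.mul_sum, Finset.sum_const, nsmul_eq_mul]
  have hsubset : {ω | r ≤ ∑ t ∈ (Finset.range T).filter (fun t => ω ∈ F t),
      (f (X t ω, R t ω) - μ (A t ω))} ⊆ {ω | ENNReal.ofReal (Real.exp (r ^ 2 / (2 * c * m))) ≤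
        ∏ s ∈ Finset.range T, (if ω ∈ F s then g (A s ω) (X s ω, R s ω) else 1)} := by
    intro ω hω
    simp only [Set.mem_ofPred_eq] at hω ⊢
    rw [hval]
    refine ENNReal.ofReal_le_ofReal (Real.exp_le_exp.2 ?_)
    have h1 := mul_le_mul_of_nonneg_left hω hl0
    have h2 : (((Finset.range T).filter fun t => ω ∈ F t).card : ℝ) * (c * l ^ 2 / 2) ≤
        m * (c * l ^ 2 / 2) :=
      mul_le_mul_of_nonneg_right (by exact_mod_cast hm ω) (by positivity)
    have h3 : r ^ 2 / (2 * c * m) = l * r - m * (c * l ^ 2 / 2) := by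
      rw [hl]
      by_cases hcm : (c * m : ℝ) = 0
      · have : (2 * c * m : ℝ) = 0 := by rw [mul_assoc, hcm, mul_zero]
        simp [hcm, this]
      · have hc : (c : ℝ) ≠ 0 := left_ne_zero_of_mul hcm
        have hm' : (m : ℝ) ≠ 0 := right_ne_zero_of_mul hcm
        field_simp
        ring
    linarith
  have hmk := mul_meas_ge_le_lintegral₀ (μ := P) (hZm.mono (ℱ.le T) le_rfl).aemeasurable
    (ENNReal.ofReal (Real.exp (r ^ 2 / (2 * c * m))))
  have hpos : ENNReal.ofReal (Real.exp (r ^ 2 / (2 * c * m))) ≠ 0 := by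
    simpa using Real.exp_pos _
  refine (measure_mono hsubset).trans ?_
  rw [Real.exp_neg, ENNReal.ofReal_inv_of_pos (Real.exp_pos _), ← one_div,
    ENNReal.le_div_iff_mul_le (.inl hpos) (.inl ENNReal.ofReal_ne_top), mul_comm]
  exact hmk.trans hZ

open scoped Classical in
theorem measure_le_abs_sum_le [IsProbabilityMeasure P] (h : M.IsInteraction P ℱ T A X R)
    {f : (Fin n → Fin K) × ℝ → ℝ} (hf : Measurable f) {μ : Intervention n K → ℝ} {c : ℝ≥0}
    (hsub : ∀ a, HasSubgaussianMGF (fun p => f p - μ a) c (M.law a)) (F : ℕ → Set Ω)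
    (hF : ∀ t, MeasurableSet[ℱ t] (F t)) {m : ℕ}
    (hm : ∀ ω, ((Finset.range T).filter fun t => ω ∈ F t).card ≤ m) {r : ℝ} (hr : 0 ≤ r) :
    P {ω | r ≤ |∑ t ∈ (Finset.range T).filter (fun t => ω ∈ F t), (f (X t ω, R t ω) - μ (A t ω))|}
      ≤ ENNReal.ofReal (2 * Real.exp (-(r ^ 2 / (2 * c * m)))) := by
  have h1 := h.measure_le_sum_le hf hsub F hF hm hr
  have h2 := h.measure_le_sum_le (f := fun p => -f p) hf.neg (μ := fun a => -μ a) (c := c)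
    (fun a => (hsub a).neg.congr (.of_forall fun p => by simp [neg_add_eq_sub])) F hF hm hr
  refine (measure_mono (t := _ ∪ _) ?_).trans ((measure_union_le _ _).trans
    ((add_le_add h1 h2).trans_eq ?_))
  · intro ω hω
    rcases le_abs.1 (show r ≤ |_| from hω) with e | e
    · exact .inl e
    · refine .inr (e.trans_eq ?_)
      rw [← Finset.sum_neg_distrib]
      exact Finset.sum_congr rfl fun t _ => by ring
  · rw [← ENNReal.ofReal_add (Real.exp_nonneg _) (Real.exp_nonneg _), ← two_mul]

end CausalBandit.IsInteraction

namespace DAG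

variable {n : ℕ} {D : DAG n}

/-! ### The out-trees on the chain components of a causal forest -/

/-- `u → v` is an edge of `D` inside a chain component. -/
def treeEdge (D : DAG n) (u v : Fin n) : Prop := D.essentialGraph.und.Adj u v ∧ D.edge u v

/-- The vertices that can be reached from `u` by edges of `D` inside its chain component. -/
def treeDesc (D : DAG n) (u : Fin n) : Set (Fin n) := {w | Relation.ReflTransGen D.treeEdge u w}

theorem mem_treeDesc_self (u : Fin n) : u ∈ D.treeDesc u := Relation.ReflTransGen.refl

theorem treeDesc_subset {u v : Fin n} (h : v ∈ D.treeDesc u) : D.treeDesc v ⊆ D.treeDesc u :=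
  fun _ hw => Relation.ReflTransGen.trans h hw

theorem treeEdge.mem_treeDesc {u v : Fin n} (h : D.treeEdge u v) : v ∈ D.treeDesc u :=
  Relation.ReflTransGen.single h

theorem isAncestor_of_mem_treeDesc {u v : Fin n} (h : v ∈ D.treeDesc u) : D.IsAncestor u v :=
  Relation.ReflTransGen.mono (fun _ _ h => h.2) _ _ h

theorem treeEdge.notMem_treeDesc {u v : Fin n} (h : D.treeEdge u v) : u ∉ D.treeDesc v := fun h' =>
  D.acyclic u (Relation.TransGen.head' h.2 (isAncestor_of_mem_treeDesc h'))

theorem adj_iff_treeEdge {u v : Fin n} :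
    D.essentialGraph.und.Adj u v ↔ D.treeEdge u v ∨ D.treeEdge v u := by
  constructor
  · intro h
    rcases h.1 with e | e
    · exact .inl ⟨h, e⟩
    · exact .inr ⟨h.symm, e⟩
  · rintro (h | h)
    · exact h.1
    · exact h.1.symm

theorem eq_of_mem_treeDesc {u v : Fin n} (h : v ∈ D.treeDesc u) (h' : u ∈ D.treeDesc v) : u = v := by
  rcases Relation.reflTransGen_iff_eq_or_transGen.1 (isAncestor_of_mem_treeDesc h) with e | e
  · exact e.symm
  · exact (D.acyclic u (e.trans_left (isAncestor_of_mem_treeDesc h'))).elim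

theorem IsCausalForest.treeEdge_unique (hf : D.IsCausalForest) {i j k : Fin n}
    (hi : D.treeEdge i k) (hj : D.treeEdge j k) : i = j :=
  hf.parent_unique hi.1 hj.1 hi.2 hj.2

theorem IsCausalForest.mem_treeDesc_of_treeEdge (hf : D.IsCausalForest) {u w w' : Fin n}
    (h : w' ∈ D.treeDesc u) (hw : D.treeEdge w w') (hne : w' ≠ u) : w ∈ D.treeDesc u := by
  rcases Relation.ReflTransGen.cases_tail h with e | ⟨z, hz, hzw⟩
  · exact (hne e).elim
  · exact hf.treeEdge_unique hzw hw ▸ hz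

/-- Uniqueness of parents makes the descendant sets a laminar family. -/
theorem IsCausalForest.treeDesc_total (hf : D.IsCausalForest) {u v w : Fin n}
    (hu : w ∈ D.treeDesc u) (hv : w ∈ D.treeDesc v) : u ∈ D.treeDesc v ∨ v ∈ D.treeDesc u := by
  induction hu using Relation.ReflTransGen.head_induction_on with
  | refl => exact .inl hv
  | @head a c hac hcw ih =>
    rcases ih with h | h
    · by_cases hcv : c = v
      · exact .inr (hcv ▸ hac.mem_treeDesc)
      · exact .inl (hf.mem_treeDesc_of_treeEdge h hac hcv)
    · exact .inr (treeDesc_subset hac.mem_treeDesc h)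

/-! ### Branches and central nodes of subtrees -/

/-- `W` is a connected set of vertices of a chain component that contains all descendants of its
elements in the component. -/
structure IsSubtree (D : DAG n) (W : Set (Fin n)) : Prop where
  down : ∀ u ∈ W, ∀ v, D.treeEdge u v → v ∈ W
  conn : ∀ u ∈ W, ∀ v ∈ W, (CNUCB.subgraphOn D.essentialGraph.und W).Reachable u v

theorem IsSubtree.treeDesc_subset {W : Set (Fin n)} (hW : D.IsSubtree W) {u : Fin n} (hu : u ∈ W) :
    D.treeDesc u ⊆ W := by
  intro w hw
  induction hw with
  | refl => exact hu
  | tail _ h ih => exact hW.down _ ih _ h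

theorem isSubtree_supp (c : D.essentialGraph.ChainComponent) : D.IsSubtree c.supp := by
  have hadj : ∀ u ∈ c.supp, ∀ v, D.essentialGraph.und.Adj u v → v ∈ c.supp := fun u hu v h =>
    (SimpleGraph.ConnectedComponent.sound h.reachable.symm).trans hu
  refine ⟨fun u hu v h => hadj u hu v h.1, fun u hu v hv => ?_⟩
  have h : D.essentialGraph.und.Reachable u v :=
    SimpleGraph.ConnectedComponent.exact (hu.trans hv.symm)
  rw [SimpleGraph.reachable_iff_reflTransGen] at h
  have : v ∈ c.supp ∧ (CNUCB.subgraphOn D.essentialGraph.und c.supp).Reachable u v := by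
    clear hv
    induction h with
    | refl => exact ⟨hu, .rfl⟩
    | @tail w z _ hwz ih =>
      have hz := hadj w ih.1 z hwz
      have : (CNUCB.subgraphOn D.essentialGraph.und c.supp).Adj w z := ⟨hwz, ih.1, hz⟩
      exact ⟨hz, ih.2.trans this.reachable⟩
  exact this.2

theorem isSubtree_treeDesc (r : Fin n) : D.IsSubtree (D.treeDesc r) := by
  have key : ∀ u ∈ D.treeDesc r,
      (CNUCB.subgraphOn D.essentialGraph.und (D.treeDesc r)).Reachable r u := by
    intro u hu
    induction hu with
    | refl => exact .rfl
    | @tail w z hw hwz ih =>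
      have : (CNUCB.subgraphOn D.essentialGraph.und (D.treeDesc r)).Adj w z :=
        ⟨hwz.1, hw, Relation.ReflTransGen.tail hw hwz⟩
      exact ih.trans this.reachable
  exact ⟨fun u hu v h => Relation.ReflTransGen.tail hu h,
    fun u hu v hv => (key u hu).symm.trans (key v hv)⟩

variable {W : Set (Fin n)}

theorem IsSubtree.adj_child (hW : D.IsSubtree W) {v y : Fin n} (hv : v ∈ W) (h : D.treeEdge v y) :
    (CNUCB.subgraphOn D.essentialGraph.und W).Adj v y := ⟨h.1, hv, hW.down v hv y h⟩

/-- The only edge by which a walk can leave the descendants of `y` is the one to the unique parent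
`v`, and it is cut. With `branch_parent`, this translates the undirected branches of the algorithm
into the unknown orientation. -/
theorem IsSubtree.branch_child (hW : D.IsSubtree W) (hf : D.IsCausalForest) {v y : Fin n}
    (hv : v ∈ W) (h : D.treeEdge v y) :
    CNUCB.branch (CNUCB.subgraphOn D.essentialGraph.und W) v y = D.treeDesc y := by
  have hy := hW.down v hv y h
  ext u
  constructor
  · intro hu
    replace hu := (SimpleGraph.reachable_iff_reflTransGen _ _).1 hu
    induction hu with
    | refl => exact mem_treeDesc_self y
    | @tail w z _ hwz ih =>
      rw [SimpleGraph.deleteEdges_adj] at hwz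
      rcases adj_iff_treeEdge.1 hwz.1.1 with e | e
      · exact Relation.ReflTransGen.tail ih e
      · refine hf.mem_treeDesc_of_treeEdge ih e ?_
        rintro rfl
        obtain rfl := hf.treeEdge_unique e h
        exact hwz.2 (by simp [Sym2.eq_swap])
  · intro hu
    induction hu with
    | refl => exact SimpleGraph.Reachable.rfl
    | @tail w z hw hwz ih =>
      have hwW := hW.treeDesc_subset hy hw
      have : ((CNUCB.subgraphOn D.essentialGraph.und W).deleteEdges {s(v, y)}).Adj w z := by
        rw [SimpleGraph.deleteEdges_adj]
        refine ⟨hW.adj_child hwW hwz, fun e => ?_⟩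
        rcases Sym2.eq_iff.1 (Set.mem_singleton_iff.1 e) with ⟨rfl, rfl⟩ | ⟨rfl, rfl⟩
        · exact h.notMem_treeDesc hw
        · exact D.edge_asymm h.2 hwz.2
      exact SimpleGraph.Reachable.trans ih this.reachable

/-- All elements of a subtree are descendants of an element without a parent in it, or can be
reached from its parent while the edge to the parent is cut. -/
theorem IsSubtree.mem_treeDesc_or (hW : D.IsSubtree W) (hf : D.IsCausalForest) {v u : Fin n}
    (hv : v ∈ W) (hu : u ∈ W) : u ∈ D.treeDesc v ∨ ∃ p ∈ W, D.treeEdge p v ∧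
      u ∈ CNUCB.branch (CNUCB.subgraphOn D.essentialGraph.und W) v p := by
  have h := (SimpleGraph.reachable_iff_reflTransGen _ _).1 (hW.conn v hv u hu)
  clear hu
  induction h with
  | refl => exact .inl (mem_treeDesc_self v)
  | @tail w z _ hwz ih =>
    rcases ih with ih | ⟨p, hp, hpv, ih⟩
    · rcases adj_iff_treeEdge.1 hwz.1 with e | e
      · exact .inl (Relation.ReflTransGen.tail ih e)
      · by_cases hwv : w = v
        · subst hwv
          exact .inr ⟨z, hwz.2.2, e, SimpleGraph.Reachable.rfl⟩
        · exact .inl (hf.mem_treeDesc_of_treeEdge ih e hwv)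
    · by_cases he : s(w, z) = s(v, p)
      · rcases Sym2.eq_iff.1 he with ⟨rfl, rfl⟩ | ⟨rfl, rfl⟩
        · exact .inr ⟨z, hp, hpv, SimpleGraph.Reachable.rfl⟩
        · exact .inl (mem_treeDesc_self _)
      · refine .inr ⟨p, hp, hpv, SimpleGraph.Reachable.trans ih (SimpleGraph.Adj.reachable ?_)⟩
        rw [SimpleGraph.deleteEdges_adj]
        exact ⟨hwz, he⟩

theorem IsSubtree.branch_parent (hW : D.IsSubtree W) (hf : D.IsCausalForest) {v p : Fin n}
    (hv : v ∈ W) (hp : p ∈ W) (h : D.treeEdge p v) :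
    CNUCB.branch (CNUCB.subgraphOn D.essentialGraph.und W) v p = W \ D.treeDesc v := by
  ext u
  constructor
  · intro hu
    replace hu := (SimpleGraph.reachable_iff_reflTransGen _ _).1 hu
    induction hu with
    | refl => exact ⟨hp, h.notMem_treeDesc⟩
    | @tail w z _ hwz ih =>
      rw [SimpleGraph.deleteEdges_adj] at hwz
      refine ⟨hwz.1.2.2, fun hz => ?_⟩
      rcases adj_iff_treeEdge.1 hwz.1.1 with e | e
      · by_cases hzv : z = v
        · subst hzv
          obtain rfl := hf.treeEdge_unique e h
          exact hwz.2 (by simp [Sym2.eq_swap])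
        · exact ih.2 (hf.mem_treeDesc_of_treeEdge hz e hzv)
      · exact ih.2 (Relation.ReflTransGen.tail hz e)
  · rintro ⟨hu, hu'⟩
    obtain ⟨q, _, hq, h'⟩ := (hW.mem_treeDesc_or hf hv hu).resolve_left hu'
    exact hf.treeEdge_unique hq h ▸ h'

theorem IsSubtree.exists_parent (hW : D.IsSubtree W) (hf : D.IsCausalForest) {v u : Fin n}
    (hv : v ∈ W) (hu : u ∈ W) (h : u ∉ D.treeDesc v) : ∃ p ∈ W, D.treeEdge p v := by
  obtain ⟨p, hp, hpv, _⟩ := (hW.mem_treeDesc_or hf hv hu).resolve_left h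
  exact ⟨p, hp, hpv⟩

/-- At a central node, no more than half of the candidates are descendants of a given child. -/
theorem IsSubtree.central_child (hW : D.IsSubtree W) (hf : D.IsCausalForest) {S : Set (Fin n)}
    {v y : Fin n} (hc : CNUCB.IsCentral D.essentialGraph.und W S v) (h : D.treeEdge v y) :
    2 * (S ∩ D.treeDesc y).ncard ≤ S.ncard := by
  have := hc.2 y (hW.adj_child hc.1 h)
  rwa [hW.branch_child hf hc.1 h] at this

/-- At most half of the candidates are no descendants of a central node. -/
theorem IsSubtree.central_parent (hW : D.IsSubtree W) (hf : D.IsCausalForest) {S : Set (Fin n)}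
    (hS : S ⊆ W) {v : Fin n} (hc : CNUCB.IsCentral D.essentialGraph.und W S v) :
    2 * (S \ D.treeDesc v).ncard ≤ S.ncard := by
  by_cases he : (S \ D.treeDesc v) = ∅
  · rw [he]; simp
  · obtain ⟨u, hu⟩ := Set.nonempty_iff_ne_empty.2 he
    obtain ⟨p, hp, hpv⟩ := hW.exists_parent hf hc.1 (hS hu.1) hu.2
    have hadj : (CNUCB.subgraphOn D.essentialGraph.und W).Adj v p := ⟨hpv.1.symm, hc.1, hp⟩
    have := hc.2 p hadj
    rw [hW.branch_parent hf hc.1 hp hpv] at this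
    have e : S ∩ (W \ D.treeDesc v) = S \ D.treeDesc v := by
      ext w
      exact ⟨fun h => ⟨h.1, h.2.2⟩, fun h => ⟨h.1, hS h.1, h.2⟩⟩
    rwa [e] at this

/-- If all candidates are descendants of a vertex, so is every central node. -/
theorem IsSubtree.central_mem_treeDesc (hW : D.IsSubtree W) (hf : D.IsCausalForest)
    {S : Set (Fin n)} (hS : S ⊆ W) (hne : S.Nonempty) {v y : Fin n}
    (hc : CNUCB.IsCentral D.essentialGraph.und W S v) (hSy : S ⊆ D.treeDesc y) :
    v ∈ D.treeDesc y := by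
  have hpos : 0 < S.ncard := (Set.ncard_pos (Set.toFinite _)).2 hne
  by_contra hv
  by_cases hyv : y ∈ D.treeDesc v
  · rcases Relation.ReflTransGen.cases_head hyv with e | ⟨z, hvz, hzy⟩
    · exact hv (e ▸ mem_treeDesc_self v)
    · have h1 := hW.central_child hf hc hvz
      rw [Set.inter_eq_left.2 (hSy.trans (DAG.treeDesc_subset hzy))] at h1
      omega
  -- If `v` and `y` are incomparable, their descendant sets are disjoint and all candidates lie
  -- outside those of `v`, too many for a central node.
  · have h1 := hW.central_parent hf hS hc
    have : S \ D.treeDesc v = S := by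
      ext w
      refine ⟨fun h => h.1, fun h => ⟨h, fun hw => ?_⟩⟩
      rcases hf.treeDesc_total (hSy h) hw with e | e
      · exact hyv e
      · exact hv e
    rw [this] at h1
    omega

/-- The children of a vertex, and the descendants of one of them, are strict descendants. -/
theorem IsCausalForest.length_add_ncard_le (hf : D.IsCausalForest) {v z : Fin n}
    (hz : D.treeEdge v z) {l : List (Fin n)} (hl : l.Nodup) (hl' : ∀ y ∈ l, D.treeEdge v y) :
    l.length + (D.treeDesc z).ncard ≤ (D.treeDesc v).ncard := by
  classical
  -- The vertex `v` takes the place of the child `z`, which is already counted among its own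
  -- descendants.
  set s : Set (Fin n) := {v} ∪ (l.toFinset.erase z : Finset (Fin n)) with hs
  have h1 : l.length ≤ s.ncard := by
    have hd : Disjoint ({v} : Set (Fin n)) (l.toFinset.erase z : Finset (Fin n)) := by
      rw [Set.disjoint_singleton_left]
      intro h
      have := hl' v (by simpa using (Finset.mem_erase.1 (Finset.mem_coe.1 h)).2)
      exact D.edge_irrefl v this.2
    rw [hs, Set.ncard_union_eq hd, Set.ncard_singleton, Set.ncard_coe_finset]
    have := Finset.pred_card_le_card_erase (s := l.toFinset) (a := z)
    rw [List.toFinset_card_of_nodup hl] at this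
    omega
  have hd : Disjoint s (D.treeDesc z) := by
    refine Set.disjoint_left.2 fun w hw hwz => ?_
    rcases hw with rfl | hw
    · exact hz.notMem_treeDesc hwz
    · obtain ⟨h2, h3⟩ := Finset.mem_erase.1 (Finset.mem_coe.1 hw)
      exact hz.notMem_treeDesc
        (hf.mem_treeDesc_of_treeEdge hwz (hl' w (by simpa using h3)) h2)
  have hsub : s ∪ D.treeDesc z ⊆ D.treeDesc v := by
    refine Set.union_subset (Set.union_subset ?_ ?_) (DAG.treeDesc_subset hz.mem_treeDesc)
    · simpa using mem_treeDesc_self v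
    · intro w hw
      exact (hl' w (by simpa using (Finset.mem_erase.1 (Finset.mem_coe.1 hw)).2)).mem_treeDesc
  calc l.length + (D.treeDesc z).ncard ≤ s.ncard + (D.treeDesc z).ncard := by omega
    _ = (s ∪ D.treeDesc z).ncard := (Set.ncard_union_eq hd).symm
    _ ≤ _ := Set.ncard_le_ncard hsub (Set.toFinite _)

theorem length_children_le {v : Fin n} {l : List (Fin n)} (hl : l.Nodup)
    (hl' : ∀ y ∈ l, D.treeEdge v y) : l.length ≤ D.essentialGraph.maxChainDegree := by
  classical
  rw [← List.toFinset_card_of_nodup hl, ← Set.ncard_coe_finset]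
  refine (Set.ncard_le_ncard ?_ (Set.toFinite _)).trans (Finset.le_sup
    (f := fun v => (D.essentialGraph.und.neighborSet v).ncard) (Finset.mem_univ v))
  intro y hy
  exact (hl' y (by simpa using hy)).1

/-! ### Ancestors and the order of the components -/

/-- The chain component of a vertex. -/
abbrev componentOf (D : DAG n) (v : Fin n) : D.essentialGraph.ChainComponent :=
  D.essentialGraph.und.connectedComponentMk v

theorem componentOf_eq_of_treeEdge {u v : Fin n} (h : D.treeEdge u v) :
    D.componentOf u = D.componentOf v := SimpleGraph.ConnectedComponent.sound h.1.reachable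

theorem componentOf_eq_of_mem_treeDesc {u v : Fin n} (h : v ∈ D.treeDesc u) :
    D.componentOf u = D.componentOf v := by
  induction h with
  | refl => rfl
  | tail _ h ih => exact ih.trans (componentOf_eq_of_treeEdge h)

/-- Undirected steps after a directed one are absorbed, as the last arrow into a component can be
redirected to any of its vertices. -/
theorem mem_treeDesc_or_of_isAncestor {u w : Fin n} (h : D.IsAncestor u w) :
    w ∈ D.treeDesc u ∨ D.componentOf w ∈ D.laterComponents (D.componentOf u) := by
  induction h with
  | refl => exact .inl (mem_treeDesc_self u)
  | @tail w z _ hwz ih =>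
    rcases dir_or_und_of_edge hwz with hd | hd
    · right
      rcases ih with ih | ⟨i, hi, j, hj, hij⟩
      · exact ⟨w, (componentOf_eq_of_mem_treeDesc ih).symm, z, rfl, .single hd⟩
      · refine ⟨i, hi, z, rfl, ?_⟩
        obtain ⟨x, hix, hxj⟩ := Relation.TransGen.tail'_iff.1 hij
        exact (Relation.TransGen.tail' hix
          (dir_of_reachable hxj (SimpleGraph.ConnectedComponent.exact hj))).tail hd
    · have hq : D.treeEdge w z := ⟨hd, hwz⟩
      rcases ih with ih | ih
      · exact .inl (Relation.ReflTransGen.tail ih hq)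
      · exact .inr (componentOf_eq_of_treeEdge hq ▸ ih)

theorem notMem_laterComponents (c : D.essentialGraph.ChainComponent) :
    c ∉ D.laterComponents c := by
  rintro ⟨i, hi, j, hj, hij⟩
  obtain ⟨x, hix, hxj⟩ := Relation.TransGen.tail'_iff.1 hij
  have := Relation.TransGen.tail' hix
    (dir_of_reachable hxj (SimpleGraph.ConnectedComponent.exact (hj.trans hi.symm)))
  exact D.acyclic i (Relation.TransGen.mono (fun _ _ h => edge_of_dir h) _ _ this)

theorem isAncestor_iff_mem_treeDesc {u w : Fin n} (h : D.componentOf u = D.componentOf w) :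
    D.IsAncestor u w ↔ w ∈ D.treeDesc u := by
  refine ⟨fun h' => (mem_treeDesc_or_of_isAncestor h').resolve_right fun h'' => ?_,
    isAncestor_of_mem_treeDesc⟩
  rw [h] at h''
  exact notMem_laterComponents _ h''

/-- No directed edge leads from the prefix ending in `c` to `rest`, so a directed path that starts
in the prefix stays there. -/
theorem notMem_of_mem_laterComponents {order done rest : List D.essentialGraph.ChainComponent}
    (ho : D.essentialGraph.SinksFirst order) {c c' : D.essentialGraph.ChainComponent}
    (he : order = done ++ c :: rest) (hc : c' ∈ D.laterComponents c) : c' ∉ rest := by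
  obtain ⟨i, hi, j, hj, hij⟩ := hc
  obtain ⟨hnd, hall, hp⟩ := ho
  subst he
  have hpre : ∀ x y, D.essentialGraph.dir x y → D.componentOf x ∈ done ++ [c] →
      D.componentOf y ∈ done ++ [c] := by
    intro x y hxy hx
    have hy := hall (D.componentOf y)
    have e : done ++ c :: rest = (done ++ [c]) ++ rest := by simp
    rw [e] at hy hp
    refine (List.mem_append.1 hy).resolve_right fun h => ?_
    exact (List.pairwise_append.1 hp).2.2 _ hx _ h x rfl y rfl hxy
  have hj' : D.componentOf j ∈ done ++ [c] := by
    have hi' : D.componentOf i ∈ done ++ [c] := by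
      rw [show D.componentOf i = c from hi]; simp
    clear hj
    induction hij with
    | single h => exact hpre _ _ h hi'
    | tail _ h ih => exact hpre _ _ h ih
  rw [show D.componentOf j = c' from hj] at hj'
  intro hr
  have e : done ++ c :: rest = (done ++ [c]) ++ rest := by simp
  rw [e] at hnd
  exact (List.nodup_append.1 hnd).2.2 _ hj' _ hr rfl

end DAG

/-! ### Correctness and length of the search -/

theorem Nat.log_two_succ_le {a b : ℕ} (ha : a ≠ 0) (h : 2 * a ≤ b) :
    Nat.log 2 a + 1 ≤ Nat.log 2 b := by
  rw [← Nat.log_mul_base Nat.one_lt_two ha]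
  exact Nat.log_mono_right (by omega)

theorem Nat.log_two_lt {m : ℕ} (hm : m ≠ 0) : Nat.log 2 m + 1 ≤ m := by
  have := Nat.pow_log_le_self 2 hm
  have := Nat.lt_two_pow_self (n := Nat.log 2 m)
  omega

theorem Nat.two_mul_log_two_le (m : ℕ) : 2 * Nat.log 2 m ≤ m := by
  rcases Nat.eq_zero_or_pos m with rfl | hm
  · simp
  · refine le_trans ?_ (Nat.pow_log_le_self 2 hm.ne')
    generalize Nat.log 2 m = k
    induction k with
    | zero => simp
    | succ k ih =>
      rcases Nat.eq_zero_or_pos k with rfl | hk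
      · simp
      · rw [pow_succ]
        omega

namespace CNUCB

variable {n : ℕ} {D : DAG n}

/-- A bound on the number of blocks of stages 1 and 2. -/
noncomputable def searchBound (D : DAG n) : ℕ :=
  D.essentialGraph.numChainComponents * (Nat.log 2 n + 1) +
    (1 + D.essentialGraph.maxChainDegree) * Nat.log 2 n

/-- The invariant of the search for `q` at the beginning of block `j`, as long as all tests give
the correct results. -/
def SearchInv (D : DAG n) (order : List D.essentialGraph.ChainComponent) (q : Fin n) (j : ℕ) :
    Phase D.essentialGraph → Prop
  | .locate rest W S v => ∃ (c : D.essentialGraph.ChainComponent)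
      (done : List D.essentialGraph.ChainComponent), W = c.supp ∧ order = done ++ c :: rest ∧
      D.componentOf q ∉ done ∧ S ⊆ W ∧ S.Nonempty ∧ (q ∈ W → q ∈ S) ∧
      IsCentral D.essentialGraph.und W S v ∧
      j + rest.length * (Nat.log 2 n + 1) + Nat.log 2 S.ncard + 1 +
        (1 + D.essentialGraph.maxChainDegree) * Nat.log 2 n ≤ searchBound D ∧
      j + 2 * (rest.map fun c => c.supp.ncard).sum + Nat.log 2 S.ncard + Nat.log 2 W.ncard +
        W.ncard ≤ 2 * n ∧
      j + (rest.map fun c => c.supp.ncard).sum + Nat.log 2 S.ncard + 1 ≤ n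
  | .central W r S v => W = D.treeDesc r ∧ q ∈ W ∧ S ⊆ W ∧ q ∈ S ∧ 1 < S.ncard ∧
      IsCentral D.essentialGraph.und W S v ∧
      j + (1 + D.essentialGraph.maxChainDegree) * Nat.log 2 S.ncard ≤ searchBound D ∧
      ∃ y ∈ W, S ⊆ D.treeDesc y ∧ j + Nat.log 2 S.ncard + (D.treeDesc y).ncard ≤ 2 * n + 1
  | .child W r S v y todo found => W = D.treeDesc r ∧ q ∈ W ∧ S ⊆ W ∧ q ∈ S ∧ 1 < S.ncard ∧
      IsCentral D.essentialGraph.und W S v ∧ q ∈ D.treeDesc v ∧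
      (∀ z ∈ y :: todo, D.treeEdge v z) ∧ (∀ z ∈ found, D.treeEdge v z ∧ q ∈ D.treeDesc z) ∧
      (q = v ∨ found.isSome ∨ ∃ z ∈ y :: todo, q ∈ D.treeDesc z) ∧
      j + (todo.length + 1) + (1 + D.essentialGraph.maxChainDegree) * (Nat.log 2 S.ncard - 1) ≤
        searchBound D ∧
      ∀ z, D.treeEdge v z →
        j + (todo.length + 1) + (Nat.log 2 S.ncard - 1) + (D.treeDesc z).ncard ≤ 2 * n + 1
  | .exploit x s => x = q ∧ s ≤ searchBound D
  | .failed => False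

theorem one_le_ncard_treeDesc (v : Fin n) : 1 ≤ (D.treeDesc v).ncard :=
  (Set.ncard_pos (Set.toFinite _)).2 ⟨v, DAG.mem_treeDesc_self v⟩

variable {order : List D.essentialGraph.ChainComponent} {q : Fin n} {j : ℕ}

/-- The invariant keeps separate budgets: `searchBound` for the regret, `2 * n` for all blocks with
reward tests, and `n` for the blocks of stage 1, where directions are tested. The last two match the
numbers of blocks in the union bound, so that the tests still to come are covered by it. -/
theorem SearchInv.lt_of_target {p : Phase D.essentialGraph} (h : SearchInv D order q j p)
    {v : Fin n} (hv : p.target = some v) : j < 2 * n := by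
  cases p with
  | locate rest W S w =>
    obtain ⟨c, done, -, -, -, -, -, -, hc, -, h, -⟩ := h
    have : 1 ≤ W.ncard := (Set.ncard_pos (Set.toFinite _)).2 ⟨w, hc.1⟩
    omega
  | central W r S w =>
    obtain ⟨-, -, -, -, hS, -, -, y, -, -, h⟩ := h
    have h1 := one_le_ncard_treeDesc (D := D) y
    have h2 : 1 ≤ Nat.log 2 S.ncard := Nat.log_pos Nat.one_lt_two hS
    omega
  | child W r S w y todo found =>
    obtain ⟨-, -, -, -, -, -, -, h1, -, -, -, h⟩ := h
    have h2 := h y (h1 y (by simp))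
    have h1 := one_le_ncard_treeDesc (D := D) y
    omega
  | exploit x s => simp [Phase.target] at hv
  | failed => simp [Phase.target] at hv

theorem SearchInv.lt_of_locate {rest : List D.essentialGraph.ChainComponent} {W S : Set (Fin n)}
    {v : Fin n} (h : SearchInv D order q j (.locate rest W S v)) : j < n := by
  obtain ⟨c, done, -, -, -, -, -, -, -, -, -, h⟩ := h
  omega

theorem SearchInv.eq_of_exploit {x : Fin n} {s : ℕ} (h : SearchInv D order q j (.exploit x s)) :
    x = q ∧ s ≤ searchBound D := h

/-- At block `searchBound D` only the second alternative is left: the search has ended with the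
correct variable. -/
theorem SearchInv.target_or_exploit {p : Phase D.essentialGraph} (h : SearchInv D order q j p) :
    ((∃ v, p.target = some v) ∧ j < searchBound D) ∨ ∃ s, p = .exploit q s := by
  cases p with
  | locate rest W S w =>
    obtain ⟨c, done, -, -, -, -, -, -, hc, h, -, -⟩ := h
    exact .inl ⟨⟨w, rfl⟩, by omega⟩
  | central W r S w =>
    obtain ⟨-, -, -, -, hS, -, h, -⟩ := h
    have h2 : 1 ≤ Nat.log 2 S.ncard := Nat.log_pos Nat.one_lt_two hS
    refine .inl ⟨⟨w, rfl⟩, ?_⟩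
    have := Nat.mul_le_mul (Nat.le_add_right 1 D.essentialGraph.maxChainDegree) h2
    omega
  | child W r S w y todo found =>
    obtain ⟨-, -, -, -, -, -, -, -, -, -, h, -⟩ := h
    exact .inl ⟨⟨y, rfl⟩, by omega⟩
  | exploit x s => exact .inr ⟨s, by rw [h.1]⟩
  | failed => exact h.elim

theorem searchInv_of_searchKey {r : Fin n} {S : Set (Fin n)}
    {p : Phase D.essentialGraph} (hS : S ⊆ D.treeDesc r) (hq : q ∈ S)
    (hb : j + (1 + D.essentialGraph.maxChainDegree) * Nat.log 2 S.ncard ≤ searchBound D)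
    (hy : ∃ y ∈ D.treeDesc r, S ⊆ D.treeDesc y ∧
      j + Nat.log 2 S.ncard + (D.treeDesc y).ncard ≤ 2 * n + 1)
    (h : SearchKey D.essentialGraph j (D.treeDesc r) r S p) : SearchInv D order q j p := by
  cases h with
  | many v h1 h2 => exact ⟨rfl, hS hq, hS, hq, h1, h2, hb, hy⟩
  | one x h => exact ⟨by simpa [h, eq_comm] using hq, by omega⟩
  | none h => simp [h] at hq

/-- The tests of the remaining children are paid in advance through the length of the list. When it
is exhausted without a hit, `q` is below no child of `v` and hence equal to `v`; after a hit, the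
descent halves the candidates. -/
theorem searchInv_of_searchChildren (hf : D.IsCausalForest) {r v : Fin n} {S : Set (Fin n)}
    {l : List (Fin n)} {found : Option (Fin n)} {p : Phase D.essentialGraph}
    (hS : S ⊆ D.treeDesc r) (hq : q ∈ S) (h1 : 1 < S.ncard)
    (hc : IsCentral D.essentialGraph.und (D.treeDesc r) S v) (hv : q ∈ D.treeDesc v)
    (hl : ∀ z ∈ l, D.treeEdge v z) (hfound : ∀ z ∈ found, D.treeEdge v z ∧ q ∈ D.treeDesc z)
    (hcov : q = v ∨ found.isSome ∨ ∃ z ∈ l, q ∈ D.treeDesc z)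
    (hb : j + l.length + (1 + D.essentialGraph.maxChainDegree) * (Nat.log 2 S.ncard - 1) ≤
      searchBound D)
    (hb' : ∀ z, D.treeEdge v z →
      j + l.length + (Nat.log 2 S.ncard - 1) + (D.treeDesc z).ncard ≤ 2 * n + 1)
    (h : SearchChildren D.essentialGraph j (D.treeDesc r) r S v l found p) :
    SearchInv D order q j p := by
  have hW := DAG.isSubtree_treeDesc (D := D) r
  cases h with
  | next y todo found =>
    exact ⟨rfl, hS hq, hS, hq, h1, hc, hv, hl, hfound, hcov, hb, hb'⟩
  | key =>
    refine ⟨?_, by omega⟩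
    simpa [eq_comm] using hcov
  | descend y _ h =>
    obtain ⟨hy, hqy⟩ := hfound y rfl
    rw [hW.branch_child hf hc.1 hy] at h
    have hq' : q ∈ S ∩ D.treeDesc y := ⟨hq, hqy⟩
    have hlog := Nat.log_two_succ_le
      ((Set.ncard_pos (Set.toFinite _)).2 ⟨q, hq'⟩).ne' (hW.central_child hf hc hy)
    refine searchInv_of_searchKey (Set.inter_subset_left.trans hS) hq' ?_
      ⟨y, hW.down _ hc.1 _ hy, Set.inter_subset_right, ?_⟩ h
    · refine le_trans ?_ hb
      have := Nat.mul_le_mul_left (1 + D.essentialGraph.maxChainDegree) (Nat.le_sub_one_of_lt hlog)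
      simp only [List.length_nil]
      omega
    · have := hb' y hy
      simp only [List.length_nil] at this
      omega

theorem ncard_supp_le_log (c : D.essentialGraph.ChainComponent) :
    Nat.log 2 c.supp.ncard ≤ Nat.log 2 n :=
  Nat.log_mono_right ((Set.ncard_le_ncard (Set.subset_univ _)).trans_eq (by simp))

theorem ncard_supp_pos (c : D.essentialGraph.ChainComponent) : 0 < c.supp.ncard :=
  (Set.ncard_pos (Set.toFinite _)).2 c.nonempty_supp

/-- The invariant is preserved by a block whose tests give the correct results. -/
theorem SearchInv.step (hf : D.IsCausalForest) (ho : D.essentialGraph.SinksFirst order) {K : ℕ}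
    {ε Δ Rhat : ℝ} {obs : Fin n → Fin K → ℝ} {fb : Feedback n K} {p p' : Phase D.essentialGraph}
    (h : SearchInv D order q j p)
    (hhit : ∀ v, p.target = some v → (fb.Hit Δ Rhat ↔ D.IsAncestor v q))
    (hdown : ∀ rest W S v, p = .locate rest W S v → ∀ y, D.essentialGraph.und.Adj v y →
      (fb.Down ε obs y ↔ D.edge v y))
    (hs : Step D.essentialGraph ε Δ obs Rhat fb (j + 1) p p') :
    SearchInv D order q (j + 1) p' := by
  -- the result of a test in stage 1
  have hloc : ∀ {rest W S v}, p = .locate rest W S v → SearchInv D order q j p →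
      (fb.Hit Δ Rhat ↔ q ∈ D.treeDesc v) ∧ (q ∉ W → D.componentOf q ∈ rest) := by
    rintro rest W S v rfl ⟨c, done, rfl, he, hdone, -, -, -, hc, -⟩
    have hvc : D.componentOf v = c := hc.1
    have hall := ho.2.1 (D.componentOf q)
    rw [he] at hall
    have hrest : q ∉ c.supp → D.componentOf q ∈ rest := fun hqc => by
      rcases List.mem_append.1 hall with e | e
      · exact (hdone e).elim
      · exact (List.mem_cons.1 e).resolve_left fun e => hqc e
    refine ⟨(hhit v rfl).trans ⟨fun ha => ?_, DAG.isAncestor_of_mem_treeDesc⟩, hrest⟩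
    -- Otherwise the component of `q` would be reachable from `c` by directed edges and could be
    -- neither `c` nor in `rest`; but it is not among the finished components.
    refine (DAG.mem_treeDesc_or_of_isAncestor ha).resolve_right fun hl => ?_
    rw [hvc] at hl
    refine DAG.notMem_of_mem_laterComponents ho he hl (hrest fun hqc => ?_)
    rw [show D.componentOf q = c from hqc] at hl
    exact DAG.notMem_laterComponents _ hl
  -- the candidates that are kept in stage 1
  have hkeep : ∀ {rest W S v}, p = .locate rest W S v → SearchInv D order q j p →
      {u ∈ S | ∃ y, (subgraphOn D.essentialGraph.und W).Adj v y ∧ ¬ fb.Down ε obs y ∧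
        u ∈ branch (subgraphOn D.essentialGraph.und W) v y} = S \ D.treeDesc v := by
    rintro rest W S v rfl ⟨c, done, rfl, he, hdone, hSW, -, -, hc, -⟩
    have hW := DAG.isSubtree_supp c
    have hd := hdown rest _ S v rfl
    ext u
    constructor
    · rintro ⟨hu, y, hvy, hnd, huy⟩
      refine ⟨hu, ?_⟩
      rw [hd y hvy.1] at hnd
      have hyv : D.treeEdge y v := (DAG.adj_iff_treeEdge.1 hvy.1).resolve_left fun e => hnd e.2
      rw [hW.branch_parent hf hc.1 hvy.2.2 hyv] at huy
      exact huy.2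
    · rintro ⟨hu, hu'⟩
      obtain ⟨y, hy, hyv, huy⟩ := (hW.mem_treeDesc_or hf hc.1 (hSW hu)).resolve_left hu'
      exact ⟨hu, y, ⟨hyv.1.symm, hc.1, hy⟩, fun e =>
        D.edge_asymm hyv.2 ((hd y hyv.1.symm).1 e), huy⟩
  cases hs with
  | found rest W S W' v _ hh hW' hk =>
    obtain ⟨h1, h2⟩ := hloc rfl h
    have hqv := h1.1 hh
    have hd := hdown rest _ S v rfl
    obtain ⟨c, done, rfl, he, hdone, hSW, hne, hqS, hc, b1, b2, b3⟩ := h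
    have hW := DAG.isSubtree_supp c
    have e : W' = D.treeDesc v := by
      rw [hW']
      ext u
      constructor
      · rintro (rfl | ⟨y, hvy, hdn, huy⟩)
        · exact DAG.mem_treeDesc_self _
        · rw [hd y hvy.1] at hdn
          have hvy' : D.treeEdge v y := ⟨hvy.1, hdn⟩
          rw [hW.branch_child hf hc.1 hvy'] at huy
          exact DAG.treeDesc_subset hvy'.mem_treeDesc huy
      · intro hu
        rcases Relation.ReflTransGen.cases_head hu with e | ⟨y, hvy, hyu⟩
        · exact .inl e.symm
        · refine .inr ⟨y, hW.adj_child hc.1 hvy, (hd y hvy.1).2 hvy.2, ?_⟩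
          rw [hW.branch_child hf hc.1 hvy]
          exact hyu
    rw [e] at hk
    have hsub := hW.treeDesc_subset hc.1
    have hle := Set.ncard_le_ncard hsub (Set.toFinite _)
    have hlog := Nat.log_mono_right (b := 2) hle
    have hlogn := ncard_supp_le_log c
    -- The logarithm of the size of the component, held in reserve during stage 1, pays for the one
    -- with which stage 2 begins.
    refine searchInv_of_searchKey subset_rfl hqv ?_
      ⟨v, DAG.mem_treeDesc_self v, subset_rfl, by omega⟩ hk
    have := Nat.mul_le_mul_left (1 + D.essentialGraph.maxChainDegree) (hlog.trans hlogn)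
    omega
  | eliminate rest W S S' v v' hh hS' hne' hc' =>
    obtain ⟨h1, h2⟩ := hloc rfl h
    rw [hkeep rfl h] at hS'
    have hqv : q ∉ D.treeDesc v := fun e => hh (h1.2 e)
    obtain ⟨c, done, rfl, he, hdone, hSW, hne, hqS, hc, b1, b2, b3⟩ := h
    have hlog : Nat.log 2 S'.ncard + 1 ≤ Nat.log 2 S.ncard :=
      Nat.log_two_succ_le ((Set.ncard_pos (Set.toFinite _)).2 hne').ne'
        (hS' ▸ (DAG.isSubtree_supp c).central_parent hf hSW hc)
    refine ⟨c, done, rfl, he, hdone, ?_, hne', fun hq => ?_, hc', ?_, ?_, ?_⟩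
    · exact hS' ▸ Set.sdiff_subset.trans hSW
    · exact hS' ▸ ⟨hqS hq, hqv⟩
    · omega
    · omega
    · omega
  | exhausted rest W S v _ hh hS' hst =>
    obtain ⟨h1, h2⟩ := hloc rfl h
    rw [hkeep rfl h] at hS'
    have hqv : q ∉ D.treeDesc v := fun e => hh (h1.2 e)
    obtain ⟨c, done, rfl, he, hdone, hSW, hne, hqS, hc, b1, b2, b3⟩ := h
    have hqc : q ∉ c.supp := fun e => by
      have : q ∈ S \ D.treeDesc v := ⟨hqS e, hqv⟩
      rw [hS'] at this
      exact this
    cases hst with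
    | none => simpa using h2 hqc
    | next c' rest w hw =>
      have hn := ncard_supp_le_log c'
      have hpos := ncard_supp_pos c'
      have hpos' := ncard_supp_pos c
      have hl1 := Nat.log_two_lt hpos.ne'
      -- A new component brings its size and two logarithms, which fit into its share of twice its
      -- size; `hl1` does the same for the budget `n`.
      have hl2 := Nat.two_mul_log_two_le c'.supp.ncard
      simp only [List.length_cons, List.map_cons, List.sum_cons, Nat.add_mul, Nat.mul_add] at b1 b2 b3
      refine ⟨c', done ++ [c], rfl, by simp [he], ?_, subset_rfl, c'.nonempty_supp, id, hw,
        ?_, by omega, by omega⟩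
      · rw [List.mem_append, not_or]
        exact ⟨hdone, fun e => hqc (List.mem_singleton.1 e)⟩
      · simp only [Nat.mul_add, Nat.add_mul]
        omega
  | up W r S v _ hh hk =>
    have hanc := hhit v rfl
    obtain ⟨rfl, hqW, hSW, hqS, h1, hc, b1, y, hy, hSy, b2⟩ := h
    have hW := DAG.isSubtree_treeDesc (D := D) r
    have hqv : q ∉ D.treeDesc v := fun e => hh (hanc.2 (DAG.isAncestor_of_mem_treeDesc e))
    have hvr : r ∉ D.treeDesc v := fun e => hqv (DAG.treeDesc_subset e hqW)
    have e : {u ∈ S | ∃ y, (subgraphOn D.essentialGraph.und (D.treeDesc r)).Adj v y ∧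
        r ∈ branch (subgraphOn D.essentialGraph.und (D.treeDesc r)) v y ∧
        u ∈ branch (subgraphOn D.essentialGraph.und (D.treeDesc r)) v y} = S \ D.treeDesc v := by
      ext u
      constructor
      · rintro ⟨hu, y, hvy, hry, huy⟩
        refine ⟨hu, ?_⟩
        rcases DAG.adj_iff_treeEdge.1 hvy.1 with e | e
        · rw [hW.branch_child hf hc.1 e] at hry
          exact (hvr (DAG.treeDesc_subset e.mem_treeDesc hry)).elim
        · rw [hW.branch_parent hf hc.1 hvy.2.2 e] at huy
          exact huy.2
      · rintro ⟨hu, hu'⟩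
        obtain ⟨p, hp, hpv⟩ := hW.exists_parent hf hc.1 (hSW hu) hu'
        refine ⟨hu, p, ⟨hpv.1.symm, hc.1, hp⟩, ?_⟩
        rw [hW.branch_parent hf hc.1 hp hpv]
        exact ⟨⟨DAG.mem_treeDesc_self r, hvr⟩, hSW hu, hu'⟩
    rw [e] at hk
    have hq' : q ∈ S \ D.treeDesc v := ⟨hqS, hqv⟩
    have hlog := Nat.log_two_succ_le
      ((Set.ncard_pos (Set.toFinite _)).2 ⟨q, hq'⟩).ne' (hW.central_parent hf hSW hc)
    refine searchInv_of_searchKey (Set.sdiff_subset.trans hSW) hq' ?_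
      ⟨y, hy, Set.sdiff_subset.trans hSy, by omega⟩ hk
    have := Nat.mul_le_mul_left (1 + D.essentialGraph.maxChainDegree) hlog
    rw [Nat.mul_add] at this
    omega
  | down W r S v children _ hh hnd hch hk =>
    have hanc := hhit v rfl
    obtain ⟨rfl, hqW, hSW, hqS, h1, hc, b1, y, hy, hSy, b2⟩ := h
    have hW := DAG.isSubtree_treeDesc (D := D) r
    have hvq : q ∈ D.treeDesc v := by
      refine (DAG.isAncestor_iff_mem_treeDesc ?_).1 (hanc.1 hh)
      exact (DAG.componentOf_eq_of_mem_treeDesc hc.1).symm.trans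
        (DAG.componentOf_eq_of_mem_treeDesc hqW)
    have hch' : ∀ z, z ∈ children ↔ D.treeEdge v z := by
      intro z
      rw [hch]
      constructor
      · rintro ⟨hvz, hr⟩
        refine (DAG.adj_iff_treeEdge.1 hvz.1).resolve_right fun e => hr ?_
        rw [hW.branch_parent hf hc.1 hvz.2.2 e]
        refine ⟨DAG.mem_treeDesc_self r, fun hr' => ?_⟩
        obtain rfl := DAG.eq_of_mem_treeDesc hc.1 hr'
        exact e.notMem_treeDesc hvz.2.2
      · intro e
        refine ⟨hW.adj_child hc.1 e, ?_⟩
        rw [hW.branch_child hf hc.1 e]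
        exact fun hr' => e.notMem_treeDesc (DAG.treeDesc_subset hr' hc.1)
    have hlog : 1 ≤ Nat.log 2 S.ncard := Nat.log_pos Nat.one_lt_two h1
    -- Since `v` lies below `y`, the tests of its children can be charged to vertices below `y` that
    -- are lost in the descent to one child. This keeps the total below `2 * n` for every degree.
    have hvy := hW.central_mem_treeDesc hf hSW ⟨q, hqS⟩ hc hSy
    have hle := Set.ncard_le_ncard (DAG.treeDesc_subset hvy) (Set.toFinite _)
    refine searchInv_of_searchChildren hf hSW hqS h1 hc hvq (fun z hz => (hch' z).1 hz) (by simp)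
      ?_ ?_ (fun z hz => ?_) hk
    · rcases Relation.ReflTransGen.cases_head hvq with e | ⟨z, hvz, hzq⟩
      · exact .inl e.symm
      · exact .inr (.inr ⟨z, (hch' z).2 hvz, hzq⟩)
    -- One halving is worth `1 + d` blocks: the test of `v` and those of its children.
    · have hlen := DAG.length_children_le hnd fun z hz => (hch' z).1 hz
      obtain ⟨k, hk⟩ : ∃ k, Nat.log 2 S.ncard = k + 1 := ⟨_, (Nat.sub_add_cancel hlog).symm⟩
      rw [hk] at b1 ⊢
      rw [Nat.mul_add] at b1
      rw [Nat.add_sub_cancel]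
      omega
    · have := hf.length_add_ncard_le hz hnd fun z hz => (hch' z).1 hz
      omega
  | childHit W r S v y todo found _ hh hk =>
    have hanc := hhit y rfl
    obtain ⟨rfl, hqW, hSW, hqS, h1, hc, hvq, hl, hfd, hcov, b1, b2⟩ := h
    have hy := hl y (by simp)
    have hyq : q ∈ D.treeDesc y := by
      refine (DAG.isAncestor_iff_mem_treeDesc ?_).1 (hanc.1 hh)
      exact (DAG.componentOf_eq_of_treeEdge hy).symm.trans
        (DAG.componentOf_eq_of_mem_treeDesc hvq)
    refine searchInv_of_searchChildren hf hSW hqS h1 hc hvq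
      (fun z hz => hl z (List.mem_cons_of_mem _ hz)) ?_ (.inr (.inl rfl)) ?_ (fun z hz => ?_) hk
    · rintro z hz
      obtain rfl := Option.mem_some_iff.1 hz
      exact ⟨hy, hyq⟩
    · omega
    · have := b2 z hz
      omega
  | childMiss W r S v y todo found _ hh hk =>
    have hanc := hhit y rfl
    obtain ⟨rfl, hqW, hSW, hqS, h1, hc, hvq, hl, hfd, hcov, b1, b2⟩ := h
    have hyq : q ∉ D.treeDesc y := fun e => hh (hanc.2 (DAG.isAncestor_of_mem_treeDesc e))
    refine searchInv_of_searchChildren hf hSW hqS h1 hc hvq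
      (fun z hz => hl z (List.mem_cons_of_mem _ hz)) hfd ?_ ?_ (fun z hz => ?_) hk
    · rcases hcov with e | e | ⟨z, hz, hqz⟩
      · exact .inl e
      · exact .inr (.inl e)
      · rcases List.mem_cons.1 hz with rfl | hz
        · exact (hyq hqz).elim
        · exact .inr (.inr ⟨z, hz, hqz⟩)
    · omega
    · have := b2 z hz
      omega
  | exploit x start => exact h
  | failed => exact h

theorem sum_ncard_supp {order : List D.essentialGraph.ChainComponent}
    (ho : D.essentialGraph.SinksFirst order) : (order.map fun c => c.supp.ncard).sum = n := by
  classical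
  have h := Finset.card_eq_sum_card_fiberwise (f := D.componentOf) (s := Finset.univ)
    (t := order.toFinset) fun v _ => by simpa using ho.2.1 _
  rw [Finset.card_univ, Fintype.card_fin, List.sum_toFinset _ ho.1] at h
  refine Eq.trans ?_ h.symm
  congr 1
  refine List.map_congr_left fun c _ => ?_
  rw [← Set.ncard_coe_finset]
  congr 1
  ext v
  simp

theorem length_order {order : List D.essentialGraph.ChainComponent}
    (ho : D.essentialGraph.SinksFirst order) :
    order.length = D.essentialGraph.numChainComponents := by
  classical
  let _ : Fintype D.essentialGraph.ChainComponent := Fintype.ofFinite _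
  rw [MixedGraph.numChainComponents, Nat.card_eq_fintype_card, ← List.toFinset_card_of_nodup ho.1,
    Finset.eq_univ_of_forall fun c => List.mem_toFinset.2 (ho.2.1 c), Finset.card_univ]

theorem searchInv_of_startComponent (ho : D.essentialGraph.SinksFirst order)
    {p : Phase D.essentialGraph} (h : StartComponent D.essentialGraph order p) :
    SearchInv D order q 0 p := by
  have hlen := length_order ho
  have hsum := sum_ncard_supp ho
  cases h with
  | none => simpa using ho.2.1 (D.componentOf q)
  | next c rest v hv =>
    have hn := ncard_supp_le_log c
    have hl1 := Nat.log_two_lt (ncard_supp_pos c).ne'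
    have hl2 := Nat.two_mul_log_two_le c.supp.ncard
    simp only [List.length_cons, List.map_cons, List.sum_cons] at hlen hsum
    refine ⟨c, [], rfl, rfl, by simp, subset_rfl, c.nonempty_supp, id, hv, ?_, by omega, by omega⟩
    rw [searchBound, ← hlen, Nat.add_mul rest.length]
    omega

end CNUCB

/-! ### The regret of UCB -/

namespace CNUCB

variable {n K : ℕ}

theorem pulls_succ (A : ℕ → Intervention n K) {t₀ t : ℕ} (h : t₀ ≤ t) (a : Intervention n K) :
    pulls A t₀ (t + 1) a = pulls A t₀ t a + if A t = a then 1 else 0 := by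
  rw [pulls, pulls, Finset.card_filter, Finset.card_filter, Finset.sum_Ico_succ_top h]

theorem pulls_mono (A : ℕ → Intervention n K) (t₀ : ℕ) {s t : ℕ} (h : s ≤ t)
    (a : Intervention n K) : pulls A t₀ s a ≤ pulls A t₀ t a :=
  Finset.card_le_card (Finset.filter_subset_filter _ (Finset.Ico_subset_Ico_right h))

theorem sum_pulls_le (A : ℕ → Intervention n K) (t₀ t : ℕ) (x : Fin n) :
    ∑ k, pulls A t₀ t (some (x, k)) ≤ t - t₀ := by
  classical
  rw [← Nat.card_Ico t₀ t]
  simp only [pulls]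
  rw [← Finset.card_biUnion]
  · exact Finset.card_le_card (Finset.biUnion_subset.2 fun k _ => Finset.filter_subset _ _)
  · intro k _ k' _ hkk
    refine Finset.disjoint_left.2 fun s hs hs' => hkk ?_
    have h1 := (Finset.mem_filter.1 hs).2
    have h2 := (Finset.mem_filter.1 hs').2
    rw [h1] at h2
    simpa using h2

/-- The difference of the roots is the inverse of their sum, and the larger root is at most twice
the smaller. This makes the confidence widths telescope. -/
theorem one_div_sqrt_le {m : ℕ} (hm : m ≠ 0) :
    1 / √(m : ℝ) ≤ 3 * (√((m : ℝ) + 1) - √(m : ℝ)) := by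
  have hm1 : (1 : ℝ) ≤ m := by exact_mod_cast Nat.one_le_iff_ne_zero.2 hm
  set a := √(m : ℝ) with ha
  set b := √((m : ℝ) + 1) with hb
  have ha1 : 1 ≤ a := Real.one_le_sqrt.2 hm1
  have ha2 : a ^ 2 = m := Real.sq_sqrt (by linarith)
  have hb2 : b ^ 2 = m + 1 := Real.sq_sqrt (by linarith)
  have hab : a ≤ b := Real.sqrt_le_sqrt (by linarith)
  have hb3 : b ≤ 2 * a := by nlinarith
  rw [div_le_iff₀ (by linarith)]
  have : (b - a) * (b + a) = 1 := by nlinarith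
  nlinarith

/-- The regret of UCB on the interventions on `x`, if all averages are close to the means. -/
theorem ucb_regret {η L : ℝ} {A : ℕ → Intervention n K} {R : ℕ → ℝ} {t₀ T : ℕ} {x : Fin n}
    {μ : Intervention n K → ℝ} {k₀ : Fin K} (hL : Real.log (1 / η) = L) (hL1 : 1 ≤ L)
    (hμ : ∀ k, μ (some (x, k)) ∈ Set.Icc (0 : ℝ) 1)
    (hchoice : ∀ t, t₀ ≤ t → t < T → UCBChoice η A R t₀ t x)
    (hconc : ∀ t, t₀ ≤ t → t < T → ∀ k, pulls A t₀ t (some (x, k)) ≠ 0 →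
      |(∑ s ∈ (Finset.Ico t₀ t).filter (fun s => A s = some (x, k)), R s) /
          pulls A t₀ t (some (x, k)) - μ (some (x, k))| ≤
        √(2 * L / pulls A t₀ t (some (x, k)))) :
    ∑ t ∈ Finset.Ico t₀ T, (μ (some (x, k₀)) - μ (A t)) ≤ 6 * √(2 * L) * √(K * T) := by
  have hc1 : 1 ≤ √(2 * L) := Real.one_le_sqrt.2 (by linarith)
  -- The sum of the roots of the numbers of pulls is a potential whose growth pays for each round.
  -- For an untried arm it grows by one, which covers the maximal gap.
  have key : ∀ t, t₀ ≤ t → t ≤ T → ∑ s ∈ Finset.Ico t₀ t, (μ (some (x, k₀)) - μ (A s)) ≤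
      6 * √(2 * L) * ∑ k, √(pulls A t₀ t (some (x, k)) : ℝ) := by
    intro t ht
    induction t, ht using Nat.le_induction with
    | base => intro _; simp [pulls]
    | succ t ht ih =>
      intro htT
      have ih := ih (by omega)
      rw [Finset.sum_Ico_succ_top ht]
      obtain ⟨k, hk, hk'⟩ := hchoice t ht (by omega)
      have hsum : ∑ k', √(pulls A t₀ (t + 1) (some (x, k')) : ℝ) =
          ∑ k', √(pulls A t₀ t (some (x, k')) : ℝ) +
            (√((pulls A t₀ t (some (x, k)) : ℝ) + 1) - √(pulls A t₀ t (some (x, k)) : ℝ)) := by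
        rw [← Finset.add_sum_erase _ _ (Finset.mem_univ k),
          ← Finset.add_sum_erase Finset.univ (fun k' => √(pulls A t₀ t (some (x, k')) : ℝ))
            (Finset.mem_univ k)]
        have : ∀ k' ∈ Finset.univ.erase k, √(pulls A t₀ (t + 1) (some (x, k')) : ℝ) =
            √(pulls A t₀ t (some (x, k')) : ℝ) := by
          intro k' hk'
          have hne : ¬ k = k' := fun e => (Finset.ne_of_mem_erase hk') e.symm
          rw [pulls_succ A ht, hk]
          simp [hne]
        rw [Finset.sum_congr rfl this, pulls_succ A ht, hk]
        simp only [if_true]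
        push_cast
        ring
      rw [hsum, mul_add]
      refine add_le_add ih ?_
      rw [hk]
      set m := pulls A t₀ t (some (x, k)) with hm
      rcases hk' with h0 | ⟨hall, hmax⟩
      · have : μ (some (x, k₀)) - μ (some (x, k)) ≤ 1 := by
          have := (hμ k₀).2
          have := (hμ k).1
          linarith
        rw [h0]
        simp only [Nat.cast_zero, zero_add, Real.sqrt_one, Real.sqrt_zero, sub_zero, mul_one]
        linarith
      · have h1 := hconc t ht (by omega) k (hall k)
        have h2 := hconc t ht (by omega) k₀ (hall k₀)
        have h3 := hmax k₀
        simp only [ucbIndex, hL] at h3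
        rw [← hm] at h1 h3
        have h4 : √(2 * L / m) = √(2 * L) * (1 / √(m : ℝ)) := by
          rw [Real.sqrt_div (by linarith)]
          ring
        have h5 := mul_le_mul_of_nonneg_left (one_div_sqrt_le (hall k)) (Real.sqrt_nonneg (2 * L))
        rw [← hm] at h5
        have h6 := abs_le.1 h1
        have h7 := abs_le.1 h2
        -- Optimism: the index of `k₀` is at least its mean, and the index of the chosen arm exceeds
        -- its own mean by at most two widths.
        have : μ (some (x, k₀)) - μ (some (x, k)) ≤ 2 * √(2 * L / m) := by linarith [h6.2, h7.1]
        rw [h4] at this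
        calc _ ≤ _ := this
          _ = 2 * (√(2 * L) * (1 / √(m : ℝ))) := rfl
          _ ≤ 2 * (√(2 * L) * (3 * (√((m : ℝ) + 1) - √(m : ℝ)))) := by linarith
          _ = _ := by ring
  by_cases hT : t₀ ≤ T
  · refine (key T hT le_rfl).trans (mul_le_mul_of_nonneg_left ?_ (by positivity))
    refine Real.le_sqrt_of_sq_le ?_
    -- Cauchy–Schwarz over the `K` arms, with at most `T` pulls in total.
    refine sq_sum_le_card_mul_sum_sq.trans ?_
    rw [Finset.card_univ, Fintype.card_fin]
    refine mul_le_mul_of_nonneg_left ?_ (Nat.cast_nonneg _)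
    simp_rw [Real.sq_sqrt (Nat.cast_nonneg _)]
    exact_mod_cast (sum_pulls_le A t₀ T x).trans (Nat.sub_le _ _)
  · rw [Finset.Ico_eq_empty_of_le (by omega), Finset.sum_empty]
    positivity

/-! ### The regret of a run with accurate averages -/

theorem blockStart_succ (K B j : ℕ) : blockStart K B (j + 1) = blockStart K B j + K * B := by
  simp only [blockStart]
  ring

theorem blockStart_mono (K B : ℕ) {i j : ℕ} (h : i ≤ j) : blockStart K B i ≤ blockStart K B j := by
  simp only [blockStart]
  gcongr

theorem exists_block {K B t : ℕ} (hKB : 0 < K * B) (ht : B ≤ t) :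
    ∃ j, blockStart K B j ≤ t ∧ t < blockStart K B (j + 1) := by
  refine ⟨(t - B) / (K * B), ?_, ?_⟩
  · have := Nat.div_mul_le_self (t - B) (K * B)
    simp only [blockStart]
    omega
  · have := Nat.lt_div_mul_add (a := t - B) hKB
    rw [blockStart_succ]
    simp only [blockStart]
    omega

theorem SearchKey.start_eq {E : MixedGraph n} {j : ℕ} {W : Set (Fin n)} {r : Fin n}
    {S : Set (Fin n)} {x : Fin n} {s : ℕ} (h : SearchKey E j W r S (.exploit x s)) : s = j := by
  cases h
  rfl

theorem SearchChildren.start_eq {E : MixedGraph n} {j : ℕ} {W : Set (Fin n)} {r v : Fin n}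
    {S : Set (Fin n)} {l : List (Fin n)} {f : Option (Fin n)} {x : Fin n} {s : ℕ}
    (h : SearchChildren E j W r S v l f (.exploit x s)) : s = j := by
  cases h with
  | key => rfl
  | descend y _ h => exact h.start_eq

theorem Step.start_eq {E : MixedGraph n} {ε Δ Rhat : ℝ} {obs : Fin n → Fin K → ℝ}
    {fb : Feedback n K} {j : ℕ} {p : Phase E} {x : Fin n} {s : ℕ}
    (h : Step E ε Δ obs Rhat fb j p (.exploit x s)) : s = j ∨ ∃ x' s', p = .exploit x' s' := by
  cases h with
  | found _ _ _ _ _ _ _ _ h => exact .inl h.start_eq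
  | exhausted _ _ _ _ _ _ _ h => cases h
  | up _ _ _ _ _ _ h => exact .inl h.start_eq
  | down _ _ _ _ _ _ _ _ _ h => exact .inl h.start_eq
  | childHit _ _ _ _ _ _ _ _ _ h => exact .inl h.start_eq
  | childMiss _ _ _ _ _ _ _ _ _ h => exact .inl h.start_eq
  | exploit => exact .inr ⟨_, _, rfl⟩

theorem Step.eq_of_exploit {E : MixedGraph n} {ε Δ Rhat : ℝ} {obs : Fin n → Fin K → ℝ}
    {fb : Feedback n K} {j : ℕ} {p : Phase E} {x : Fin n} {s : ℕ}
    (h : Step E ε Δ obs Rhat fb j (.exploit x s) p) : p = .exploit x s := by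
  cases h
  rfl

/-- A sum over a window divided by its length. -/
theorem abs_div_sub_lt {B : ℕ} (hB : 0 < B) {f : ℕ → ℝ} {μ r : ℝ}
    (h : |∑ b ∈ Finset.range B, (f b - μ)| < B * r) :
    |(∑ b ∈ Finset.range B, f b) / B - μ| < r := by
  have hB' : (0 : ℝ) < B := by exact_mod_cast hB
  rw [Finset.sum_sub_distrib, Finset.sum_const, Finset.card_range, nsmul_eq_mul] at h
  have : (∑ b ∈ Finset.range B, f b) / B - μ = (∑ b ∈ Finset.range B, f b - B * μ) / B := by
    field_simp
  rw [this, abs_div, abs_of_pos hB', div_lt_iff₀ hB']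
  linarith

/-- The tests of one block give the correct results if the averages are accurate. -/
theorem hit_iff {M : CausalBandit n K} {Δ Rhat : ℝ} (hR : M.RewardModel)
    (hΔ : M.RewardIdentifiable Δ) (hhat : |Rhat - M.mean none| < Δ / 4) {fb : Feedback n K}
    {v : Fin n} (hfb : ∀ z, |fb.reward z - M.mean (some (v, z))| < Δ / 4) :
    fb.Hit Δ Rhat ↔ M.D.IsAncestor v M.rewardVar := by
  constructor
  · rintro ⟨z, hz⟩
    by_contra hv
    have h1 := hfb z
    rw [hR.mean_eq_of_not_isAncestor hv] at h1
    rw [abs_lt] at h1 hhat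
    rcases lt_abs.1 hz with e | e <;> linarith [h1.1, h1.2, hhat.1, hhat.2]
  · intro hv
    obtain ⟨z, hz⟩ := hΔ v hv
    -- Two errors below `Δ / 4` leave more than the threshold `Δ / 2` of a gap `Δ`; without a gap
    -- they stay below it.
    refine ⟨z, lt_abs.2 ?_⟩
    have h1 := abs_lt.1 (hfb z)
    have h2 := abs_lt.1 hhat
    rcases le_abs.1 hz with e | e
    · left; linarith [h1.1, h1.2, h2.1, h2.2]
    · right; linarith [h1.1, h1.2, h2.1, h2.2]

/-- If the edge is `y → v`, acyclicity makes `v` a non-ancestor of `y`, so there is no effect. As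
the observational probabilities are exact, only one average has an error, and it may be as large as
`ε / 2`. -/
theorem down_iff {M : CausalBandit n K} {ε : ℝ} (hε : M.EffectIdentifiable ε)
    {fb : Feedback n K} {v y : Fin n} (hadj : M.D.skeleton.Adj v y)
    (hfb : ∀ z k, |fb.freq z y k - M.marginal (some (v, z)) y k| < ε / 2) :
    fb.Down ε (M.marginal none) y ↔ M.D.edge v y := by
  constructor
  · rintro ⟨z, k, hz⟩
    refine hadj.resolve_right fun e => ?_
    have hn : ¬ M.D.IsAncestor v y := fun h => M.D.acyclic y (Relation.TransGen.head' e h)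
    have h1 := hfb z k
    rw [M.marginal_eq_of_not_isAncestor hn, abs_sub_comm] at h1
    exact lt_asymm h1 hz
  · intro e
    obtain ⟨k, z, hz⟩ := hε v y e
    refine ⟨z, k, ?_⟩
    have h1 := abs_lt.1 (hfb z k)
    rcases lt_abs.1 hz with e | e
    · exact lt_abs.2 (.inr (by linarith [h1.1, h1.2]))
    · exact lt_abs.2 (.inl (by linarith [h1.1, h1.2]))

/-- Round `t` belongs to a block in which the algorithm performs UCB on the interventions on `q`,
and `do(X_q = k)` is chosen. -/
def ExploitPull {E : MixedGraph n} (B : ℕ) (q : Fin n) (A : ℕ → Intervention n K) (σ : ℕ → Phase E)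
    (k : Fin K) (t : ℕ) : Prop :=
  ∃ j s, blockStart K B j ≤ t ∧ t < blockStart K B (j + 1) ∧ σ j = .exploit q s ∧
    A t = some (q, k)

open scoped Classical in
/-- The first `m` rounds before round `T` in which the property `F` holds. -/
noncomputable def firstRounds (F : ℕ → Prop) (T m : ℕ) : Finset ℕ :=
  (Finset.range T).filter fun t => F t ∧ ((Finset.range t).filter F).card < m

/-- The number of pulls at round `t` is random; the rounds involved are nevertheless the first `m`
occurrences of a predictable event, and each fixed `m` admits a deviation bound. -/
theorem firstRounds_eq {F : ℕ → Prop} {A : ℕ → Intervention n K} {a : Intervention n K}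
    {t₀ T t : ℕ} (hF : ∀ s < T, F s ↔ t₀ ≤ s ∧ A s = a) (ht : t ≤ T) :
    firstRounds F T (pulls A t₀ t a) = (Finset.Ico t₀ t).filter fun s => A s = a := by
  classical
  have hp : ∀ s ≤ T, ((Finset.range s).filter F).card = pulls A t₀ s a := by
    intro s hs
    rw [pulls]
    congr 1
    ext u
    simp only [Finset.mem_filter, Finset.mem_range, Finset.mem_Ico]
    constructor
    · rintro ⟨h1, h2⟩
      have := (hF u (by omega)).1 h2
      exact ⟨⟨this.1, h1⟩, this.2⟩
    · rintro ⟨⟨h1, h2⟩, h3⟩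
      exact ⟨h2, (hF u (by omega)).2 ⟨h1, h3⟩⟩
  ext s
  simp only [firstRounds, Finset.mem_filter, Finset.mem_range, Finset.mem_Ico]
  constructor
  · rintro ⟨h1, h2, h3⟩
    have h4 := (hF s h1).1 h2
    refine ⟨⟨h4.1, ?_⟩, h4.2⟩
    by_contra hc
    rw [hp s h1.le] at h3
    have := pulls_mono A t₀ (not_lt.1 hc) a
    omega
  · rintro ⟨⟨h1, h2⟩, h3⟩
    refine ⟨by omega, (hF s (by omega)).2 ⟨h1, h3⟩, ?_⟩
    rw [hp s (by omega)]
    have h4 := pulls_succ A h1 a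
    rw [if_pos h3] at h4
    have := pulls_mono A t₀ (show s + 1 ≤ t from h2) a
    omega

/-- The averages of a run are accurate. -/
structure Accurate (M : CausalBandit n K) (ε Δ L : ℝ) (B T : ℕ) (A : ℕ → Intervention n K)
    (X : ℕ → Fin n → Fin K) (R : ℕ → ℝ) (σ : ℕ → Phase M.D.essentialGraph) : Prop where
  base : B ≤ T → |∑ b ∈ Finset.range B, (R b - M.mean (A b))| < B * (Δ / 4)
  reward : ∀ j < 2 * n, ∀ z : Fin K, blockStart K B (j + 1) ≤ T →
    |∑ b ∈ Finset.range B, (R (blockStart K B j + z * B + b) -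
      M.mean (A (blockStart K B j + z * B + b)))| < B * (Δ / 4)
  freq : ∀ j < n, ∀ z : Fin K, ∀ y k, blockStart K B (j + 1) ≤ T →
    |∑ b ∈ Finset.range B, ((if X (blockStart K B j + z * B + b) y = k then (1 : ℝ) else 0) -
      M.marginal (A (blockStart K B j + z * B + b)) y k)| < B * (ε / 2)
  ucb : ∀ k : Fin K, ∀ m ∈ Finset.Icc 1 T,
    |∑ t ∈ firstRounds (ExploitPull B M.rewardVar A σ k) T m, (R t - M.mean (A t))| < √(2 * L * m)

/-- Accurate averages make every test correct as long as `SearchInv` holds, and correct tests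
preserve it. The rounds before stage 3 cost at most one each. -/
theorem regret_le_of_accurate {M : CausalBandit n K} {ε Δ η L : ℝ} {B T : ℕ}
    {order : List M.D.essentialGraph.ChainComponent} {A : ℕ → Intervention n K}
    {X : ℕ → Fin n → Fin K} {R : ℕ → ℝ} {σ : ℕ → Phase M.D.essentialGraph} (hK : 0 < K)
    (hB : 0 < B) (hR : M.RewardModel) (hf : M.D.IsCausalForest) (hε : M.EffectIdentifiable ε)
    (hΔ : M.RewardIdentifiable Δ) (ho : M.D.essentialGraph.SinksFirst order)
    (hL : Real.log (1 / η) = L) (hL1 : 1 ≤ L) (hacc : Accurate M ε Δ L B T A X R σ)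
    (observe : ∀ t < T, t < B → A t = none)
    (init : StartComponent M.D.essentialGraph order (σ 0))
    (step : ∀ j, blockStart K B (j + 1) ≤ T → Step M.D.essentialGraph ε Δ (M.marginal none)
      ((∑ b ∈ Finset.range B, R b) / B) (feedback B X R j) (j + 1) (σ j) (σ (j + 1)))
    (explore : ∀ j v, (σ j).target = some v → ∀ z : Fin K, ∀ b < B,
      blockStart K B j + z * B + b < T → A (blockStart K B j + z * B + b) = some (v, z))
    (exploit : ∀ j x start, σ j = .exploit x start → ∀ t < T, blockStart K B j ≤ t →
      t < blockStart K B (j + 1) → UCBChoice η A R (blockStart K B start) t x) :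
    M.regret T A ≤ blockStart K B (searchBound M.D) + 6 * √(2 * L) * √(K * T) := by
  have hKB : 0 < K * B := Nat.mul_pos hK hB
  -- the search is correct
  have inv : ∀ j, blockStart K B j ≤ T → SearchInv M.D order M.rewardVar j (σ j) := by
    intro j
    induction j with
    | zero => exact fun _ => searchInv_of_startComponent ho init
    | succ j ih =>
      intro hj
      have hj' := blockStart_succ K B j
      have hinv := ih (by omega)
      have hB0 : B ≤ blockStart K B j := by simp [blockStart]
      have hwin : ∀ (z : Fin K), ∀ b < B, blockStart K B j + z * B + b < T := by
        intro z b hb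
        have : (z + 1) * B ≤ K * B := Nat.mul_le_mul_right B z.2
        rw [Nat.succ_mul] at this
        omega
      have hhat : |(∑ b ∈ Finset.range B, R b) / B - M.mean none| < Δ / 4 := by
        refine abs_div_sub_lt hB ?_
        have := hacc.base (by omega)
        rwa [Finset.sum_congr rfl fun b hb => by
          rw [observe b (by have := Finset.mem_range.1 hb; omega) (Finset.mem_range.1 hb)]] at this
      refine hinv.step hf ho (fun v hv => ?_) (fun rest W S v hp y hadj => ?_) (step j hj)
      · refine hit_iff hR hΔ hhat fun z => abs_div_sub_lt hB ?_
        have := hacc.reward j (hinv.lt_of_target hv) z hj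
        rwa [Finset.sum_congr rfl fun b hb => by
          rw [explore j v hv z b (Finset.mem_range.1 hb) (hwin z b (Finset.mem_range.1 hb))]] at this
      · have hv : (σ j).target = some v := by rw [hp]; rfl
        rw [hp] at hinv
        refine down_iff hε hadj.1 fun z k => abs_div_sub_lt hB ?_
        have := hacc.freq j hinv.lt_of_locate z y k hj
        rwa [Finset.sum_congr rfl fun b hb => by
          rw [explore j v hv z b (Finset.mem_range.1 hb) (hwin z b (Finset.mem_range.1 hb))]] at this
  obtain ⟨k₀, hk₀, hopt⟩ := hR.exists_optimal hK
  have hgap : ∀ a, M.optimalMean - M.mean a ≤ 1 := fun a => by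
    have h1 := (hR.mean_mem_Icc hK a).1
    have h2 := (hR.mean_mem_Icc hK (some (M.rewardVar, k₀))).2
    linarith
  have hreg : M.regret T A = ∑ t ∈ Finset.range T, (M.optimalMean - M.mean (A t)) := by
    rw [CausalBandit.regret, Finset.sum_sub_distrib]
    simp
  have hpart : ∀ t, ∑ s ∈ Finset.range t, (M.optimalMean - M.mean (A s)) ≤ t := fun t => by
    refine (Finset.sum_le_sum fun s _ => hgap (A s)).trans_eq ?_
    simp
  -- If stage 3 is not reached, the horizon itself is shorter than the longest possible search.
  by_cases hex : ∃ j, blockStart K B j ≤ T ∧ ∃ s, σ j = .exploit M.rewardVar s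
  · classical
    obtain ⟨j₀, ⟨hj₀, s, hs⟩, hmin⟩ : ∃ j₀, (blockStart K B j₀ ≤ T ∧
        ∃ s, σ j₀ = .exploit M.rewardVar s) ∧
        ∀ j < j₀, ¬ (blockStart K B j ≤ T ∧ ∃ s, σ j = .exploit M.rewardVar s) :=
      ⟨Nat.find hex, Nat.find_spec hex, fun j hj => Nat.find_min hex hj⟩
    -- The recorded start is the first block of stage 3, so the statistics of UCB consist of exactly
    -- the pulls from `t₀` on.
    have hstart : s = j₀ := by
      cases j₀ with
      | zero =>
        rw [hs] at init
        cases init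
      | succ j =>
        have h1 := step j hj₀
        rw [hs] at h1
        refine h1.start_eq.resolve_right ?_
        rintro ⟨x', s', h2⟩
        have hle := (blockStart_mono K B (Nat.le_succ j)).trans hj₀
        have h3 := inv j hle
        rw [h2] at h3
        rw [h3.eq_of_exploit.1] at h2
        exact hmin j (Nat.lt_succ_self j) ⟨hle, s', h2⟩
    subst hstart
    have hstay : ∀ j, s ≤ j → blockStart K B j ≤ T → σ j = .exploit M.rewardVar s := by
      intro j hj
      induction j, hj using Nat.le_induction with
      | base => exact fun _ => hs
      | succ j hj ih =>
        intro hT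
        have h1 := step j hT
        rw [ih ((blockStart_mono K B (Nat.le_succ j)).trans hT)] at h1
        exact h1.eq_of_exploit
    have hsb : s ≤ searchBound M.D := by
      have := inv s hj₀
      rw [hs] at this
      exact this.eq_of_exploit.2
    set t₀ := blockStart K B s with ht₀
    have hblock : ∀ t, t₀ ≤ t → t < T → ∃ j, blockStart K B j ≤ t ∧
        t < blockStart K B (j + 1) ∧ σ j = .exploit M.rewardVar s := by
      intro t ht htT
      have hBt : B ≤ t := le_trans (by simp [ht₀, blockStart]) ht
      obtain ⟨j, h1, h2⟩ := exists_block hKB hBt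
      refine ⟨j, h1, h2, hstay j ?_ (by omega)⟩
      by_contra hc
      have := blockStart_mono K B (Nat.succ_le_of_lt (not_le.1 hc))
      rw [Nat.succ_eq_add_one] at this
      omega
    have hpull : ∀ k, ∀ t < T, ExploitPull B M.rewardVar A σ k t ↔
        t₀ ≤ t ∧ A t = some (M.rewardVar, k) := by
      intro k t htT
      constructor
      · rintro ⟨j, s', h1, h2, h3, h4⟩
        refine ⟨?_, h4⟩
        have : s ≤ j := by
          by_contra hc
          exact hmin j (not_le.1 hc) ⟨by omega, s', h3⟩
        exact (blockStart_mono K B this).trans h1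
      · rintro ⟨h1, h2⟩
        obtain ⟨j, h3, h4, h5⟩ := hblock t h1 htT
        exact ⟨j, s, h3, h4, h5, h2⟩
    have hucb := ucb_regret (η := η) (L := L) (A := A) (R := R) (t₀ := t₀) (T := T)
      (x := M.rewardVar) (μ := M.mean) (k₀ := k₀) hL hL1 (fun k => hR.mean_mem_Icc hK _)
      (fun t h1 h2 => by
        obtain ⟨j, h3, h4, h5⟩ := hblock t h1 h2
        exact exploit j _ _ h5 t h2 h3 h4)
      (fun t h1 h2 k hk => by
        set m := pulls A t₀ t (some (M.rewardVar, k)) with hm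
        have hmpos : (0 : ℝ) < m := by exact_mod_cast Nat.pos_of_ne_zero hk
        have hmT : m ≤ T := by
          have h3 : m ≤ (Finset.Ico t₀ t).card := Finset.card_filter_le _ _
          rw [Nat.card_Ico] at h3
          omega
        have h4 := hacc.ucb k m (Finset.mem_Icc.2 ⟨Nat.pos_of_ne_zero hk, hmT⟩)
        rw [hm, firstRounds_eq (hpull k) h2.le, ← hm] at h4
        rw [Finset.sum_congr rfl (g := fun s => R s - M.mean (some (M.rewardVar, k)))
          fun s hs => by rw [(Finset.mem_filter.1 hs).2], Finset.sum_sub_distrib, Finset.sum_const,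
          nsmul_eq_mul, show ((Finset.Ico t₀ t).filter fun s =>
            A s = some (M.rewardVar, k)).card = m from rfl] at h4
        rw [div_sub' hmpos.ne', abs_div, abs_of_pos hmpos, div_le_iff₀ hmpos]
        refine h4.le.trans_eq ?_
        rw [← Real.sqrt_sq hmpos.le, ← Real.sqrt_mul' _ (by positivity)]
        congr 1
        rw [Real.sqrt_sq hmpos.le]
        field_simp)
    rw [hreg, Finset.range_eq_Ico, ← Finset.sum_Ico_consecutive _ (Nat.zero_le t₀) hj₀,
      ← Finset.range_eq_Ico]
    refine add_le_add ((hpart t₀).trans ?_) ?_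
    · exact_mod_cast blockStart_mono K B hsb
    · rw [hk₀]
      exact hucb
  · have hlt : T < blockStart K B (searchBound M.D) := by
      by_contra hc
      rcases (inv _ (not_lt.1 hc)).target_or_exploit with h | ⟨s, h⟩
      · exact lt_irrefl _ h.2
      · exact hex ⟨_, not_lt.1 hc, s, h⟩
    rw [hreg]
    have h1 : (T : ℝ) ≤ blockStart K B (searchBound M.D) := by exact_mod_cast hlt.le
    have h2 : 0 ≤ 6 * √(2 * L) * √(K * T) := by positivity
    linarith [hpart T]

end CNUCB

/-! ### The averages of a run are accurate with high probability -/

namespace CausalBandit.IsInteraction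

open scoped ENNReal NNReal

variable {n K : ℕ} {M : CausalBandit n K} {Ω : Type*} [mΩ : MeasurableSpace Ω] {P : Measure Ω}
  {ℱ : Filtration ℕ mΩ} {T : ℕ} {A : ℕ → Ω → Intervention n K} {X : ℕ → Ω → Fin n → Fin K}
  {R : ℕ → Ω → ℝ} {f : (Fin n → Fin K) × ℝ → ℝ} {μ : Intervention n K → ℝ} {c : ℝ≥0}

theorem measure_le_abs_sum_window_le [IsProbabilityMeasure P] (h : M.IsInteraction P ℱ T A X R)
    (hf : Measurable f) (hsub : ∀ a, HasSubgaussianMGF (fun p => f p - μ a) c (M.law a))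
    {s B : ℕ} (hs : s + B ≤ T) {r : ℝ} (hr : 0 ≤ r) :
    P {ω | r ≤ |∑ b ∈ Finset.range B, (f (X (s + b) ω, R (s + b) ω) - μ (A (s + b) ω))|}
      ≤ ENNReal.ofReal (2 * Real.exp (-(r ^ 2 / (2 * c * B)))) := by
  classical
  have hfil : ∀ ω : Ω, (Finset.range T).filter (fun t => ω ∈ {_ω : Ω | s ≤ t ∧ t < s + B}) =
      Finset.Ico s (s + B) := fun ω => by
    ext t
    simp only [Finset.mem_filter, Finset.mem_range, Set.mem_ofPred_eq, Finset.mem_Ico]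
    omega
  have := h.measure_le_abs_sum_le hf hsub (fun t => {_ω | s ≤ t ∧ t < s + B})
    (fun t => MeasurableSet.const _) (m := B)
    (fun ω => by
      refine (Finset.card_le_card fun t ht => ?_).trans_eq (by simp : (Finset.Ico s (s + B)).card = B)
      simp only [Finset.mem_filter, Set.mem_ofPred_eq] at ht
      exact Finset.mem_Ico.2 ht.2) hr
  refine le_trans (measure_mono fun ω hω => ?_) this
  simp only [Set.mem_ofPred_eq] at hω ⊢
  refine hω.trans_eq ?_
  congr 1
  have e := Finset.sum_Ico_eq_sum_range (fun t => f (X t ω, R t ω) - μ (A t ω)) s (s + B)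
  rw [Nat.add_sub_cancel_left] at e
  rw [← e]
  refine Finset.sum_congr ?_ fun _ _ => rfl
  ext t
  simp only [Finset.mem_filter, Finset.mem_range, Finset.mem_Ico]
  omega

theorem card_firstRounds_le (F : ℕ → Prop) (T m : ℕ) : (CNUCB.firstRounds F T m).card ≤ m := by
  classical
  refine (Finset.card_le_card_of_injOn (t := Finset.range m)
    (fun t => ((Finset.range t).filter F).card) ?_ ?_).trans_eq (Finset.card_range m)
  · intro t ht
    exact Finset.mem_coe.2 (Finset.mem_range.2 (Finset.mem_filter.1 ht).2.2)
  · have hlt : ∀ s t, F s → s < t → ((Finset.range s).filter F).card < ((Finset.range t).filter F).card := by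
      intro s t hs hst
      refine Finset.card_lt_card ⟨Finset.filter_subset_filter _ (Finset.range_subset_range.2 hst.le), fun hc => ?_⟩
      have := @hc s (Finset.mem_filter.2 ⟨Finset.mem_range.2 hst, hs⟩)
      simp at this
    intro s hs t ht e
    have hs := (Finset.mem_filter.1 hs).2.1
    have ht := (Finset.mem_filter.1 ht).2.1
    simp only at e
    rcases lt_trichotomy s t with h | h | h
    · have := hlt s t hs h
      omega
    · exact h
    · have := hlt t s ht h
      omega

/-- Whether `F` has occurred fewer than `m` times so far is known before the round, so the selection
is predictable and selects at most `m` rounds. -/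
theorem measure_le_abs_sum_firstRounds_le [IsProbabilityMeasure P]
    (h : M.IsInteraction P ℱ T A X R) (hf : Measurable f)
    (hsub : ∀ a, HasSubgaussianMGF (fun p => f p - μ a) c (M.law a)) {F : ℕ → Ω → Prop}
    (hF : ∀ t, MeasurableSet[ℱ t] {ω | F t ω}) {m : ℕ} {r : ℝ} (hr : 0 ≤ r) :
    P {ω | r ≤ |∑ t ∈ CNUCB.firstRounds (fun t => F t ω) T m, (f (X t ω, R t ω) - μ (A t ω))|}
      ≤ ENNReal.ofReal (2 * Real.exp (-(r ^ 2 / (2 * c * m)))) := by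
  classical
  have hN : ∀ t, Measurable[ℱ t] fun ω => ((Finset.range t).filter fun s => F s ω).card := by
    intro t
    simp only [Finset.card_filter]
    refine Finset.measurable_sum _ fun s hs => ?_
    exact Measurable.ite (ℱ.mono (Finset.mem_range.1 hs).le _ (hF s)) measurable_const
      measurable_const
  have := h.measure_le_abs_sum_le hf hsub
    (fun t => {ω | F t ω} ∩ {ω | ((Finset.range t).filter fun s => F s ω).card < m})
    (fun t => (hF t).inter (hN t (measurableSet_Iio (a := m)))) (m := m)
    (fun ω => ?_) hr
  · refine le_trans (measure_mono fun ω hω => ?_) this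
    simp only [Set.mem_ofPred_eq] at hω ⊢
    refine hω.trans_eq ?_
    congr 1
    refine Finset.sum_congr ?_ fun _ _ => rfl
    ext t
    simp only [CNUCB.firstRounds, Finset.mem_filter, Finset.mem_range, Set.mem_inter_iff,
      Set.mem_ofPred_eq]
  · refine le_trans (Finset.card_le_card fun t ht => ?_)
      (card_firstRounds_le (fun t => F t ω) T m)
    simp only [CNUCB.firstRounds, Finset.mem_filter, Finset.mem_range, Set.mem_inter_iff,
      Set.mem_ofPred_eq] at ht ⊢
    convert ht

end CausalBandit.IsInteraction

theorem MeasureTheory.measure_biUnion_le_card_mul {Ω ι : Type*} [MeasurableSpace Ω] (P : Measure Ω)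
    (s : Finset ι) (f : ι → Set Ω) {c : ℝ} (hf : ∀ i ∈ s, P (f i) ≤ ENNReal.ofReal c) :
    P (⋃ i ∈ s, f i) ≤ ENNReal.ofReal (s.card * c) := by
  refine (measure_biUnion_finset_le s f).trans ((Finset.sum_le_sum hf).trans_eq ?_)
  rw [Finset.sum_const, nsmul_eq_mul, ENNReal.ofReal_mul (Nat.cast_nonneg _),
    ENNReal.ofReal_natCast]

theorem Real.two_mul_exp_neg_le {x y : ℝ} (hy : 0 < y) (h : Real.log y ≤ x) :
    2 * Real.exp (-x) ≤ 2 / y := by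
  have h1 : Real.exp (-x) ≤ y⁻¹ := by
    rw [Real.exp_neg]
    exact inv_anti₀ hy ((Real.log_le_iff_le_exp hy).1 h)
  rw [div_eq_mul_inv]
  linarith

namespace CNUCB

open scoped ENNReal

variable {n K : ℕ} {M : CausalBandit n K} {ε Δ δ : ℝ}
  {order : List M.D.essentialGraph.ChainComponent} {T : ℕ} {Ω : Type*} [mΩ : MeasurableSpace Ω]
  {P : Measure Ω} {ℱ : Filtration ℕ mΩ} {A : ℕ → Ω → Intervention n K}
  {X : ℕ → Ω → Fin n → Fin K} {R : ℕ → Ω → ℝ} {σ : ℕ → Ω → Phase M.D.essentialGraph}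

/-- The state of a block is known at its first round, which is not later than `t`. -/
theorem measurableSet_exploitPull (h : IsRun M ε Δ δ order T P ℱ A X R σ) (k : Fin K) (t : ℕ) :
    MeasurableSet[ℱ t] {ω | ExploitPull (reps n K ε Δ δ) M.rewardVar (fun t => A t ω)
      (fun j => σ j ω) k t} := by
  have e : {ω | ExploitPull (reps n K ε Δ δ) M.rewardVar (fun t => A t ω)
      (fun j => σ j ω) k t} = ⋃ j, ⋃ s, ⋃ (_ : blockStart K (reps n K ε Δ δ) j ≤ t ∧
        t < blockStart K (reps n K ε Δ δ) (j + 1)),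
        ({ω | σ j ω = .exploit M.rewardVar s} ∩ {ω | A t ω = some (M.rewardVar, k)}) := by
    ext ω
    simp only [ExploitPull, Set.mem_ofPred_eq, Set.mem_iUnion, Set.mem_inter_iff, exists_prop,
      and_assoc]
  rw [e]
  refine MeasurableSet.iUnion fun j => MeasurableSet.iUnion fun s => MeasurableSet.iUnion fun hj => ?_
  exact (ℱ.mono hj.1 _ (h.state_meas j _)).inter (h.interaction.action_meas t _)

/-- A union bound over windows at fixed positions, with deviations centred at the means of whatever
actions were taken there. The failure probability is split into at most `δ / 8` for `do()`, `δ / 2`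
for the reward tests, `δ / 4` for the direction tests and `δ / 16` for UCB. -/
theorem le_measure_accurate [IsProbabilityMeasure P] (h : IsRun M ε Δ δ order T P ℱ A X R σ)
    (hn : 2 ≤ n) (hK : 0 < K) (hT : 0 < T) (hε : 0 < ε) (hΔ : 0 < Δ) (hδ : 0 < δ)
    (hR : M.RewardModel) (hB : 0 < reps n K ε Δ δ) {L : ℝ}
    (hL : L = Real.log (1 / (δ / (32 * K * T)))) (hL0 : 0 ≤ L) :
    ∃ bad : Set Ω, P bad ≤ ENNReal.ofReal δ ∧ ∀ ω ∉ bad,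
      Accurate M ε Δ L (reps n K ε Δ δ) T (fun t => A t ω) (fun t => X t ω) (fun t => R t ω)
        (fun j => σ j ω) := by
  classical
  set B := reps n K ε Δ δ with hBdef
  have hI := h.interaction
  have hn' : (2 : ℝ) ≤ n := by exact_mod_cast hn
  have hK' : (1 : ℝ) ≤ K := by exact_mod_cast hK
  have hT' : (1 : ℝ) ≤ T := by exact_mod_cast hT
  have hB' : (0 : ℝ) < B := by exact_mod_cast hB
  have hBmax : max (32 / Δ ^ 2 * Real.log (8 * n * K / δ))
      (2 / ε ^ 2 * Real.log (8 * n ^ 2 * K ^ 2 / δ)) ≤ (B : ℝ) := Nat.le_ceil _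
  have hB1 : Real.log (8 * n * K / δ) ≤ (B : ℝ) * Δ ^ 2 / 32 := by
    have := (le_max_left _ _).trans hBmax
    rw [div_mul_eq_mul_div, div_le_iff₀ (by positivity)] at this
    linarith
  have hB2 : Real.log (8 * n ^ 2 * K ^ 2 / δ) ≤ (B : ℝ) * ε ^ 2 / 2 := by
    have := (le_max_right _ _).trans hBmax
    rw [div_mul_eq_mul_div, div_le_iff₀ (by positivity)] at this
    linarith
  have hsubR : ∀ a, HasSubgaussianMGF (fun p : (Fin n → Fin K) × ℝ => p.2 - M.mean a) 1 (M.law a) :=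
    hR.2
  -- deviations of the averages over one window
  have dev1 : ∀ s, s + B ≤ T → P {ω | (B : ℝ) * (Δ / 4) ≤ |∑ b ∈ Finset.range B,
      (R (s + b) ω - M.mean (A (s + b) ω))|} ≤ ENNReal.ofReal (δ / (4 * n * K)) := by
    intro s hs
    refine (hI.measure_le_abs_sum_window_le measurable_snd hsubR hs
      (r := (B : ℝ) * (Δ / 4)) (by positivity)).trans (ENNReal.ofReal_le_ofReal ?_)
    have e : ((B : ℝ) * (Δ / 4)) ^ 2 / (2 * ((1 : NNReal) : ℝ) * B) = (B : ℝ) * Δ ^ 2 / 32 := by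
      rw [NNReal.coe_one]
      field_simp
      norm_num
    rw [e]
    refine (Real.two_mul_exp_neg_le (y := 8 * n * K / δ) (by positivity) hB1).trans_eq ?_
    field_simp
    norm_num
  have dev2 : ∀ y k s, s + B ≤ T → P {ω | (B : ℝ) * (ε / 2) ≤ |∑ b ∈ Finset.range B,
      ((if X (s + b) ω y = k then (1 : ℝ) else 0) - M.marginal (A (s + b) ω) y k)|} ≤
        ENNReal.ofReal (δ / (4 * n ^ 2 * K ^ 2)) := by
    intro y k s hs
    have hm : Measurable fun p : (Fin n → Fin K) × ℝ => if p.1 y = k then (1 : ℝ) else 0 :=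
      Measurable.ite (measurableSet_eq_fun (by fun_prop) measurable_const) measurable_const
        measurable_const
    refine (hI.measure_le_abs_sum_window_le hm
      (fun a => CausalBandit.hasSubgaussianMGF_indicator hK a y k) hs
      (r := (B : ℝ) * (ε / 2)) (by positivity)).trans (ENNReal.ofReal_le_ofReal ?_)
    have e : ((B : ℝ) * (ε / 2)) ^ 2 / (2 * ((1 / 4 : NNReal) : ℝ) * B) = (B : ℝ) * ε ^ 2 / 2 := by
      push_cast
      field_simp
      norm_num
    rw [e]
    refine (Real.two_mul_exp_neg_le (y := 8 * n ^ 2 * K ^ 2 / δ) (by positivity) hB2).trans_eq ?_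
    field_simp
    norm_num
  have dev3 : ∀ k : Fin K, ∀ m ∈ Finset.Icc 1 T, P {ω | √(2 * L * m) ≤ |∑ t ∈ firstRounds
      (fun t => ExploitPull B M.rewardVar (fun t => A t ω) (fun j => σ j ω) k t) T m,
      (R t ω - M.mean (A t ω))|} ≤ ENNReal.ofReal (δ / (16 * K * T)) := by
    intro k m hm
    have hm' : (1 : ℝ) ≤ m := by exact_mod_cast (Finset.mem_Icc.1 hm).1
    refine (hI.measure_le_abs_sum_firstRounds_le measurable_snd hsubR
      (F := fun t ω => ExploitPull B M.rewardVar (fun t => A t ω) (fun j => σ j ω) k t)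
      (fun t => measurableSet_exploitPull h k t) (m := m)
      (r := √(2 * L * m)) (by positivity)).trans (ENNReal.ofReal_le_ofReal ?_)
    have e : √(2 * L * m) ^ 2 / (2 * ((1 : NNReal) : ℝ) * m) = L := by
      rw [NNReal.coe_one, Real.sq_sqrt (by positivity)]
      field_simp
    rw [e]
    refine (Real.two_mul_exp_neg_le (y := 1 / (δ / (32 * K * T))) (by positivity) hL.ge).trans_eq ?_
    field_simp
    norm_num
  have hend : ∀ j (z : Fin K), blockStart K B (j + 1) ≤ T → blockStart K B j + z * B + B ≤ T := by
    intro j z hj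
    have := blockStart_succ K B j
    have h2 : (z + 1) * B ≤ K * B := Nat.mul_le_mul_right B z.2
    rw [Nat.succ_mul] at h2
    omega
  set bad1 : Set Ω := {ω | B ≤ T ∧ (B : ℝ) * (Δ / 4) ≤ |∑ b ∈ Finset.range B,
      (R b ω - M.mean (A b ω))|} with hbad1
  set bad2 : ℕ × Fin K → Set Ω := fun i => {ω | blockStart K B (i.1 + 1) ≤ T ∧
    (B : ℝ) * (Δ / 4) ≤ |∑ b ∈ Finset.range B, (R (blockStart K B i.1 + i.2 * B + b) ω -
      M.mean (A (blockStart K B i.1 + i.2 * B + b) ω))|} with hbad2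
  set bad3 : ℕ × Fin K × Fin n × Fin K → Set Ω := fun i => {ω | blockStart K B (i.1 + 1) ≤ T ∧
    (B : ℝ) * (ε / 2) ≤ |∑ b ∈ Finset.range B,
      ((if X (blockStart K B i.1 + i.2.1 * B + b) ω i.2.2.1 = i.2.2.2 then (1 : ℝ) else 0) -
      M.marginal (A (blockStart K B i.1 + i.2.1 * B + b) ω) i.2.2.1 i.2.2.2)|} with hbad3
  set bad4 : Fin K × ℕ → Set Ω := fun i => {ω | √(2 * L * i.2) ≤ |∑ t ∈ firstRounds
      (fun t => ExploitPull B M.rewardVar (fun t => A t ω) (fun j => σ j ω) i.1 t) T i.2,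
      (R t ω - M.mean (A t ω))|} with hbad4
  have p1 : P bad1 ≤ ENNReal.ofReal (δ / (4 * n * K)) := by
    by_cases hBT : B ≤ T
    · refine le_trans (measure_mono fun ω hω => ?_) (dev1 0 (by omega))
      simpa using hω.2
    · simp [hbad1, hBT]
  have p2 := measure_biUnion_le_card_mul P (Finset.range (2 * n) ×ˢ Finset.univ) bad2
    (c := δ / (4 * n * K)) fun i _ => by
      by_cases hBT : blockStart K B (i.1 + 1) ≤ T
      · exact le_trans (measure_mono fun ω hω => hω.2) (dev1 _ (hend i.1 i.2 hBT))
      · simp [hbad2, hBT]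
  have p3 := measure_biUnion_le_card_mul P (Finset.range n ×ˢ Finset.univ) bad3
    (c := δ / (4 * n ^ 2 * K ^ 2)) fun i _ => by
      by_cases hBT : blockStart K B (i.1 + 1) ≤ T
      · exact le_trans (measure_mono fun ω hω => hω.2) (dev2 _ _ _ (hend i.1 i.2.1 hBT))
      · simp [hbad3, hBT]
  have p4 := measure_biUnion_le_card_mul P (Finset.univ ×ˢ Finset.Icc 1 T) bad4
    (c := δ / (16 * K * T)) fun i hi => dev3 i.1 i.2 (Finset.mem_product.1 hi).2
  refine ⟨bad1 ∪ (⋃ i ∈ Finset.range (2 * n) ×ˢ Finset.univ, bad2 i) ∪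
    (⋃ i ∈ Finset.range n ×ˢ Finset.univ, bad3 i) ∪
    (⋃ i ∈ Finset.univ ×ˢ Finset.Icc 1 T, bad4 i), ?_, fun ω hω => ?_⟩
  · refine (measure_union_le _ _).trans ((add_le_add ((measure_union_le _ _).trans
      (add_le_add ((measure_union_le _ _).trans (add_le_add p1 p2)) p3)) p4).trans ?_)
    rw [← ENNReal.ofReal_add (by positivity) (by positivity),
      ← ENNReal.ofReal_add (by positivity) (by positivity),
      ← ENNReal.ofReal_add (by positivity) (by positivity)]
    refine ENNReal.ofReal_le_ofReal ?_
    simp only [Finset.card_product, Finset.card_range, Finset.card_univ, Fintype.card_prod,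
      Fintype.card_fin, Nat.card_Icc, Nat.add_sub_cancel]
    push_cast
    have e2 : (2 * (n : ℝ) * K) * (δ / (4 * n * K)) = δ / 2 := by field_simp; norm_num
    have e3 : ((n : ℝ) * (K * (n * K))) * (δ / (4 * n ^ 2 * K ^ 2)) = δ / 4 := by field_simp
    have e4 : ((K : ℝ) * T) * (δ / (16 * K * T)) = δ / 16 := by field_simp
    have e1 : δ / (4 * n * K) ≤ δ / 8 := by
      refine div_le_div_of_nonneg_left hδ.le (by norm_num) ?_
      nlinarith
    rw [e2, e3, e4]
    linarith
  · simp only [Set.mem_union, Set.mem_iUnion, not_or, not_exists] at hω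
    obtain ⟨⟨⟨h1, h2⟩, h3⟩, h4⟩ := hω
    refine ⟨fun hBT => ?_, fun j hj z hjT => ?_, fun j hj z y k hjT => ?_, fun k m hm => ?_⟩
    · exact not_le.1 fun hc => h1 ⟨hBT, hc⟩
    · exact not_le.1 fun hc => h2 (j, z) (by simpa using hj) ⟨hjT, hc⟩
    · exact not_le.1 fun hc => h3 (j, z, y, k) (by simpa using hj) ⟨hjT, hc⟩
    · exact not_le.1 fun hc => h4 (k, m) (by simpa using hm) hc

/-! ### The regret bound -/

theorem log_eight_mul_le {n K : ℕ} {δ : ℝ} (hn : 2 ≤ n) (hK : 0 < K) (hδ : 0 < δ) (hδ1 : δ < 1) :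
    Real.log (8 * n ^ 2 * K ^ 2 / δ) ≤ 8 * Real.log n * (1 + Real.log (K / δ)) := by
  have hn' : (2 : ℝ) ≤ n := by exact_mod_cast hn
  have hK' : (1 : ℝ) ≤ K := by exact_mod_cast hK
  have h2 : (0.6931471803 : ℝ) < Real.log 2 := Real.log_two_gt_d9
  have hl : Real.log 2 ≤ Real.log n := Real.log_le_log (by norm_num) hn'
  have h8 : Real.log 8 = 3 * Real.log 2 := by
    rw [show (8 : ℝ) = 2 ^ 3 by norm_num, Real.log_pow]
    norm_num
  have hd : Real.log δ ≤ 0 := Real.log_nonpos hδ.le hδ1.le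
  have hk : 0 ≤ Real.log K := Real.log_nonneg hK'
  rw [Real.log_div (by positivity) hδ.ne', Real.log_mul (by positivity) (by positivity),
    Real.log_mul (by positivity) (by positivity), Real.log_pow, Real.log_pow, h8,
    Real.log_div (by positivity) hδ.ne']
  push_cast
  nlinarith

theorem searchBound_le {n : ℕ} (D : DAG n) (hn : 2 ≤ n) :
    (searchBound D : ℝ) ≤ 9 / 2 * (D.essentialGraph.maxChainDegree +
      D.essentialGraph.numChainComponents) * Real.log n ∧
    (1 : ℝ) ≤ D.essentialGraph.numChainComponents := by
  have hn' : (2 : ℝ) ≤ n := by exact_mod_cast hn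
  have h2 : (0.6931471803 : ℝ) < Real.log 2 := Real.log_two_gt_d9
  have hl : Real.log 2 ≤ Real.log n := Real.log_le_log (by norm_num) hn'
  have hc : (1 : ℝ) ≤ D.essentialGraph.numChainComponents := by
    have : Nonempty D.essentialGraph.ChainComponent := ⟨D.componentOf ⟨0, by omega⟩⟩
    exact_mod_cast Nat.card_pos (α := D.essentialGraph.ChainComponent)
  refine ⟨?_, hc⟩
  have hlog1 : (1 : ℝ) ≤ Nat.log 2 n := by exact_mod_cast Nat.log_pos Nat.one_lt_two hn
  have hlog2 : (Nat.log 2 n : ℝ) ≤ 3 / 2 * Real.log n := by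
    have h1 : ((2 : ℝ) ^ Nat.log 2 n) ≤ n := by
      exact_mod_cast Nat.pow_log_le_self 2 (by omega : n ≠ 0)
    have h3 := Real.log_le_log (by positivity) h1
    rw [Real.log_pow] at h3
    nlinarith
  have hd : (0 : ℝ) ≤ D.essentialGraph.maxChainDegree := Nat.cast_nonneg _
  rw [searchBound]
  push_cast
  set c : ℝ := ((D.essentialGraph.numChainComponents : ℕ) : ℝ)
  set d : ℝ := ((D.essentialGraph.maxChainDegree : ℕ) : ℝ)
  set l : ℝ := (Nat.log 2 n : ℝ)
  have h1 : c * (l + 1) ≤ c * (3 * Real.log n) :=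
    mul_le_mul_of_nonneg_left (by linarith) (by linarith)
  have h3 : (1 + d) * l ≤ (c + d) * (3 / 2 * Real.log n) :=
    mul_le_mul (by linarith) hlog2 (by linarith) (by linarith)
  nlinarith

theorem reps_le {n K : ℕ} {ε Δ δ : ℝ} (hn : 2 ≤ n) (hK : 0 < K) (hΔ : 0 < Δ) (hΔ1 : Δ ≤ 1)
    (hδ : 0 < δ) (hδ1 : δ < 1) :
    (reps n K ε Δ δ : ℝ) ≤ 258 * max (1 / Δ ^ 2) (1 / ε ^ 2) * Real.log n *
      (1 + Real.log (K / δ)) ∧ 0 < reps n K ε Δ δ := by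
  have hn' : (2 : ℝ) ≤ n := by exact_mod_cast hn
  have hK' : (1 : ℝ) ≤ K := by exact_mod_cast hK
  have h2 : (0.6931471803 : ℝ) < Real.log 2 := Real.log_two_gt_d9
  have hl : Real.log 2 ≤ Real.log n := Real.log_le_log (by norm_num) hn'
  have hKδ : 0 ≤ Real.log (K / δ) := Real.log_nonneg (by rw [le_div_iff₀ hδ]; linarith)
  set Q := max (1 / Δ ^ 2) (1 / ε ^ 2) with hQ
  have hQ1 : 1 ≤ Q := by
    refine le_trans ?_ (le_max_left _ _)
    rw [le_div_iff₀ (by positivity)]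
    nlinarith
  have hlog := log_eight_mul_le hn hK hδ hδ1
  have hpos1 : 0 < Real.log (8 * n * K / δ) := by
    refine Real.log_pos ?_
    rw [lt_div_iff₀ hδ]
    nlinarith
  have hle : Real.log (8 * n * K / δ) ≤ Real.log (8 * n ^ 2 * K ^ 2 / δ) := by
    refine Real.log_le_log (by positivity) ?_
    gcongr ?_ / δ
    have h3 : (n : ℝ) ≤ n ^ 2 := by nlinarith
    have h4 : (K : ℝ) ≤ K ^ 2 := by nlinarith
    have := mul_le_mul h3 h4 (by positivity) (by positivity)
    linarith
  set g := Real.log n * (1 + Real.log (K / δ)) with hg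
  have hg1 : 2 / 3 ≤ g := by nlinarith
  have hmax : max (32 / Δ ^ 2 * Real.log (8 * n * K / δ))
      (2 / ε ^ 2 * Real.log (8 * n ^ 2 * K ^ 2 / δ)) ≤ 256 * Q * g := by
    have hp2 := hpos1.trans_le hle
    -- The constant `256` below is `32 * 8`. Rounding up adds at most `1`, and `2 / 3 ≤ Q * g` lets
    -- `258` absorb it.
    have hlog' : Real.log (8 * n ^ 2 * K ^ 2 / δ) ≤ 8 * g := by rw [hg]; linarith
    refine max_le ?_ ?_
    · have h3 : 32 / Δ ^ 2 ≤ 32 * Q := by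
        have := le_max_left (1 / Δ ^ 2) (1 / ε ^ 2)
        rw [← hQ] at this
        calc 32 / Δ ^ 2 = 32 * (1 / Δ ^ 2) := by ring
          _ ≤ _ := by linarith
      calc _ ≤ 32 * Q * (8 * g) := mul_le_mul h3 (hle.trans hlog') hpos1.le (by positivity)
        _ = _ := by ring
    · have h3 : 2 / ε ^ 2 ≤ 32 * Q := by
        have := le_max_right (1 / Δ ^ 2) (1 / ε ^ 2)
        rw [← hQ] at this
        calc 2 / ε ^ 2 = 2 * (1 / ε ^ 2) := by ring
          _ ≤ _ := by linarith
      calc _ ≤ 32 * Q * (8 * g) := mul_le_mul h3 hlog' hp2.le (by positivity)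
        _ = _ := by ring
  have hpos : 0 < max (32 / Δ ^ 2 * Real.log (8 * n * K / δ))
      (2 / ε ^ 2 * Real.log (8 * n ^ 2 * K ^ 2 / δ)) :=
    lt_max_of_lt_left (by positivity)
  refine ⟨?_, Nat.ceil_pos.2 hpos⟩
  have := (Nat.ceil_lt_add_one hpos.le).le
  have hQg : 2 / 3 ≤ Q * g := by nlinarith
  calc (reps n K ε Δ δ : ℝ) ≤ _ := this
    _ ≤ 256 * Q * g + 1 := by linarith
    _ ≤ 258 * (Q * g) := by linarith
    _ = _ := by rw [hg]; ring

theorem blockStart_searchBound_le {n K : ℕ} (D : DAG n) {ε Δ δ : ℝ} (hn : 2 ≤ n) (hK : 0 < K)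
    (hΔ : 0 < Δ) (hΔ1 : Δ ≤ 1) (hδ : 0 < δ) (hδ1 : δ < 1) :
    (blockStart K (reps n K ε Δ δ) (searchBound D) : ℝ) ≤
      2000 * (K * max (1 / Δ ^ 2) (1 / ε ^ 2) *
        (D.essentialGraph.maxChainDegree + D.essentialGraph.numChainComponents) *
        Real.log n ^ 2 * (1 + Real.log (K / δ))) := by
  have hn' : (2 : ℝ) ≤ n := by exact_mod_cast hn
  have hK' : (1 : ℝ) ≤ K := by exact_mod_cast hK
  have h2 : (0.6931471803 : ℝ) < Real.log 2 := Real.log_two_gt_d9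
  have hl : Real.log 2 ≤ Real.log n := Real.log_le_log (by norm_num) hn'
  have hKδ : 0 ≤ Real.log (K / δ) := Real.log_nonneg (by rw [le_div_iff₀ hδ]; linarith)
  obtain ⟨hB, -⟩ := reps_le (ε := ε) hn hK hΔ hΔ1 hδ hδ1
  obtain ⟨hs, hc⟩ := searchBound_le D hn
  set Q := max (1 / Δ ^ 2) (1 / ε ^ 2) with hQ
  have hQ0 : 0 < Q := lt_max_of_lt_left (by positivity)
  set G : ℝ := D.essentialGraph.maxChainDegree + D.essentialGraph.numChainComponents with hG
  have hG1 : 1 ≤ G := by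
    have : (0 : ℝ) ≤ D.essentialGraph.maxChainDegree := Nat.cast_nonneg _
    linarith
  set S := K * Q * G * Real.log n ^ 2 * (1 + Real.log (K / δ)) with hS
  have hS0 : 0 ≤ S := by positivity
  simp only [blockStart]
  push_cast
  set b : ℝ := ((reps n K ε Δ δ : ℕ) : ℝ)
  set N : ℝ := ((searchBound D : ℕ) : ℝ)
  have hb0 : 0 ≤ b := Nat.cast_nonneg _
  -- The search accounts for `9 / 2`, and the initial rounds of `do()` for the remaining `3 / 2`,
  -- because `2 / 3 ≤ G * Real.log n`.
  have h1 : 1 + N * K ≤ 6 * (G * Real.log n * K) := by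
    have hGl : 2 / 3 ≤ G * Real.log n := by nlinarith
    have h4 : N * K ≤ 9 / 2 * G * Real.log n * K := mul_le_mul_of_nonneg_right hs (by linarith)
    nlinarith
  calc b + N * (K * b) = (1 + N * K) * b := by ring
    _ ≤ 6 * (G * Real.log n * K) * (258 * Q * Real.log n * (1 + Real.log (K / δ))) :=
        mul_le_mul h1 hB hb0 (by positivity)
    _ = 1548 * S := by rw [hS]; ring
    _ ≤ 2000 * S := by linarith

theorem exploration_width_le {K T : ℕ} {δ : ℝ} (hK : 0 < K) (hT : 0 < T) (hδ : 0 < δ)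
    (hδ1 : δ < 1) :
    1 ≤ Real.log (1 / (δ / (32 * K * T))) ∧
    6 * √(2 * Real.log (1 / (δ / (32 * K * T)))) * √(K * T) ≤
      2000 * √(K * T * (1 + Real.log (K * T / δ))) := by
  have hK' : (1 : ℝ) ≤ K := by exact_mod_cast hK
  have hT' : (1 : ℝ) ≤ T := by exact_mod_cast hT
  have h2 : (0.6931471803 : ℝ) < Real.log 2 := Real.log_two_gt_d9
  set L := Real.log (1 / (δ / (32 * K * T))) with hL
  have hKT : 1 ≤ (K : ℝ) * T := by nlinarith
  have hKTδ : 0 ≤ Real.log (K * T / δ) := Real.log_nonneg (by rw [le_div_iff₀ hδ]; linarith)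
  have h32 : Real.log 32 = 5 * Real.log 2 := by
    rw [show (32 : ℝ) = 2 ^ 5 by norm_num, Real.log_pow]
    norm_num
  have hL' : L = 5 * Real.log 2 + Real.log (K * T / δ) := by
    rw [hL, ← h32, ← Real.log_mul (by norm_num) (by positivity)]
    congr 1
    field_simp
  have hlog2 := Real.log_two_lt_d9
  have hL1 : 1 ≤ L := by rw [hL']; linarith
  have hL4 : L ≤ 4 * (1 + Real.log (K * T / δ)) := by rw [hL']; linarith
  refine ⟨hL1, ?_⟩
  rw [mul_assoc, ← Real.sqrt_mul (by linarith)]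
  have h1 : √(2 * L * (K * T)) ≤ √(3 ^ 2 * (K * T * (1 + Real.log (K * T / δ)))) := by
    refine Real.sqrt_le_sqrt ?_
    nlinarith
  have e : √(3 ^ 2 * (K * T * (1 + Real.log (K * T / δ)))) =
      3 * √(K * T * (1 + Real.log (K * T / δ))) := by
    rw [Real.sqrt_mul (by norm_num), Real.sqrt_sq (by norm_num)]
  rw [e] at h1
  linarith [Real.sqrt_nonneg (K * T * (1 + Real.log (K * T / δ)))]

end CNUCB

/-- The gap at `X_R` itself is a difference of two means in `[0, 1]`. The bound on `Δ` allows
rounding errors to be absorbed into `1 / Δ ^ 2`. -/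
theorem CausalBandit.le_one_of_rewardIdentifiable {n K : ℕ} {M : CausalBandit n K} {Δ : ℝ}
    (hR : M.RewardModel) (h : M.RewardIdentifiable Δ) : 0 < K ∧ Δ ≤ 1 := by
  obtain ⟨x, hx⟩ := h M.rewardVar .refl
  have hK : 0 < K := x.pos
  refine ⟨hK, hx.trans ?_⟩
  have h1 := hR.mean_mem_Icc hK none
  have h2 := hR.mean_mem_Icc hK (some (M.rewardVar, x))
  rw [abs_le]
  constructor <;> linarith [h1.1, h1.2, h2.1, h2.2]

/-! ### The high-probability regret bound -/

theorem theorem2 :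
    ∃ C : ℝ, 0 < C ∧
      ∀ (n K : ℕ) (M : CausalBandit n K) (ε Δ δ : ℝ),
        2 ≤ n → 0 < ε → 0 < Δ → 0 < δ → δ < 1 →
        M.RewardModel → M.D.IsCausalForest →
        M.Faithful → M.EffectIdentifiable ε → M.RewardIdentifiable Δ →
        (∃ order, M.D.essentialGraph.SinksFirst order) ∧
        ∀ order, M.D.essentialGraph.SinksFirst order →
        ∀ (T : ℕ) (Ω : Type*) [mΩ : MeasurableSpace Ω] (P : Measure Ω) [IsProbabilityMeasure P]
          (ℱ : Filtration ℕ mΩ) (A : ℕ → Ω → Intervention n K)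
          (X : ℕ → Ω → Fin n → Fin K) (R : ℕ → Ω → ℝ)
          (σ : ℕ → Ω → CNUCB.Phase M.D.essentialGraph),
          CNUCB.IsRun M ε Δ δ order T P ℱ A X R σ →
          ENNReal.ofReal (1 - δ) ≤ P {ω | M.regret T (fun t => A t ω) ≤
            C * (K * max (1 / Δ ^ 2) (1 / ε ^ 2)
                  * (M.D.essentialGraph.maxChainDegree + M.D.essentialGraph.numChainComponents)
                  * Real.log n ^ 2 * (1 + Real.log (K / δ))
                + √(K * T * (1 + Real.log (K * T / δ))))} := by
  refine ⟨2000, by norm_num, ?_⟩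
  intro n K M ε Δ δ hn hε hΔ hδ hδ1 hR hf _ hE hI
  refine ⟨M.D.exists_sinksFirst, ?_⟩
  intro order ho T Ω mΩ P _ ℱ A X R σ h
  obtain ⟨hK, hΔ1⟩ := CausalBandit.le_one_of_rewardIdentifiable hR hI
  obtain ⟨-, hB0⟩ := CNUCB.reps_le (ε := ε) hn hK hΔ hΔ1 hδ hδ1
  have hsearch := CNUCB.blockStart_searchBound_le M.D (ε := ε) hn hK hΔ hΔ1 hδ hδ1
  set G := K * max (1 / Δ ^ 2) (1 / ε ^ 2) *
    (M.D.essentialGraph.maxChainDegree + M.D.essentialGraph.numChainComponents) *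
    Real.log n ^ 2 * (1 + Real.log (K / δ)) with hG
  rcases Nat.eq_zero_or_pos T with rfl | hT
  · have hG0 : 0 ≤ 2000 * G := (Nat.cast_nonneg _).trans hsearch
    have : {ω | M.regret 0 (fun t => A t ω) ≤ 2000 * (G +
        √(K * (0 : ℕ) * (1 + Real.log (K * (0 : ℕ) / δ))))} = Set.univ := by
      refine Set.eq_univ_of_forall fun ω => ?_
      simp only [Set.mem_ofPred_eq, CausalBandit.regret]
      simpa using hG0
    rw [this, measure_univ]
    exact ENNReal.ofReal_le_one.2 (by linarith)
  obtain ⟨hL1, hwidth⟩ := CNUCB.exploration_width_le hK hT hδ hδ1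
  obtain ⟨bad, hbad, hgood⟩ :=
    CNUCB.le_measure_accurate h hn hK hT hε hΔ hδ hR hB0 rfl (by linarith)
  have hsub : badᶜ ⊆ {ω | M.regret T (fun t => A t ω) ≤ 2000 * (G +
      √(K * T * (1 + Real.log (K * T / δ))))} := by
    intro ω hω
    have hω' : M.regret T (fun t => A t ω) ≤
        CNUCB.blockStart K (CNUCB.reps n K ε Δ δ) (CNUCB.searchBound M.D) +
          6 * √(2 * Real.log (1 / (δ / (32 * K * T)))) * √(K * T) :=
      CNUCB.regret_le_of_accurate (X := fun t => X t ω) (R := fun t => R t ω)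
        (σ := fun j => σ j ω) hK hB0 hR hf hE hI ho rfl hL1 (hgood ω hω)
        (h.observe ω) (h.init ω) (h.step ω) (h.explore ω) (h.exploit ω)
    refine hω'.trans ((add_le_add hsearch hwidth).trans_eq (mul_add _ _ _).symm)
  -- Subadditivity yields the lower bound without measurability of the event or of `bad`.
  have huniv : (1 : ENNReal) ≤ P {ω | M.regret T (fun t => A t ω) ≤ 2000 * (G +
      √(K * T * (1 + Real.log (K * T / δ))))} + P bad := by
    rw [← measure_univ (μ := P)]
    refine le_trans (measure_mono fun ω _ => ?_) (measure_union_le _ _)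
    by_cases hω : ω ∈ bad
    · exact .inr hω
    · exact .inl (hsub hω)
  rw [ENNReal.ofReal_sub _ hδ.le, ENNReal.ofReal_one, tsub_le_iff_right]
  exact huniv.trans (add_le_add_right hbad _)
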